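/- Let $N\ge 2$, let $\Omega\subset\mathbb R^N$ be a bounded open set containing the origin, let $0<\lambda<N-1$ and $f\in L^N(\Omega)$. Let $1^*=N/(N-1)$ and let $$S_N=\sup_{0\ne u\in W^{1,1}(\mathbb R^N)}\frac{\|u\|_{L^{1^*}(\mathbb R^N)}}{\|\nabla u\|_{L^1(\mathbb R^N)}}$$ be the best constant in the Sobolev inequality. Let $\bar p\in(1,N)$ be such that $\lambda<\left(\frac{N-p}{p}\right)^p$ for all $p\in(1,\bar p]$, and for every $p\in(1,\bar p]$ let $u_p\in W^{1,p}_0(\Omega)$ be a weak solution of $$-\Delta_p u_p=\frac{\lambda}{|x|^p}|u_p|^{p-2}u_p+f\ \text{ in }\Omega,\qquad u_p=0\ \text{ on }\partial\Omega,$$ that is, $$\int_\Omega|\nabla u_p|^{p-2}\nabla u_p\cdot\nabla\varphi\,dx=\lambda\int_\Omega\frac{|u_p|^{p-2}u_p\,\varphi}{|x|^p}\,dx+\int_\Omega f\varphi\,dx\qquad\text{for all }\varphi\in W^{1,p}_0(\Omega).$$ (Strict case.) If $\|f\|_{L^N(\Omega)}S_N+\frac{\lambda}{N-1}<1$, then $u_p\to0$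 in $L^{1^*}(\Omega)$ as $p\to1^+$, and $u_p\to 0$ a.e. in $\Omega$ as $p\to1^+$, in the sense that $u_{p_n}(x)\to0$ for a.e. $x\in\Omega$ for every sequence $p_n\to1^+$. (Extreme case.) If $\|f\|_{L^N(\Omega)}S_N+\frac{\lambda}{N-1}=1$, then there is a constant $C$ with $\int_\Omega|\nabla u_p|^p\,dx\le C$ for all $p\in(1,\bar p]$, and every sequence $p_n\to1^+$ has a subsequence along which, for some $u\in BV(\Omega)$, $u_{p_n}\to u$ in $L^s(\Omega)$ for every $s\in[1,1^*)$. -/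

import Mathlib

open MeasureTheory Filter Topology
open scoped ENNReal ContDiff

namespace HardyOneLaplace

/-- Euclidean space of dimension `N`. -/
abbrev E (N : ℕ) : Type := EuclideanSpace ℝ (Fin N)

/-- `φ ∈ C_c^∞(Ω)`. -/
def IsTestFunction {N : ℕ} (Ω : Set (E N)) (φ : E N → ℝ) : Prop :=
  ContDiff ℝ ∞ φ ∧ HasCompactSupport φ ∧ tsupport φ ⊆ Ω

/-- `u ∈ W^{1,p}(Ω)`, with distributional gradient `Du ∈ L^p(Ω; ℝ^N)`. -/
structure MemW1p {N : ℕ} (Ω : Set (E N)) (p : ℝ) (u : E N → ℝ) (Du : E N → E N) : Prop where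
  memLp : MemLp u (ENNReal.ofReal p) (volume.restrict Ω)
  memLp_grad : MemLp Du (ENNReal.ofReal p) (volume.restrict Ω)
  weak_grad : ∀ φ : E N → ℝ, IsTestFunction Ω φ → ∀ v : E N,
    ∫ x in Ω, u x * fderiv ℝ φ x v = - ∫ x in Ω, inner ℝ (Du x) v * φ x

/-- `u ∈ W_0^{1,p}(Ω)`, with gradient `Du`: the closure of `C_c^∞(Ω)` in `W^{1,p}(Ω)`. -/
structure MemW1p0 {N : ℕ} (Ω : Set (E N)) (p : ℝ) (u : E N → ℝ) (Du : E N → E N) : Prop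
    extends MemW1p Ω p u Du where
  approx : ∃ φ : ℕ → E N → ℝ, (∀ n, IsTestFunction Ω (φ n)) ∧
    Tendsto (fun n => eLpNorm (fun x => φ n x - u x) (ENNReal.ofReal p) (volume.restrict Ω))
      atTop (𝓝 0) ∧
    Tendsto (fun n => eLpNorm (fun x => gradient (φ n) x - Du x) (ENNReal.ofReal p)
      (volume.restrict Ω)) atTop (𝓝 0)

/-- The best constant in the Sobolev inequality
`‖u‖_{L^{N/(N-1)}(ℝ^N)} ≤ S ‖∇u‖_{L^1(ℝ^N)}`, `u ∈ W^{1,1}(ℝ^N)`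
(the function `u = 0` contributes `0 / 0 = 0` to the supremum). -/
noncomputable def sobolevConst (N : ℕ) : ℝ≥0∞ :=
  ⨆ (u : E N → ℝ) (Du : E N → E N) (_ : MemW1p Set.univ 1 u Du),
    eLpNorm u (ENNReal.ofReal ((N : ℝ) / ((N : ℝ) - 1))) volume / eLpNorm Du 1 volume

/-- `u ∈ W_0^{1,p}(Ω)`, with gradient `Du`, is a weak solution of
`-Δ_p u = (lam / |x|^p) |u|^{p-2} u + f` in `Ω`, `u = 0` on `∂Ω`;
the test functions range over all of `W_0^{1,p}(Ω)`. -/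
structure IsWeakSolution {N : ℕ} (Ω : Set (E N)) (lam : ℝ) (f : E N → ℝ) (p : ℝ)
    (u : E N → ℝ) (Du : E N → E N) : Prop where
  mem : MemW1p0 Ω p u Du
  weak_eq : ∀ (φ : E N → ℝ) (Dφ : E N → E N), MemW1p0 Ω p φ Dφ →
    ∫ x in Ω, ‖Du x‖ ^ (p - 2) * inner ℝ (Du x) (Dφ x) =
      lam * (∫ x in Ω, 1 / ‖x‖ ^ p * (|u x| ^ (p - 2) * u x) * φ x) + ∫ x in Ω, f x * φ x

/-- The divergence of a vector field. -/
noncomputable def divergence {N : ℕ} (ψ : E N → E N) (x : E N) : ℝ :=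
  ∑ i : Fin N, fderiv ℝ ψ x (EuclideanSpace.single i 1) i

/-- The total variation `|Du|(Ω)`: the supremum of `∫_Ω u div ψ` over the
`ψ ∈ C_c^1(Ω; ℝ^N)` with `‖ψ‖_∞ ≤ 1`. -/
noncomputable def totalVariation {N : ℕ} (Ω : Set (E N)) (u : E N → ℝ) : ℝ≥0∞ :=
  ⨆ (ψ : E N → E N) (_ : ContDiff ℝ 1 ψ ∧ HasCompactSupport ψ ∧ tsupport ψ ⊆ Ω ∧ ∀ x, ‖ψ x‖ ≤ 1),
    ENNReal.ofReal (∫ x in Ω, u x * divergence ψ x)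

/-- `u ∈ BV(Ω)`. -/
def MemBV {N : ℕ} (Ω : Set (E N)) (u : E N → ℝ) : Prop :=
  MemLp u 1 (volume.restrict Ω) ∧ totalVariation Ω u < ⊤

end HardyOneLaplace

/-! Write c = ‖f‖_N S_N and H_p = (p/(N-p))^p, the Hardy constant, which tends to 1/(N-1) as p → 1.
Testing the equation with u_p and using Hardy for the potential, Hölder and Sobolev for the source
gives (1 - λ H_p) ∫|∇u|^p ≤ c ∫|∇u|, and Hölder on Ω turns this into ∫|∇u|^p ≤ (c/(1 - λ
H_p))^{p/(p-1)} |Ω| (`IsWeakSolution.energy_le`). The exponent blows up as p → 1, so everything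
depends on the limit c/(1 - λ/(N-1)) of the base.

Strict case: the limit is below 1, the energy tends to 0, hence so do the L¹ norm of the gradient
and, by Sobolev, the L^{1*} norm of u_p. Convergence a.e. along every sequence needs a pointwise
bound. The barrier is |x|^{-2N}: a singular one, for which both |∇h|^p and the potential term are
controlled by (h/|x|)^p. Testing with a smooth truncation of u - K h_ε, where h_ε is a smooth
regularization, bounds the L^{1*} norm of the truncation by the (h_ε/|x|)^p-mass of {u > K h_ε}; the
leading coefficient tends to 1 - λ/(N-1) - c > 0, which is exactly strictness. The power 2N is large
enough for (h/|x|)^p to be dominated by h^{1*}, so a De Giorgi iteration over K from 1 to 2 applies;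
its initial mass is small because the energy is. Hence u < 2|x|^{-2N} for p near 1, uniformly over
all weak solutions (`eventually_ae_lt_barrier`). Homogeneity then upgrades a bound to decay: for
some κ < 1 the datum f/κ is still strict, and u/κ^{1/(p-1)} solves the equation with that datum, so
|u| ≤ 2 κ^{1/(p-1)} |x|^{-2N} (`exists_eventually_ae_abs_le`).

Extreme case: the base equals 1 at p = 1 and its logarithm is differentiable there, so
log(base)/(p-1) stays bounded on (1, p̄] and with it the energy (`exists_energy_bound`). The
gradients are then bounded in L¹, and a Rellich argument in W^{1,1}, lower semicontinuity of the
variation and interpolation with the L^{1*} bound give the subsequence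
(`exists_strictMono_tendsto_memBV`). -/

namespace HardyOneLaplace

/-! ### Test functions, integration by parts and density in W_0^{1,p}. -/

section Basics

variable {N : ℕ} {Ω : Set (E N)}

theorem norm_gradient (φ : E N → ℝ) (x : E N) : ‖gradient φ x‖ = ‖fderiv ℝ φ x‖ := by
  simp [gradient]

theorem inner_gradient (φ : E N → ℝ) (x v : E N) :
    inner ℝ (gradient φ x) v = fderiv ℝ φ x v := by
  simp [gradient]

theorem isFiniteMeasure_restrict_of_isBounded (hΩ : Bornology.IsBounded Ω) :
    IsFiniteMeasure (volume.restrict Ω) :=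
  ⟨by simpa using hΩ.measure_lt_top⟩

theorem continuous_gradient {φ : E N → ℝ} (hφ : ContDiff ℝ 1 φ) : Continuous (gradient φ) :=
  (InnerProductSpace.toDual ℝ (E N)).symm.continuous.comp (hφ.continuous_fderiv one_ne_zero)

theorem hasCompactSupport_gradient {φ : E N → ℝ} (hφ : HasCompactSupport φ) :
    HasCompactSupport (gradient φ) :=
  (hφ.fderiv ℝ).comp_left (map_zero _)

theorem gradient_eq_zero_of_notMem_tsupport {φ : E N → ℝ} {x : E N} (hx : x ∉ tsupport φ) :
    gradient φ x = 0 := by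
  rw [gradient, fderiv_of_notMem_tsupport ℝ hx, map_zero]

theorem IsTestFunction.contDiff_one {φ : E N → ℝ} (h : IsTestFunction Ω φ) : ContDiff ℝ 1 φ :=
  h.1.of_le (by exact_mod_cast le_top)

theorem IsTestFunction.eq_zero {φ : E N → ℝ} (h : IsTestFunction Ω φ) {x : E N} (hx : x ∉ Ω) :
    φ x = 0 :=
  image_eq_zero_of_notMem_tsupport fun hx' => hx (h.2.2 hx')

theorem IsTestFunction.gradient_eq_zero {φ : E N → ℝ} (h : IsTestFunction Ω φ) {x : E N}
    (hx : x ∉ Ω) : gradient φ x = 0 :=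
  gradient_eq_zero_of_notMem_tsupport fun hx' => hx (h.2.2 hx')

theorem IsTestFunction.memLp {φ : E N → ℝ} (h : IsTestFunction Ω φ) (q : ℝ≥0∞)
    (μ : Measure (E N)) [IsFiniteMeasureOnCompacts μ] : MemLp φ q μ :=
  h.1.continuous.memLp_of_hasCompactSupport h.2.1

theorem IsTestFunction.memLp_gradient {φ : E N → ℝ} (h : IsTestFunction Ω φ) (q : ℝ≥0∞)
    (μ : Measure (E N)) [IsFiniteMeasureOnCompacts μ] : MemLp (gradient φ) q μ :=
  (continuous_gradient h.contDiff_one).memLp_of_hasCompactSupport (hasCompactSupport_gradient h.2.1)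

theorem IsTestFunction.eLpNorm_gradient_restrict {φ : E N → ℝ} (h : IsTestFunction Ω φ)
    (q : ℝ≥0∞) :
    eLpNorm (gradient φ) q (volume.restrict Ω) = eLpNorm (gradient φ) q volume :=
  eLpNorm_restrict_eq_of_support_subset fun x hx => by
    by_contra hx'
    exact hx (h.gradient_eq_zero hx')

/-- Integration by parts for a compactly supported `C¹` function. -/
theorem integral_mul_fderiv_eq_neg {φ ψ : E N → ℝ} (hφ : ContDiff ℝ 1 φ)
    (hφc : HasCompactSupport φ) (hψ : ContDiff ℝ 1 ψ) (v : E N) :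
    ∫ x, φ x * fderiv ℝ ψ x v = - ∫ x, fderiv ℝ φ x v * ψ x := by
  have hφ' : Continuous fun x => fderiv ℝ φ x v :=
    (hφ.continuous_fderiv one_ne_zero).clm_apply continuous_const
  have hψ' : Continuous fun x => fderiv ℝ ψ x v :=
    (hψ.continuous_fderiv one_ne_zero).clm_apply continuous_const
  have hφc' : HasCompactSupport fun x => fderiv ℝ φ x v :=
    (hφc.fderiv ℝ).comp_left (g := fun L : E N →L[ℝ] ℝ => L v) rfl
  refine integral_mul_fderiv_eq_neg_fderiv_mul_of_integrable ?_ ?_ ?_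
    (fun x _ => hφ.differentiable one_ne_zero x) (fun x _ => hψ.differentiable one_ne_zero x)
  · exact (hφ'.mul hψ.continuous).integrable_of_hasCompactSupport hφc'.mul_right
  · exact (hφ.continuous.mul hψ').integrable_of_hasCompactSupport hφc.mul_right
  · exact (hφ.continuous.mul hψ.continuous).integrable_of_hasCompactSupport hφc.mul_right

/-- Integration by parts on `Ω` for a test function. -/
theorem IsTestFunction.setIntegral_mul_fderiv {φ ψ : E N → ℝ} (hφ : IsTestFunction Ω φ)
    (hψ : ContDiff ℝ 1 ψ) (v : E N) :
    ∫ x in Ω, φ x * fderiv ℝ ψ x v = - ∫ x in Ω, inner ℝ (gradient φ x) v * ψ x := by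
  rw [setIntegral_eq_integral_of_forall_compl_eq_zero fun x hx => by simp [hφ.eq_zero hx],
    setIntegral_eq_integral_of_forall_compl_eq_zero fun x hx => by simp [hφ.gradient_eq_zero hx],
    integral_mul_fderiv_eq_neg hφ.contDiff_one hφ.2.1 hψ]
  simp_rw [inner_gradient]

/-- On a finite measure space, convergence in `L^p` implies convergence in `L^q` for `q ≤ p`. -/
theorem tendsto_eLpNorm_zero_of_exponent_le {α F : Type*} [MeasurableSpace α] {μ : Measure α}
    [IsFiniteMeasure μ] [NormedAddCommGroup F] {ι : Type*} {l : Filter ι} {f : ι → α → F}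
    {p q : ℝ≥0∞} (hqp : q ≤ p) (hf : ∀ i, AEStronglyMeasurable (f i) μ)
    (h : Tendsto (fun i => eLpNorm (f i) p μ) l (𝓝 0)) (hq : q ≠ 0) :
    Tendsto (fun i => eLpNorm (f i) q μ) l (𝓝 0) := by
  have hC : μ Set.univ ^ (1 / q.toReal - 1 / p.toReal) ≠ ⊤ := by
    rcases eq_or_ne q ⊤ with rfl | hq'
    · simp [top_le_iff.mp hqp]
    refine ENNReal.rpow_ne_top_of_nonneg ?_ (measure_ne_top _ _)
    rw [sub_nonneg]
    rcases eq_or_ne p ⊤ with rfl | hp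
    · simp
    exact one_div_le_one_div_of_le (ENNReal.toReal_pos hq hq') (ENNReal.toReal_mono hp hqp)
  refine tendsto_of_tendsto_of_tendsto_of_le_of_le tendsto_const_nhds
    (by simpa using ENNReal.Tendsto.mul_const h (Or.inr hC)) (fun _ => zero_le)
    (fun i => eLpNorm_le_eLpNorm_mul_rpow_measure_univ hqp (hf i))

/-- Integrals against a bounded function pass to the limit under `L¹` convergence. -/
theorem tendsto_integral_mul_of_tendsto_eLpNorm {α : Type*} [MeasurableSpace α] {μ : Measure α}
    {f : ℕ → α → ℝ} {f₀ g : α → ℝ} {C : ℝ}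
    (hf : ∀ n, Integrable (f n) μ) (hf₀ : Integrable f₀ μ)
    (h : Tendsto (fun n => eLpNorm (fun x => f n x - f₀ x) 1 μ) atTop (𝓝 0))
    (hg : AEStronglyMeasurable g μ) (hgC : ∀ x, ‖g x‖ ≤ C) :
    Tendsto (fun n => ∫ x, f n x * g x ∂μ) atTop (𝓝 (∫ x, f₀ x * g x ∂μ)) := by
  refine tendsto_integral_of_L1' _ (hf₀.mul_bdd hg (ae_of_all _ hgC)).aestronglyMeasurable
    (Eventually.of_forall fun n => (hf n).mul_bdd hg (ae_of_all _ hgC)) ?_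
  refine tendsto_of_tendsto_of_tendsto_of_le_of_le tendsto_const_nhds
    (by simpa using ENNReal.Tendsto.const_mul h (Or.inr (ENNReal.ofReal_ne_top (r := C))))
    (fun _ => zero_le) (fun n => ?_)
  refine eLpNorm_le_mul_eLpNorm_of_ae_le_mul (ae_of_all _ fun x => ?_) 1
  simp only [Pi.sub_apply]
  rw [← sub_mul, norm_mul, mul_comm]
  gcongr
  exact hgC x

theorem tendsto_eLpNorm_inner_sub {α : Type*} [MeasurableSpace α] {μ : Measure α} {p : ℝ≥0∞}
    {F : ℕ → α → E N} {F₀ : α → E N} (v : E N)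
    (h : Tendsto (fun n => eLpNorm (fun x => F n x - F₀ x) p μ) atTop (𝓝 0)) :
    Tendsto (fun n => eLpNorm (fun x => inner ℝ (F n x) v - inner ℝ (F₀ x) v) p μ)
      atTop (𝓝 0) := by
  refine tendsto_of_tendsto_of_tendsto_of_le_of_le tendsto_const_nhds
    (by simpa only [mul_zero] using
      ENNReal.Tendsto.const_mul h (Or.inr (ENNReal.ofReal_ne_top (r := ‖v‖))))
    (fun _ => zero_le) (fun n => ?_)
  refine eLpNorm_le_mul_eLpNorm_of_ae_le_mul (f := fun x => inner ℝ (F n x) v - inner ℝ (F₀ x) v)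
    (g := fun x => F n x - F₀ x) (ae_of_all _ fun x => ?_) p
  rw [← inner_sub_left, mul_comm ‖v‖]
  exact norm_inner_le_norm (𝕜 := ℝ) _ _

/-- Limits of test functions in `W^{1,p}(Ω)` belong to `W_0^{1,p}(Ω)`. -/
theorem memW1p0_of_tendsto (hΩ : Bornology.IsBounded Ω) {p : ℝ} (hp : 1 ≤ p)
    {w : E N → ℝ} {Dw : E N → E N} (hw : MemLp w (ENNReal.ofReal p) (volume.restrict Ω))
    (hDw : MemLp Dw (ENNReal.ofReal p) (volume.restrict Ω)) {φ : ℕ → E N → ℝ}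
    (hφ : ∀ n, IsTestFunction Ω (φ n))
    (h0 : Tendsto (fun n => eLpNorm (fun x => φ n x - w x) (ENNReal.ofReal p)
      (volume.restrict Ω)) atTop (𝓝 0))
    (h1 : Tendsto (fun n => eLpNorm (fun x => gradient (φ n) x - Dw x) (ENNReal.ofReal p)
      (volume.restrict Ω)) atTop (𝓝 0)) : MemW1p0 Ω p w Dw := by
  have := isFiniteMeasure_restrict_of_isBounded hΩ
  have hp' : (1 : ℝ≥0∞) ≤ ENNReal.ofReal p := by simpa using ENNReal.ofReal_le_ofReal hp
  refine ⟨⟨hw, hDw, fun ψ hψ v => ?_⟩, φ, hφ, h0, h1⟩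
  have e0 := tendsto_eLpNorm_zero_of_exponent_le hp'
    (fun n => ((hφ n).memLp 1 _).1.sub hw.1) h0 one_ne_zero
  have e1 := tendsto_eLpNorm_inner_sub v <| tendsto_eLpNorm_zero_of_exponent_le hp'
    (fun n => ((hφ n).memLp_gradient 1 _).1.sub hDw.1) h1 one_ne_zero
  have hψ' : Continuous fun x => fderiv ℝ ψ x v :=
    (hψ.contDiff_one.continuous_fderiv one_ne_zero).clm_apply continuous_const
  have hψc' : HasCompactSupport fun x => fderiv ℝ ψ x v :=
    (hψ.2.1.fderiv ℝ).comp_left (g := fun L : E N →L[ℝ] ℝ => L v) rfl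
  obtain ⟨C0, hC0⟩ := hψc'.exists_bound_of_continuous hψ'
  obtain ⟨C1, hC1⟩ := hψ.2.1.exists_bound_of_continuous hψ.1.continuous
  have t0 := tendsto_integral_mul_of_tendsto_eLpNorm
    (fun n => memLp_one_iff_integrable.mp ((hφ n).memLp 1 _)) (hw.integrable hp') e0
    hψ'.aestronglyMeasurable hC0
  have t1 := tendsto_integral_mul_of_tendsto_eLpNorm
    (fun n => (memLp_one_iff_integrable.mp ((hφ n).memLp_gradient 1 _)).inner_const v)
    ((hDw.integrable hp').inner_const v) e1
    hψ.1.continuous.aestronglyMeasurable hC1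
  refine tendsto_nhds_unique t0 ?_
  simp_rw [fun n => (hφ n).setIntegral_mul_fderiv hψ.contDiff_one v]
  exact t1.neg

/-- A test function belongs to `W^{1,1}(ℝ^N)`. -/
theorem IsTestFunction.memW1p_univ {φ : E N → ℝ} (hφ : IsTestFunction Ω φ) :
    MemW1p Set.univ 1 φ (gradient φ) := by
  refine ⟨hφ.memLp _ _, hφ.memLp_gradient _ _, fun ψ hψ v => ?_⟩
  simp_rw [Measure.restrict_univ, inner_gradient]
  exact integral_mul_fderiv_eq_neg hφ.contDiff_one hφ.2.1 hψ.contDiff_one v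

/-- Functions in `W_0^{1,p}(Ω)` are limits of test functions, in norm and almost everywhere. -/
theorem MemW1p0.exists_approx_ae {p : ℝ} (hp : 0 < p) {u : E N → ℝ} {Du : E N → E N}
    (hu : MemW1p0 Ω p u Du) : ∃ φ : ℕ → E N → ℝ, (∀ n, IsTestFunction Ω (φ n)) ∧
      Tendsto (fun n => eLpNorm (fun x => φ n x - u x) (ENNReal.ofReal p) (volume.restrict Ω))
        atTop (𝓝 0) ∧
      Tendsto (fun n => eLpNorm (fun x => gradient (φ n) x - Du x) (ENNReal.ofReal p)
        (volume.restrict Ω)) atTop (𝓝 0) ∧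
      ∀ᵐ x ∂(volume.restrict Ω), Tendsto (fun n => φ n x) atTop (𝓝 (u x)) := by
  obtain ⟨φ, hφ, h0, h1⟩ := hu.approx
  have hm := tendstoInMeasure_of_tendsto_eLpNorm (f := φ) (g := u)
    (p := ENNReal.ofReal p) (by simpa using hp) (fun n => ((hφ n).memLp 1 _).1)
    hu.memLp.1 h0
  obtain ⟨ns, hns, hae⟩ := hm.exists_seq_tendsto_ae
  exact ⟨fun n => φ (ns n), fun n => hφ _, h0.comp hns.tendsto_atTop, h1.comp hns.tendsto_atTop, hae⟩

/-- A weighted Gagliardo-Nirenberg type inequality on test functions extends to `W_0^{1,p}(Ω)`. -/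
theorem MemW1p0.eLpNorm_mul_le (hΩ : Bornology.IsBounded Ω) {p : ℝ} (hp : 1 ≤ p) {u : E N → ℝ}
    {Du : E N → E N} (hu : MemW1p0 Ω p u Du) {q r : ℝ≥0∞} (hr : 1 ≤ r)
    (hrp : r ≤ ENNReal.ofReal p) {C : ℝ≥0∞} (hC : C ≠ ⊤) {g : E N → ℝ} (hg : Measurable g)
    (h : ∀ φ : E N → ℝ, IsTestFunction Ω φ → eLpNorm (fun x => g x * φ x) q (volume.restrict Ω) ≤
      C * eLpNorm (gradient φ) r (volume.restrict Ω)) :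
    eLpNorm (fun x => g x * u x) q (volume.restrict Ω) ≤
      C * eLpNorm Du r (volume.restrict Ω) := by
  have := isFiniteMeasure_restrict_of_isBounded hΩ
  obtain ⟨φ, hφ, -, h1, hae⟩ := hu.exists_approx_ae (by linarith)
  have e1 := tendsto_eLpNorm_zero_of_exponent_le hrp
    (fun n => ((hφ n).memLp_gradient (ENNReal.ofReal p) _).1.sub hu.memLp_grad.1) h1
    (by positivity)
  have t1 : Tendsto (fun n => C * (eLpNorm Du r (volume.restrict Ω) +
      eLpNorm (fun x => gradient (φ n) x - Du x) r (volume.restrict Ω))) atTop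
      (𝓝 (C * eLpNorm Du r (volume.restrict Ω))) := by
    have := ENNReal.Tendsto.const_mul (tendsto_const_nhds (x := eLpNorm Du r (volume.restrict Ω))
      |>.add e1) (Or.inr hC)
    rwa [add_zero] at this
  -- Fatou on the left along an a.e. convergent approximation, so no a priori finiteness of the
  -- weighted norm is needed. The weight is |x|⁻¹ for Hardy and 1 for Sobolev.
  refine (Lp.eLpNorm_lim_le_liminf_eLpNorm (f := fun n x => g x * φ n x)
    (fun n => (hg.aestronglyMeasurable.mul ((hφ n).memLp 1 _).1)) _
    (hae.mono fun x hx => hx.const_mul _)).trans ?_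
  rw [← t1.liminf_eq]
  refine liminf_le_liminf (Eventually.of_forall fun n => (h _ (hφ n)).trans ?_)
  gcongr
  calc eLpNorm (gradient (φ n)) r (volume.restrict Ω)
      = eLpNorm (Du + fun x => gradient (φ n) x - Du x) r (volume.restrict Ω) := by
        congr 1; ext x; simp
    _ ≤ _ := eLpNorm_add_le hu.memLp_grad.1
        (((hφ n).memLp_gradient (ENNReal.ofReal p) _).1.sub hu.memLp_grad.1) hr

end Basics

/-! ### Homogeneity of the equation. -/

section Scaling

variable {N : ℕ} {Ω : Set (E N)}

theorem IsTestFunction.const_mul {φ : E N → ℝ} (h : IsTestFunction Ω φ) (c : ℝ) :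
    IsTestFunction Ω fun x => c * φ x :=
  ⟨contDiff_const.mul h.1, h.2.1.mul_left, (tsupport_mul_subset_right).trans h.2.2⟩

theorem gradient_const_mul {φ : E N → ℝ} {x : E N} (h : DifferentiableAt ℝ φ x) (c : ℝ) :
    gradient (fun y => c * φ y) x = c • gradient φ x := by
  simp [gradient, fderiv_const_mul h]

theorem MemW1p0.const_mul {p : ℝ} {u : E N → ℝ} {Du : E N → E N} (hu : MemW1p0 Ω p u Du)
    (c : ℝ) : MemW1p0 Ω p (fun x => c * u x) (fun x => c • Du x) := by
  refine ⟨⟨hu.memLp.const_mul c, hu.memLp_grad.const_smul c, fun φ hφ v => ?_⟩, ?_⟩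
  · simp_rw [mul_assoc, inner_smul_left, mul_assoc]
    rw [integral_const_mul, integral_const_mul, hu.weak_grad φ hφ v]
    simp
  · obtain ⟨φ, hφ, h0, h1⟩ := hu.approx
    refine ⟨fun n x => c * φ n x, fun n => (hφ n).const_mul c, ?_, ?_⟩
    · have : ∀ n, (fun x => c * φ n x - c * u x) = c • fun x => φ n x - u x := by
        intro n; ext x; simp [mul_sub]
      simp_rw [this, eLpNorm_const_smul]
      simpa using ENNReal.Tendsto.const_mul h0 (Or.inr (enorm_ne_top (x := c)))
    · have : ∀ n, (fun x => gradient (fun y => c * φ n y) x - c • Du x) =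
          c • fun x => gradient (φ n) x - Du x := by
        intro n; ext1 x
        rw [gradient_const_mul ((hφ n).contDiff_one.differentiable one_ne_zero x)]
        simp [smul_sub]
      simp_rw [this, eLpNorm_const_smul]
      simpa using ENNReal.Tendsto.const_mul h1 (Or.inr (enorm_ne_top (x := c)))

/-- Homogeneity of the equation. -/
theorem IsWeakSolution.const_mul {lam p : ℝ} {f u : E N → ℝ} {Du : E N → E N}
    (hu : IsWeakSolution Ω lam f p u Du) (c : ℝ) :
    IsWeakSolution Ω lam (fun x => |c| ^ (p - 2) * c * f x) p (fun x => c * u x)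
      (fun x => c • Du x) := by
  refine ⟨hu.mem.const_mul c, fun φ Dφ hφ => ?_⟩
  have h1 : ∫ x in Ω, ‖c • Du x‖ ^ (p - 2) * inner ℝ (c • Du x) (Dφ x) =
      |c| ^ (p - 2) * c * ∫ x in Ω, ‖Du x‖ ^ (p - 2) * inner ℝ (Du x) (Dφ x) := by
    rw [← integral_const_mul]
    refine integral_congr_ae (ae_of_all _ fun x => ?_)
    simp only [norm_smul, inner_smul_left, Real.norm_eq_abs, conj_trivial,
      Real.mul_rpow (abs_nonneg c) (norm_nonneg _)]
    ring
  have h2 : ∫ x in Ω, 1 / ‖x‖ ^ p * (|c * u x| ^ (p - 2) * (c * u x)) * φ x =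
      |c| ^ (p - 2) * c * ∫ x in Ω, 1 / ‖x‖ ^ p * (|u x| ^ (p - 2) * u x) * φ x := by
    rw [← integral_const_mul]
    refine integral_congr_ae (ae_of_all _ fun x => ?_)
    simp only [abs_mul, Real.mul_rpow (abs_nonneg _) (abs_nonneg _)]
    ring
  have h3 : ∫ x in Ω, |c| ^ (p - 2) * c * f x * φ x =
      |c| ^ (p - 2) * c * ∫ x in Ω, f x * φ x := by
    rw [← integral_const_mul]
    simp only [mul_assoc]
  rw [h1, h2, h3, hu.weak_eq φ Dφ hφ]
  ring

end Scaling

/-! ### Hardy's inequality with the explicit constant p/(N-p). -/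

section Hardy

/-- Young's inequality for a^(p-1) and b with exponents p/(p-1) and p, cleared of denominators. It
is sharp at a = b, which is what preserves the Hardy constant. -/
theorem young_rpow {p a b : ℝ} (hp : 1 < p) (ha : 0 ≤ a) (hb : 0 ≤ b) :
    p * (a ^ (p - 1) * b) ≤ (p - 1) * a ^ p + b ^ p := by
  have hc : (p / (p - 1)).HolderConjugate p := (Real.HolderConjugate.conjExponent hp).symm
  have h := Real.young_inequality_of_nonneg (Real.rpow_nonneg ha (p - 1)) hb hc
  have hp1 : p - 1 ≠ 0 := by linarith
  have hp0 : 0 < p := by linarith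
  rw [← Real.rpow_mul ha, mul_div_cancel₀ _ hp1] at h
  calc p * (a ^ (p - 1) * b) ≤ p * (a ^ p / (p / (p - 1)) + b ^ p / p) := by gcongr
    _ = (p - 1) * a ^ p + b ^ p := by field_simp

variable {N : ℕ} {Ω : Set (E N)}

theorem hasFDerivAt_normSq_add_rpow {ε : ℝ} (hε : 0 < ε) (s : ℝ) (x : E N) :
    HasFDerivAt (fun y : E N => (‖y‖ ^ 2 + ε) ^ s)
      ((s * (‖x‖ ^ 2 + ε) ^ (s - 1)) • (2 • innerSL ℝ x)) x :=
  ((hasStrictFDerivAt_norm_sq x).hasFDerivAt.add_const ε).rpow_const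
    (Or.inl (by positivity))

theorem contDiff_normSq_add_rpow {ε : ℝ} (hε : 0 < ε) (s : ℝ) {n : WithTop ℕ∞} :
    ContDiff ℝ n (fun y : E N => (‖y‖ ^ 2 + ε) ^ s) :=
  ((contDiff_norm_sq ℝ).add contDiff_const).rpow_const_of_ne fun x => by positivity

theorem sum_coord_mul_apply (L : E N →L[ℝ] ℝ) (x : E N) :
    ∑ i, x i * L (EuclideanSpace.single i 1) = L x := by
  conv_rhs => rw [← (EuclideanSpace.basisFun (Fin N) ℝ).sum_repr x]
  simp [map_sum]

/-- The divergence theorem for the field `g x ↦ g(x) (‖x‖² + ε)^s x`. -/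
theorem integral_radial_divergence {ε : ℝ} (hε : 0 < ε) (s : ℝ) {g : E N → ℝ}
    (hg : ContDiff ℝ 1 g) (hgc : HasCompactSupport g) :
    ∫ x, g x * (N * (‖x‖ ^ 2 + ε) ^ s + 2 * s * (‖x‖ ^ 2 + ε) ^ (s - 1) * ‖x‖ ^ 2) =
      - ∫ x, fderiv ℝ g x x * (‖x‖ ^ 2 + ε) ^ s := by
  set W : E N → ℝ := fun y => (‖y‖ ^ 2 + ε) ^ s with hW
  have hV : ∀ i : Fin N, ContDiff ℝ 1 fun x : E N => x i * W x := fun i =>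
    (contDiff_piLp_apply 2).mul (contDiff_normSq_add_rpow hε s)
  have hVd : ∀ (i : Fin N) (x : E N),
      fderiv ℝ (fun x : E N => x i * W x) x (EuclideanSpace.single i 1) =
        W x + 2 * s * (‖x‖ ^ 2 + ε) ^ (s - 1) * x i ^ 2 := by
    intro i x
    have h1 : HasFDerivAt (fun x : E N => x i) (EuclideanSpace.proj i : E N →L[ℝ] ℝ) x :=
      (EuclideanSpace.proj i : E N →L[ℝ] ℝ).hasFDerivAt
    have h2 : HasFDerivAt (fun x : E N => x i * W x) _ x :=
      h1.mul (hasFDerivAt_normSq_add_rpow hε s x)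
    rw [h2.fderiv]
    simp [EuclideanSpace.inner_single_right]
    ring
  have hg' : ∀ v, Continuous fun x => fderiv ℝ g x v := fun v =>
    (hg.continuous_fderiv one_ne_zero).clm_apply continuous_const
  have hgc' : ∀ v, HasCompactSupport fun x => fderiv ℝ g x v := fun v =>
    (hgc.fderiv ℝ).comp_left (g := fun L : E N →L[ℝ] ℝ => L v) rfl
  have key : ∀ i : Fin N, ∫ x, g x * (W x + 2 * s * (‖x‖ ^ 2 + ε) ^ (s - 1) * x i ^ 2) =
      - ∫ x, fderiv ℝ g x (EuclideanSpace.single i 1) * (x i * W x) := by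
    intro i
    rw [← integral_mul_fderiv_eq_neg hg hgc (hV i)]
    simp_rw [hVd]
  have hWc : Continuous W := (contDiff_normSq_add_rpow (n := 0) hε s).continuous
  have hWc' : Continuous fun x : E N => (‖x‖ ^ 2 + ε) ^ (s - 1) :=
    (contDiff_normSq_add_rpow (n := 0) hε (s - 1)).continuous
  have hsum := Finset.sum_congr (rfl : (Finset.univ : Finset (Fin N)) = _) fun i _ => key i
  rw [Finset.sum_neg_distrib, ← integral_finsetSum, ← integral_finsetSum] at hsum
  · convert hsum using 1
    · refine integral_congr_ae (ae_of_all _ fun x => ?_)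
      simp only [← Finset.mul_sum, Finset.sum_add_distrib, EuclideanSpace.norm_sq_eq,
        Real.norm_eq_abs, sq_abs]
      simp [hW, EuclideanSpace.norm_sq_eq]
    · congr 1
      refine integral_congr_ae (ae_of_all _ fun x => ?_)
      simp only [← sum_coord_mul_apply (fderiv ℝ g x) x, Finset.sum_mul]
      exact Finset.sum_congr rfl fun i _ => by ring
  · intro i _
    refine Continuous.integrable_of_hasCompactSupport ?_ (hgc' _).mul_right
    exact (hg' _).mul (((EuclideanSpace.proj i : E N →L[ℝ] ℝ).continuous).mul hWc)
  · intro i _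
    refine Continuous.integrable_of_hasCompactSupport ?_ hgc.mul_right
    exact hg.continuous.mul (hWc.add ((continuous_const.mul hWc').mul
      (((EuclideanSpace.proj i : E N →L[ℝ] ℝ).continuous).pow 2)))

/-- Hardy's inequality with a regularized weight. -/
theorem hardy_regularized {p : ℝ} (hp : 1 < p) (hpN : p < N) {ε : ℝ} (hε : 0 < ε)
    {φ : E N → ℝ} (hφ : ContDiff ℝ 1 φ) (hφc : HasCompactSupport φ) :
    ((N - p) / p) ^ p * ∫ x, |φ x| ^ p * (‖x‖ ^ 2 + ε) ^ (-(p / 2)) ≤ ∫ x, ‖gradient φ x‖ ^ p := by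
  have hp0 : 0 < p := by linarith
  set t : ℝ := (N - p) / p with ht
  have ht0 : 0 < t := div_pos (by linarith) hp0
  have hpt : p * t = N - p := by rw [ht]; field_simp
  have hg : ContDiff ℝ 1 fun x => |φ x| ^ p := hφ.norm_rpow hp
  have hgc : HasCompactSupport fun x => |φ x| ^ p :=
    hφc.comp_left (g := fun s : ℝ => |s| ^ p) (by simp [hp0.ne'])
  have hdiv := integral_radial_divergence hε (-(p / 2)) hg hgc
  have hWc : ∀ s : ℝ, Continuous fun x : E N => (‖x‖ ^ 2 + ε) ^ s := fun s =>
    (contDiff_normSq_add_rpow (n := 0) hε s).continuous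
  have hgrad : Continuous fun x => ‖gradient φ x‖ ^ p :=
    (continuous_gradient hφ).norm.rpow_const fun _ => Or.inr hp0.le
  have hgradc : HasCompactSupport fun x => ‖gradient φ x‖ ^ p :=
    (hasCompactSupport_gradient hφc).comp_left (g := fun s : E N => ‖s‖ ^ p) (by simp [hp0.ne'])
  have hI1 : Integrable fun x => |φ x| ^ p * (‖x‖ ^ 2 + ε) ^ (-(p / 2)) :=
    (hg.continuous.mul (hWc _)).integrable_of_hasCompactSupport hgc.mul_right
  have hI2 : Integrable fun x => ‖gradient φ x‖ ^ p :=
    hgrad.integrable_of_hasCompactSupport hgradc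
  have hI3 : Integrable fun x => |φ x| ^ p * (N * (‖x‖ ^ 2 + ε) ^ (-(p / 2)) +
      2 * (-(p / 2)) * (‖x‖ ^ 2 + ε) ^ (-(p / 2) - 1) * ‖x‖ ^ 2) := by
    refine Continuous.integrable_of_hasCompactSupport ?_ hgc.mul_right
    exact hg.continuous.mul ((continuous_const.mul (hWc _)).add
      ((continuous_const.mul (hWc _)).mul (continuous_norm.pow 2)))
  have hI4 : Integrable fun x : E N => fderiv ℝ (fun x => |φ x| ^ p) x x *
      (‖x‖ ^ 2 + ε) ^ (-(p / 2)) := by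
    refine Continuous.integrable_of_hasCompactSupport
      (((hg.continuous_fderiv one_ne_zero).clm_apply continuous_id).mul (hWc _)) ?_
    refine HasCompactSupport.mul_right ?_
    refine (hgc.fderiv ℝ).mono fun x hx hx' => hx ?_
    simp [hx']
  -- The bracket on the right integrates to zero by the divergence identity `hdiv`, so integrating
  -- this pointwise inequality is the claim.
  have hpt' : ∀ x : E N, t ^ p * (|φ x| ^ p * (‖x‖ ^ 2 + ε) ^ (-(p / 2))) - ‖gradient φ x‖ ^ p ≤
      t ^ (p - 1) * (|φ x| ^ p * (N * (‖x‖ ^ 2 + ε) ^ (-(p / 2)) +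
        2 * (-(p / 2)) * (‖x‖ ^ 2 + ε) ^ (-(p / 2) - 1) * ‖x‖ ^ 2) +
        fderiv ℝ (fun x => |φ x| ^ p) x x * (‖x‖ ^ 2 + ε) ^ (-(p / 2))) := by
    intro x
    set A := ‖x‖ ^ 2 + ε with hA
    have hA0 : 0 < A := by positivity
    set W := A ^ (-(p / 2)) with hW
    have hW0 : 0 < W := Real.rpow_pos_of_pos hA0 _
    set r := A ^ ((1 : ℝ) / 2) with hr
    have hr0 : 0 < r := Real.rpow_pos_of_pos hA0 _
    have hrW : r ^ (-p) = W := by rw [hr, ← Real.rpow_mul hA0.le, hW]; congr 1; ring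
    have hrx : ‖x‖ ≤ r := by
      rw [hr, ← Real.sqrt_eq_rpow]
      exact Real.le_sqrt_of_sq_le (by linarith)
    have hd : |fderiv ℝ (fun x => |φ x| ^ p) x x| ≤
        p * |φ x| ^ (p - 1) * ‖gradient φ x‖ * ‖x‖ := by
      refine (ContinuousLinearMap.le_opNorm (fderiv ℝ (fun x => |φ x| ^ p) x) x).trans ?_
      rw [norm_gradient]
      gcongr
      exact norm_fderiv_norm_rpow_le (hφ.differentiable one_ne_zero) hp
    -- Regularization only helps: the divergence of the field is at least (N - p) W, its value for ε
    -- = 0.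
    have hA1 : A ^ (-(p / 2) - 1) * ‖x‖ ^ 2 ≤ W := by
      rw [Real.rpow_sub_one hA0.ne', ← hW, div_mul_eq_mul_div, div_le_iff₀ hA0]
      gcongr
      linarith
    -- With r = (|x|² + ε)^(1/2), this choice makes a^p equal to t^p times the left integrand; the
    -- factor p t = N - p from the divergence then balances exactly.
    have hyoung := young_rpow hp (a := t * |φ x| / r) (b := ‖gradient φ x‖) (by positivity)
      (norm_nonneg _)
    have e1 : (t * |φ x| / r) ^ p = t ^ p * (|φ x| ^ p * W) := by
      rw [Real.div_rpow (by positivity) hr0.le, Real.mul_rpow ht0.le (abs_nonneg _), ← hrW,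
        Real.rpow_neg hr0.le]
      ring
    have e2 : (t * |φ x| / r) ^ (p - 1) = t ^ (p - 1) * (|φ x| ^ (p - 1) * (r * W)) := by
      rw [Real.div_rpow (by positivity) hr0.le, Real.mul_rpow ht0.le (abs_nonneg _), ← hrW,
        Real.rpow_neg hr0.le, Real.rpow_sub_one hr0.ne']
      field_simp
    rw [e1, e2] at hyoung
    have e3 : t ^ p = t ^ (p - 1) * t := by
      rw [Real.rpow_sub_one ht0.ne']; field_simp
    have h1 : -(fderiv ℝ (fun x => |φ x| ^ p) x x * W) ≤
        p * |φ x| ^ (p - 1) * ‖gradient φ x‖ * (r * W) := by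
      calc -(fderiv ℝ (fun x => |φ x| ^ p) x x * W)
          = -(fderiv ℝ (fun x => |φ x| ^ p) x x) * W := by ring
        _ ≤ (p * |φ x| ^ (p - 1) * ‖gradient φ x‖ * ‖x‖) * W := by
          gcongr; exact (neg_le_abs _).trans hd
        _ ≤ (p * |φ x| ^ (p - 1) * ‖gradient φ x‖ * r) * W := by gcongr
        _ = _ := by ring
    have h2 : |φ x| ^ p * ((N - p) * W) ≤ |φ x| ^ p * (N * W +
        2 * (-(p / 2)) * A ^ (-(p / 2) - 1) * ‖x‖ ^ 2) := by
      gcongr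
      nlinarith
    have ht1 : 0 ≤ t ^ (p - 1) := by positivity
    have h3 := mul_le_mul_of_nonneg_left h1 ht1
    have h4 := mul_le_mul_of_nonneg_left h2 ht1
    rw [← hpt] at h4
    have e4 : t ^ (p - 1) * (|φ x| ^ p * (p * t * W)) = p * (t ^ p * (|φ x| ^ p * W)) := by
      rw [e3]; ring
    rw [e4] at h4
    nlinarith
  have hint := integral_mono ((hI1.const_mul (t ^ p)).sub hI2) ((hI3.add hI4).const_mul _) hpt'
  simp only [Pi.sub_apply, Pi.add_apply] at hint
  rw [integral_const_mul, integral_add hI3 hI4, hdiv, integral_sub (hI1.const_mul _) hI2,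
    integral_const_mul] at hint
  linarith

/-- Hardy's inequality for test functions. -/
theorem IsTestFunction.hardy {p : ℝ} (hp : 1 < p) (hpN : p < N) {φ : E N → ℝ}
    (hφ : IsTestFunction Ω φ) :
    eLpNorm (fun x => ‖x‖⁻¹ * φ x) (ENNReal.ofReal p) (volume.restrict Ω) ≤
      ENNReal.ofReal (p / (N - p)) * eLpNorm (gradient φ) (ENNReal.ofReal p)
        (volume.restrict Ω) := by
  have hp0 : 0 < p := by linarith
  have hNp : 0 < N - p := by linarith
  have hP0 : ENNReal.ofReal p ≠ 0 := by simpa using hp0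
  rw [hφ.eLpNorm_gradient_restrict]
  refine (eLpNorm_mono_measure _ Measure.restrict_le_self).trans ?_
  have hN : Nonempty (Fin N) := ⟨⟨0, by exact_mod_cast hp0.trans hpN⟩⟩
  have hreg : ∀ ε : ℝ, 0 < ε →
      eLpNorm (fun x => (‖x‖ ^ 2 + ε) ^ (-(1 / 2 : ℝ)) * φ x) (ENNReal.ofReal p) volume ≤
        ENNReal.ofReal (p / (N - p)) * eLpNorm (gradient φ) (ENNReal.ofReal p) volume := by
    intro ε hε
    have hm : MemLp (fun x => (‖x‖ ^ 2 + ε) ^ (-(1 / 2 : ℝ)) * φ x) (ENNReal.ofReal p) volume :=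
      ((contDiff_normSq_add_rpow (n := 0) hε _).continuous.mul
        hφ.1.continuous).memLp_of_hasCompactSupport hφ.2.1.mul_left
    rw [hm.eLpNorm_eq_integral_rpow_norm hP0 ENNReal.ofReal_ne_top,
      (hφ.memLp_gradient _ _).eLpNorm_eq_integral_rpow_norm hP0 ENNReal.ofReal_ne_top,
      ← ENNReal.ofReal_mul (by positivity), ENNReal.toReal_ofReal hp0.le]
    refine ENNReal.ofReal_le_ofReal ?_
    have h := hardy_regularized hp hpN hε hφ.contDiff_one hφ.2.1
    have e : ∀ x : E N, ‖(‖x‖ ^ 2 + ε) ^ (-(1 / 2 : ℝ)) * φ x‖ ^ p =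
        |φ x| ^ p * (‖x‖ ^ 2 + ε) ^ (-(p / 2)) := by
      intro x
      rw [norm_mul, Real.norm_of_nonneg (by positivity), Real.mul_rpow (by positivity)
        (norm_nonneg _), ← Real.rpow_mul (by positivity), mul_comm, Real.norm_eq_abs]
      congr 2; ring
    simp_rw [e]
    have hI0 : 0 ≤ ∫ x, |φ x| ^ p * (‖x‖ ^ 2 + ε) ^ (-(p / 2)) :=
      integral_nonneg fun x => by positivity
    have hJ0 : 0 ≤ ∫ x, ‖gradient φ x‖ ^ p := integral_nonneg fun x => by positivity
    have ht : 0 < (N - p) / p := div_pos hNp hp0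
    have h' := Real.rpow_le_rpow (by positivity) h (inv_pos.mpr hp0).le
    rw [Real.mul_rpow (by positivity) hI0, Real.rpow_rpow_inv ht.le hp0.ne'] at h'
    rw [← inv_div (N - p : ℝ) p, ← div_eq_inv_mul, le_div_iff₀ ht, mul_comm]
    exact h'
  -- Fatou along ε = 1/(n+1); the bound `hreg` does not depend on ε.
  refine (Lp.eLpNorm_lim_le_liminf_eLpNorm
    (f := fun (n : ℕ) x => (‖x‖ ^ 2 + 1 / ((n : ℝ) + 1)) ^ (-(1 / 2 : ℝ)) * φ x)
    (fun n => ((contDiff_normSq_add_rpow (n := 0) (by positivity) _).continuous.mul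
        hφ.1.continuous).aestronglyMeasurable) _ ?_).trans ?_
  · have : ∀ᵐ x : E N, x ≠ 0 := by simp [ae_iff, measure_singleton]
    filter_upwards [this] with x hx
    refine Tendsto.mul_const _ ?_
    have hx0 : 0 < ‖x‖ := norm_pos_iff.mpr hx
    have h1 : Tendsto (fun n : ℕ => ‖x‖ ^ 2 + 1 / ((n : ℝ) + 1)) atTop (𝓝 (‖x‖ ^ 2 + 0)) :=
      tendsto_const_nhds.add tendsto_one_div_add_atTop_nhds_zero_nat
    have h2 := h1.rpow_const (p := -(1 / 2 : ℝ)) (Or.inl (by positivity))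
    have e : (‖x‖ ^ 2 + 0) ^ (-(1 / 2 : ℝ)) = ‖x‖⁻¹ := by
      rw [add_zero, Real.rpow_neg (by positivity), ← Real.sqrt_eq_rpow, Real.sqrt_sq hx0.le]
    rwa [e] at h2
  · refine liminf_le_of_le (by isBoundedDefault) fun b hb => ?_
    obtain ⟨n, hn⟩ := hb.exists
    exact hn.trans (hreg _ (by positivity))

/-- Hardy's inequality in `W_0^{1,p}(Ω)`. -/
theorem MemW1p0.hardy (hΩ : Bornology.IsBounded Ω) {p : ℝ} (hp : 1 < p) (hpN : p < N)
    {u : E N → ℝ} {Du : E N → E N} (hu : MemW1p0 Ω p u Du) :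
    eLpNorm (fun x => ‖x‖⁻¹ * u x) (ENNReal.ofReal p) (volume.restrict Ω) ≤
      ENNReal.ofReal (p / (N - p)) * eLpNorm Du (ENNReal.ofReal p) (volume.restrict Ω) :=
  hu.eLpNorm_mul_le hΩ hp.le (by simpa using ENNReal.ofReal_le_ofReal hp.le) le_rfl
    ENNReal.ofReal_ne_top measurable_norm.inv fun _ hφ => hφ.hardy hp hpN

theorem MemW1p0.memLp_div_norm (hΩ : Bornology.IsBounded Ω) {p : ℝ} (hp : 1 < p) (hpN : p < N)
    {u : E N → ℝ} {Du : E N → E N} (hu : MemW1p0 Ω p u Du) :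
    MemLp (fun x => ‖x‖⁻¹ * u x) (ENNReal.ofReal p) (volume.restrict Ω) :=
  ⟨measurable_norm.inv.aestronglyMeasurable.mul hu.memLp.1,
    (hu.hardy hΩ hp hpN).trans_lt (ENNReal.mul_lt_top ENNReal.ofReal_lt_top hu.memLp_grad.2)⟩

/-- Hardy's inequality in `W_0^{1,p}(Ω)`, in terms of integrals. -/
theorem MemW1p0.integral_hardy (hΩ : Bornology.IsBounded Ω) {p : ℝ} (hp : 1 < p) (hpN : p < N)
    {u : E N → ℝ} {Du : E N → E N} (hu : MemW1p0 Ω p u Du) :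
    ∫ x in Ω, (‖x‖⁻¹ * |u x|) ^ p ≤ (p / (N - p)) ^ p * ∫ x in Ω, ‖Du x‖ ^ p := by
  have hp0 : 0 < p := by linarith
  have hNp : 0 < N - p := by linarith
  have hP0 : ENNReal.ofReal p ≠ 0 := by simpa using hp0
  have h := hu.hardy hΩ hp hpN
  rw [(hu.memLp_div_norm hΩ hp hpN).eLpNorm_eq_integral_rpow_norm hP0 ENNReal.ofReal_ne_top,
    hu.memLp_grad.eLpNorm_eq_integral_rpow_norm hP0 ENNReal.ofReal_ne_top,
    ← ENNReal.ofReal_mul (by positivity), ENNReal.toReal_ofReal hp0.le,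
    ENNReal.ofReal_le_ofReal_iff (by positivity)] at h
  have hI0 : 0 ≤ ∫ x in Ω, ‖‖x‖⁻¹ * u x‖ ^ p := integral_nonneg fun x => by positivity
  have hJ0 : 0 ≤ ∫ x in Ω, ‖Du x‖ ^ p := integral_nonneg fun x => by positivity
  have h' := Real.rpow_le_rpow (by positivity) h hp0.le
  rw [Real.mul_rpow (by positivity) (by positivity), Real.rpow_inv_rpow hI0 hp0.ne',
    Real.rpow_inv_rpow hJ0 hp0.ne'] at h'
  simpa [abs_mul] using h'

end Hardy

/-! ### Sobolev inequalities, sharp and non-sharp, and the source term. -/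

section Sobolev

variable {N : ℕ} {Ω : Set (E N)}

/-- The Sobolev exponent `1^* = N / (N - 1)`. -/
noncomputable abbrev sobolevExp (N : ℕ) : ℝ≥0∞ := ENNReal.ofReal ((N : ℝ) / ((N : ℝ) - 1))

/-- A finite constant in the Gagliardo-Nirenberg-Sobolev inequality for test functions. -/
noncomputable def gnsConst (N : ℕ) : NNReal :=
  eLpNormLESNormFDerivOneConst (volume : Measure (E N)) (((N : ℝ) / ((N : ℝ) - 1)).toNNReal : ℝ)

theorem nnreal_holderConjugate_sobolev (hN : 2 ≤ N) :
    NNReal.HolderConjugate (N : NNReal) ((N : ℝ) / ((N : ℝ) - 1)).toNNReal := by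
  have hN' : (1 : ℝ) < N := by exact_mod_cast hN
  rw [← NNReal.holderConjugate_coe_iff,
    Real.coe_toNNReal _ (div_nonneg (by positivity) (by linarith))]
  exact Real.HolderConjugate.conjExponent hN'

theorem holderConjugate_sobolevExp (hN : 2 ≤ N) :
    ENNReal.HolderConjugate (N : ℝ≥0∞) (sobolevExp N) := by
  have := (nnreal_holderConjugate_sobolev hN).coe_ennreal
  simpa [sobolevExp, ENNReal.ofReal] using this

theorem one_lt_sobolev_ratio (hN : 2 ≤ N) : 1 < (N : ℝ) / ((N : ℝ) - 1) := by
  have hN' : (1 : ℝ) < N := by exact_mod_cast hN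
  rw [one_lt_div (by linarith)]
  linarith

theorem sobolevExp_ne_zero (hN : 2 ≤ N) : sobolevExp N ≠ 0 := by
  have := one_lt_sobolev_ratio hN
  simp only [ne_eq, ENNReal.ofReal_eq_zero, not_le]
  linarith

/-- This constant is an `NNReal`, hence finite, whereas `sobolevConst` is a supremum with values in
`ℝ≥0∞`. It serves wherever sharpness is irrelevant, and where the gradient vanishes and the quotient
defining `sobolevConst` is uninformative. -/
theorem IsTestFunction.eLpNorm_le_gnsConst (hN : 2 ≤ N) {φ : E N → ℝ}
    (hφ : IsTestFunction Ω φ) :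
    eLpNorm φ (sobolevExp N) (volume.restrict Ω) ≤
      gnsConst N * eLpNorm (gradient φ) 1 (volume.restrict Ω) := by
  rw [hφ.eLpNorm_gradient_restrict]
  refine (eLpNorm_mono_measure _ Measure.restrict_le_self).trans ?_
  have h := eLpNorm_le_eLpNorm_fderiv_one (volume : Measure (E N)) hφ.contDiff_one hφ.2.1
    (p := ((N : ℝ) / ((N : ℝ) - 1)).toNNReal) (by simpa using nnreal_holderConjugate_sobolev hN)
  refine h.trans_eq ?_
  congr 1
  exact eLpNorm_congr_norm_ae (ae_of_all _ fun x => (norm_gradient φ x).symm)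

theorem MemW1p0.eLpNorm_le_gnsConst (hN : 2 ≤ N) (hΩ : Bornology.IsBounded Ω) {p : ℝ}
    (hp : 1 ≤ p) {u : E N → ℝ} {Du : E N → E N} (hu : MemW1p0 Ω p u Du) :
    eLpNorm u (sobolevExp N) (volume.restrict Ω) ≤
      gnsConst N * eLpNorm Du 1 (volume.restrict Ω) := by
  simpa only [one_mul] using hu.eLpNorm_mul_le hΩ hp le_rfl
    (by simpa using ENNReal.ofReal_le_ofReal hp) (q := sobolevExp N) (C := gnsConst N)
    ENNReal.coe_ne_top (measurable_const (a := (1 : ℝ)))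
    (fun φ hφ => by simpa only [one_mul] using hφ.eLpNorm_le_gnsConst hN)

theorem IsTestFunction.eLpNorm_le_sobolevConst (hN : 2 ≤ N) {φ : E N → ℝ}
    (hφ : IsTestFunction Ω φ) :
    eLpNorm φ (sobolevExp N) (volume.restrict Ω) ≤
      sobolevConst N * eLpNorm (gradient φ) 1 (volume.restrict Ω) := by
  -- With zero gradient the quotient in the supremum cannot be cleared of its denominator, so the
  -- vanishing of φ comes from the non-sharp inequality.
  rcases eq_or_ne (eLpNorm (gradient φ) 1 (volume.restrict Ω)) 0 with h0 | h0
  · have := hφ.eLpNorm_le_gnsConst hN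
    rw [h0, mul_zero] at this
    rw [h0, mul_zero]
    exact this
  rw [hφ.eLpNorm_gradient_restrict] at h0 ⊢
  refine (eLpNorm_mono_measure _ Measure.restrict_le_self).trans ?_
  have h : eLpNorm φ (sobolevExp N) volume / eLpNorm (gradient φ) 1 volume ≤ sobolevConst N :=
    le_iSup_of_le φ (le_iSup_of_le (gradient φ) (le_iSup_of_le hφ.memW1p_univ le_rfl))
  rwa [ENNReal.div_le_iff_le_mul (Or.inl h0) (Or.inl (hφ.memLp_gradient 1 _).2.ne)] at h

/-- The sharp Sobolev inequality in `W_0^{1,p}(Ω)`. -/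
theorem MemW1p0.eLpNorm_le_sobolevConst (hN : 2 ≤ N) (hΩ : Bornology.IsBounded Ω) {p : ℝ}
    (hp : 1 ≤ p) {u : E N → ℝ} {Du : E N → E N} (hu : MemW1p0 Ω p u Du) :
    eLpNorm u (sobolevExp N) (volume.restrict Ω) ≤
      sobolevConst N * eLpNorm Du 1 (volume.restrict Ω) := by
  rcases eq_or_ne (eLpNorm Du 1 (volume.restrict Ω)) 0 with h0 | h0
  · have := hu.eLpNorm_le_gnsConst hN hΩ hp
    rw [h0, mul_zero] at this
    rw [h0, mul_zero]
    exact this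
  rcases eq_or_ne (sobolevConst N) ⊤ with hS | hS
  · rw [hS, ENNReal.top_mul h0]
    exact le_top
  simpa only [one_mul] using hu.eLpNorm_mul_le hΩ hp le_rfl
    (by simpa using ENNReal.ofReal_le_ofReal hp) (q := sobolevExp N)
    hS (measurable_const (a := (1 : ℝ)))
    (fun φ hφ => by simpa only [one_mul] using hφ.eLpNorm_le_sobolevConst hN)

theorem MemW1p0.memLp_one_grad (hΩ : Bornology.IsBounded Ω) {p : ℝ} (hp : 1 ≤ p) {u : E N → ℝ}
    {Du : E N → E N} (hu : MemW1p0 Ω p u Du) : MemLp Du 1 (volume.restrict Ω) :=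
  have := isFiniteMeasure_restrict_of_isBounded hΩ
  hu.memLp_grad.mono_exponent (by simpa using ENNReal.ofReal_le_ofReal hp)

/-- The source term is controlled by the Hölder and Sobolev inequalities. -/
theorem MemW1p0.abs_integral_mul_le (hN : 2 ≤ N) (hΩ : Bornology.IsBounded Ω) {p : ℝ}
    (hp : 1 ≤ p) {u : E N → ℝ} {Du : E N → E N} (hu : MemW1p0 Ω p u Du) {f : E N → ℝ}
    (hf : MemLp f (N : ℝ≥0∞) (volume.restrict Ω))
    (hfS : eLpNorm f (N : ℝ≥0∞) (volume.restrict Ω) * sobolevConst N ≠ ⊤) :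
    |∫ x in Ω, f x * u x| ≤
      (eLpNorm f (N : ℝ≥0∞) (volume.restrict Ω) * sobolevConst N).toReal *
        ∫ x in Ω, ‖Du x‖ := by
  have := holderConjugate_sobolevExp hN
  have h1 : eLpNorm (fun x => f x * u x) 1 (volume.restrict Ω) ≤
      (eLpNorm f (N : ℝ≥0∞) (volume.restrict Ω) * sobolevConst N) *
        eLpNorm Du 1 (volume.restrict Ω) := by
    rw [mul_assoc]
    refine (eLpNorm_smul_le_mul_eLpNorm (p := N) (q := sobolevExp N) (r := 1)
      hu.memLp.1 hf.1).trans ?_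
    gcongr
    exact hu.eLpNorm_le_sobolevConst hN hΩ hp
  have hD := hu.memLp_one_grad hΩ hp
  have h2 : eLpNorm Du 1 (volume.restrict Ω) = ENNReal.ofReal (∫ x in Ω, ‖Du x‖) := by
    rw [eLpNorm_one_eq_lintegral_enorm, ← ofReal_integral_norm_eq_lintegral_enorm
      (memLp_one_iff_integrable.mp hD)]
  rw [eLpNorm_one_eq_lintegral_enorm] at h1
  have h3 := (enorm_integral_le_lintegral_enorm (μ := volume.restrict Ω) fun x => f x * u x).trans h1
  rw [h2, ← ENNReal.ofReal_toReal hfS, ← ENNReal.ofReal_mul ENNReal.toReal_nonneg,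
    ← ofReal_norm, ENNReal.ofReal_le_ofReal_iff
      (mul_nonneg ENNReal.toReal_nonneg (integral_nonneg fun x => norm_nonneg _))] at h3
  exact h3

theorem MemW1p0.integrable_norm_rpow {p : ℝ} (hp : 1 ≤ p) {u : E N → ℝ} {Du : E N → E N}
    (hu : MemW1p0 Ω p u Du) : Integrable (fun x => ‖Du x‖ ^ p) (volume.restrict Ω) := by
  have h := hu.memLp_grad.integrable_norm_rpow (by simp; linarith) ENNReal.ofReal_ne_top
  rwa [ENNReal.toReal_ofReal (by linarith)] at h

/-- Hölder's inequality between the `L¹` and the `L^p` norms of the gradient. -/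
theorem MemW1p0.integral_norm_le (hΩ : Bornology.IsBounded Ω) {p : ℝ} (hp : 1 ≤ p)
    {u : E N → ℝ} {Du : E N → E N} (hu : MemW1p0 Ω p u Du) :
    ∫ x in Ω, ‖Du x‖ ≤
      (∫ x in Ω, ‖Du x‖ ^ p) ^ p⁻¹ * (volume Ω).toReal ^ (1 - p⁻¹) := by
  have hfin := isFiniteMeasure_restrict_of_isBounded hΩ
  have hp0 : 0 < p := by linarith
  have h := eLpNorm_le_eLpNorm_mul_rpow_measure_univ (p := 1) (q := ENNReal.ofReal p)
    (by simpa using ENNReal.ofReal_le_ofReal hp) hu.memLp_grad.1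
  have hD := hu.memLp_one_grad hΩ hp
  have hp1 : 0 ≤ 1 - p⁻¹ := by
    rw [sub_nonneg]; exact inv_le_one_of_one_le₀ hp
  rw [eLpNorm_one_eq_lintegral_enorm, ← ofReal_integral_norm_eq_lintegral_enorm
      (memLp_one_iff_integrable.mp hD), hu.memLp_grad.eLpNorm_eq_integral_rpow_norm
      (by simpa using hp0) ENNReal.ofReal_ne_top, ENNReal.toReal_ofReal hp0.le,
      Measure.restrict_apply_univ, ENNReal.toReal_one, one_div_one, one_div,
      ← ENNReal.ofReal_toReal (hΩ.measure_lt_top (μ := volume)).ne,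
      ENNReal.ofReal_rpow_of_nonneg ENNReal.toReal_nonneg hp1,
      ← ENNReal.ofReal_mul (by positivity), ENNReal.ofReal_le_ofReal_iff (by positivity)] at h
  exact h

end Sobolev

/-! ### The energy estimate and its limit p → 1 in the two cases. -/

section Energy

/-- The best constant in the Hardy inequality of exponent `p`. -/
noncomputable def hardyConst (N : ℕ) (p : ℝ) : ℝ := (p / (N - p)) ^ p

theorem hardyConst_one {N : ℕ} : hardyConst N 1 = 1 / ((N : ℝ) - 1) := by
  simp [hardyConst]

theorem differentiableAt_hardyConst {N : ℕ} {p : ℝ} (hp : 0 < p) (hpN : p < N) :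
    DifferentiableAt ℝ (hardyConst N) p := by
  have h : DifferentiableAt ℝ (fun q : ℝ => q / ((N : ℝ) - q)) p :=
    differentiableAt_id.div ((differentiableAt_const _).sub differentiableAt_id) (by
      show (N : ℝ) - p ≠ 0; linarith)
  exact h.rpow differentiableAt_id (div_pos hp (by linarith)).ne'

theorem mul_hardyConst_lt_one {N : ℕ} {p lam : ℝ} (hp : 0 < p) (hpN : p < N)
    (h : lam < (((N : ℝ) - p) / p) ^ p) : lam * hardyConst N p < 1 := by
  have hNp : 0 < (N : ℝ) - p := by linarith
  have e : hardyConst N p = ((((N : ℝ) - p) / p) ^ p)⁻¹ := by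
    rw [hardyConst, ← Real.inv_rpow (by positivity), inv_div]
  rw [e, ← div_eq_mul_inv, div_lt_one (by positivity)]
  exact h

theorem tendsto_hardyConst {N : ℕ} (hN : 2 ≤ N) :
    Tendsto (hardyConst N) (𝓝[>] 1) (𝓝 (1 / ((N : ℝ) - 1))) := by
  have hN' : (1 : ℝ) < N := by exact_mod_cast hN
  rw [← hardyConst_one]
  exact (differentiableAt_hardyConst one_pos hN').continuousAt.tendsto.mono_left nhdsWithin_le_nhds

variable {N : ℕ} {Ω : Set (E N)}

theorem abs_rpow_sub_two_mul_mul {p : ℝ} (hp : 1 < p) (s : ℝ) : |s| ^ (p - 2) * s * s = |s| ^ p := by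
  rcases eq_or_ne s 0 with rfl | hs
  · simp [Real.zero_rpow (by linarith : p ≠ 0)]
  · have h : 0 < |s| := abs_pos.mpr hs
    rw [mul_assoc, ← abs_mul_abs_self, ← mul_assoc, ← Real.rpow_add_one h.ne',
      ← Real.rpow_add_one h.ne']
    ring_nf

theorem norm_rpow_sub_two_mul_inner {p : ℝ} (hp : 1 < p) (X : E N) :
    ‖X‖ ^ (p - 2) * inner ℝ X X = ‖X‖ ^ p := by
  have := abs_rpow_sub_two_mul_mul hp ‖X‖
  rw [abs_of_nonneg (norm_nonneg X)] at this
  rw [real_inner_self_eq_norm_mul_norm, ← mul_assoc, this]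

/-- The energy estimate, obtained by testing the equation with the solution. -/
theorem IsWeakSolution.energy_le_mul_integral (hN : 2 ≤ N) (hΩ : Bornology.IsBounded Ω)
    {lam p : ℝ} (hlam : 0 ≤ lam) (hp : 1 < p) (hpN : p < N) {f : E N → ℝ}
    (hf : MemLp f (N : ℝ≥0∞) (volume.restrict Ω))
    (hfS : eLpNorm f (N : ℝ≥0∞) (volume.restrict Ω) * sobolevConst N ≠ ⊤)
    {u : E N → ℝ} {Du : E N → E N} (hu : IsWeakSolution Ω lam f p u Du) :
    (1 - lam * hardyConst N p) * ∫ x in Ω, ‖Du x‖ ^ p ≤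
      (eLpNorm f (N : ℝ≥0∞) (volume.restrict Ω) * sobolevConst N).toReal *
        ∫ x in Ω, ‖Du x‖ := by
  have h := hu.weak_eq u Du hu.mem
  have h1 : ∫ x in Ω, ‖Du x‖ ^ (p - 2) * inner ℝ (Du x) (Du x) = ∫ x in Ω, ‖Du x‖ ^ p := by
    simp_rw [norm_rpow_sub_two_mul_inner hp]
  have h2 : ∫ x in Ω, 1 / ‖x‖ ^ p * (|u x| ^ (p - 2) * u x) * u x =
      ∫ x in Ω, (‖x‖⁻¹ * |u x|) ^ p := by
    refine integral_congr_ae (ae_of_all _ fun x => ?_)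
    simp only
    rw [mul_assoc, abs_rpow_sub_two_mul_mul hp, Real.mul_rpow (by positivity) (by positivity),
      Real.inv_rpow (norm_nonneg _), one_div]
  rw [h1, h2] at h
  have h3 := mul_le_mul_of_nonneg_left (hu.mem.integral_hardy hΩ hp hpN) hlam
  have h4 := (le_abs_self _).trans (hu.mem.abs_integral_mul_le hN hΩ hp.le hf hfS)
  unfold hardyConst
  linarith

/-- Hölder bounds ∫‖Du‖ by X^(1/p) |Ω|^(1-1/p), where X is the energy. Dividing by X^(1/p) and
raising to the power p/(p-1) isolates X; the size of the base relative to 1 then decides between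
decay and mere boundedness. -/
theorem IsWeakSolution.energy_le (hN : 2 ≤ N) (hΩ : Bornology.IsBounded Ω)
    {lam p : ℝ} (hlam : 0 ≤ lam) (hp : 1 < p) (hpN : p < N) {f : E N → ℝ}
    (hf : MemLp f (N : ℝ≥0∞) (volume.restrict Ω))
    (hfS : eLpNorm f (N : ℝ≥0∞) (volume.restrict Ω) * sobolevConst N ≠ ⊤)
    {u : E N → ℝ} {Du : E N → E N} (hu : IsWeakSolution Ω lam f p u Du)
    (hlamH : lam * hardyConst N p < 1) :
    ∫ x in Ω, ‖Du x‖ ^ p ≤ ((eLpNorm f (N : ℝ≥0∞) (volume.restrict Ω) * sobolevConst N).toReal /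
      (1 - lam * hardyConst N p)) ^ (p / (p - 1)) * (volume Ω).toReal := by
  set c := (eLpNorm f (N : ℝ≥0∞) (volume.restrict Ω) * sobolevConst N).toReal with hc
  set X := ∫ x in Ω, ‖Du x‖ ^ p with hX
  set w := (volume Ω).toReal with hw
  have hw0 : 0 ≤ w := ENNReal.toReal_nonneg
  have hc0 : 0 ≤ c := ENNReal.toReal_nonneg
  have hX0 : 0 ≤ X := integral_nonneg fun x => by positivity
  have hd : 0 < 1 - lam * hardyConst N p := by linarith
  have hp0 : 0 < p := by linarith
  have hp1 : 0 < p - 1 := by linarith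
  rcases hX0.eq_or_lt with h0 | h0
  · rw [← h0]; positivity
  have h1 := hu.energy_le_mul_integral hN hΩ hlam hp hpN hf hfS
  have h2 := mul_le_mul_of_nonneg_left (hu.mem.integral_norm_le hΩ hp.le) hc0
  have h3 : X ^ (1 - p⁻¹) ≤ c / (1 - lam * hardyConst N p) * w ^ (1 - p⁻¹) := by
    rw [Real.rpow_sub h0, Real.rpow_one, div_le_iff₀ (by positivity), div_mul_eq_mul_div,
      div_mul_eq_mul_div, le_div_iff₀ hd]
    calc X * (1 - lam * hardyConst N p) ≤ c * (X ^ p⁻¹ * w ^ (1 - p⁻¹)) := by linarith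
      _ = c * w ^ (1 - p⁻¹) * X ^ p⁻¹ := by ring
  have e : (1 - p⁻¹) * (p / (p - 1)) = 1 := by field_simp
  have h4 := Real.rpow_le_rpow (by positivity) h3 (by positivity : 0 ≤ p / (p - 1))
  rwa [Real.mul_rpow (by positivity) (by positivity), ← Real.rpow_mul hX0, ← Real.rpow_mul hw0, e,
    Real.rpow_one, Real.rpow_one] at h4

theorem eventually_mul_hardyConst_lt (hN : 2 ≤ N) {lam a : ℝ} (h : lam / ((N : ℝ) - 1) < a) :
    ∀ᶠ p in 𝓝[>] (1 : ℝ), lam * hardyConst N p < a := by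
  have := (tendsto_hardyConst hN).const_mul lam
  rw [mul_one_div] at this
  exact this.eventually_lt_const h

theorem eventually_one_lt_lt {a : ℝ} (h : 1 < a) : ∀ᶠ p in 𝓝[>] (1 : ℝ), 1 < p ∧ p < a :=
  Ioo_mem_nhdsGT h

/-- In the strict case the energy tends to zero, uniformly over all weak solutions. -/
theorem eventually_energy_le (hN : 2 ≤ N) (hΩ : Bornology.IsBounded Ω)
    {lam : ℝ} (hlam : 0 ≤ lam) {f : E N → ℝ}
    (hf : MemLp f (N : ℝ≥0∞) (volume.restrict Ω))
    (hfS : eLpNorm f (N : ℝ≥0∞) (volume.restrict Ω) * sobolevConst N ≠ ⊤)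
    (hstrict : (eLpNorm f (N : ℝ≥0∞) (volume.restrict Ω) * sobolevConst N).toReal +
      lam / ((N : ℝ) - 1) < 1) {η : ℝ} (hη : 0 < η) :
    ∀ᶠ p in 𝓝[>] (1 : ℝ), ∀ (u : E N → ℝ) (Du : E N → E N), IsWeakSolution Ω lam f p u Du →
      ∫ x in Ω, ‖Du x‖ ^ p ≤ η := by
  have hN' : (1 : ℝ) < N := by exact_mod_cast hN
  set c := (eLpNorm f (N : ℝ≥0∞) (volume.restrict Ω) * sobolevConst N).toReal with hc
  have hc0 : 0 ≤ c := ENNReal.toReal_nonneg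
  have hlt : lam / ((N : ℝ) - 1) < 1 := by linarith
  -- κ leaves room above the limiting base: for p near 1 the actual base is at most κ < 1, while the
  -- exponent p/(p-1) tends to infinity.
  obtain ⟨κ, hκ1, hκ2⟩ := exists_between (show c / (1 - lam / ((N : ℝ) - 1)) < 1 by
    rw [div_lt_one] <;> linarith)
  have hκ0 : 0 < κ := (div_nonneg hc0 (by linarith)).trans_lt hκ1
  have h1 : lam / ((N : ℝ) - 1) < 1 - c / κ := by
    rw [div_lt_iff₀ (by linarith)] at hκ1
    rw [lt_sub_iff_add_lt, ← lt_sub_iff_add_lt', div_lt_iff₀ hκ0]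
    linarith
  have hpow : Tendsto (fun p : ℝ => κ ^ (p / (p - 1)) * (volume Ω).toReal) (𝓝[>] 1)
      (𝓝 (0 * (volume Ω).toReal)) := by
    refine Tendsto.mul_const _ ?_
    refine (tendsto_rpow_atTop_of_base_lt_one κ (by linarith) hκ2).comp ?_
    have h2 : Tendsto (fun p : ℝ => p - 1) (𝓝[>] 1) (𝓝[>] 0) := by
      refine tendsto_nhdsWithin_iff.mpr ⟨?_, ?_⟩
      · have : Tendsto (fun p : ℝ => p - 1) (𝓝 1) (𝓝 (1 - 1)) :=
          tendsto_id.sub_const 1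
        rw [sub_self] at this
        exact this.mono_left nhdsWithin_le_nhds
      · filter_upwards [self_mem_nhdsWithin] with p hp
        simpa using hp
    refine tendsto_atTop_mono' _ ?_ (tendsto_inv_nhdsGT_zero.comp h2)
    filter_upwards [self_mem_nhdsWithin] with p hp
    have hp' : (1 : ℝ) < p := hp
    have : 0 < p - 1 := by linarith
    simp only [Function.comp]
    rw [inv_eq_one_div]
    gcongr
  rw [zero_mul] at hpow
  filter_upwards [hpow.eventually_le_const hη, eventually_mul_hardyConst_lt hN h1,
    eventually_one_lt_lt hN', eventually_mul_hardyConst_lt hN hlt] with p hpη hpκ hp hp1 u Du hu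
  refine (hu.energy_le hN hΩ hlam hp.1 hp.2 hf hfS hp1).trans (le_trans ?_ hpη)
  have hd : 0 < 1 - lam * hardyConst N p := by linarith
  have : 0 < p - 1 := by linarith
  have h3 : c / κ ≤ 1 - lam * hardyConst N p := by linarith
  rw [div_le_iff₀ hκ0] at h3
  have h4 : c / (1 - lam * hardyConst N p) ≤ κ := by
    rw [div_le_iff₀ hd]
    linarith
  exact mul_le_mul_of_nonneg_right (Real.rpow_le_rpow (div_nonneg hc0 hd.le) h4
    (div_nonneg (by linarith) this.le)) ENNReal.toReal_nonneg

/-- In the extreme case the energy is bounded up to `p = 1`. -/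
theorem exists_energy_bound (hN : 2 ≤ N) (hΩ : Bornology.IsBounded Ω)
    {lam : ℝ} (hlam : 0 ≤ lam) (hlamN : lam < (N : ℝ) - 1) {f : E N → ℝ}
    (hf : MemLp f (N : ℝ≥0∞) (volume.restrict Ω))
    (hfS : eLpNorm f (N : ℝ≥0∞) (volume.restrict Ω) * sobolevConst N ≠ ⊤)
    (hextreme : (eLpNorm f (N : ℝ≥0∞) (volume.restrict Ω) * sobolevConst N).toReal +
      lam / ((N : ℝ) - 1) = 1)
    {pbar : ℝ} (hpbar : 1 < pbar) (hpbarN : pbar < N)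
    (hH : ∀ p ∈ Set.Ioc 1 pbar, lam * hardyConst N p < 1) :
    ∃ C : ℝ, ∀ p ∈ Set.Ioc 1 pbar, ∀ (u : E N → ℝ) (Du : E N → E N),
      IsWeakSolution Ω lam f p u Du → ∫ x in Ω, ‖Du x‖ ^ p ≤ C := by
  have hN' : (1 : ℝ) < N := by exact_mod_cast hN
  set c := (eLpNorm f (N : ℝ≥0∞) (volume.restrict Ω) * sobolevConst N).toReal with hc
  have hlt : lam / ((N : ℝ) - 1) < 1 := by rw [div_lt_one] <;> linarith
  have hc0 : 0 < c := by linarith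
  have hH1 : lam * hardyConst N 1 = 1 - c := by rw [hardyConst_one, mul_one_div]; linarith
  -- An open set containing the closed interval [1, p̄]. The endpoint 1 belongs to it because 1 - λ
  -- H_1 = c is positive, and this is where λ < N - 1 enters.
  set s : Set ℝ := Set.Ioo 0 (N : ℝ) ∩ {p | lam * hardyConst N p < 1} with hs
  have hcont : ContinuousOn (fun p => lam * hardyConst N p) (Set.Ioo 0 (N : ℝ)) := fun p hp =>
    ((differentiableAt_hardyConst hp.1 hp.2).continuousAt.const_mul lam).continuousWithinAt
  have hso : IsOpen s := hcont.isOpen_inter_preimage isOpen_Ioo (isOpen_Iio (a := (1 : ℝ)))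
  have hs1 : (1 : ℝ) ∈ s := ⟨⟨one_pos, hN'⟩, by simp only [Set.mem_ofPred_eq, hH1]; linarith⟩
  have hsub : Set.Icc 1 pbar ⊆ s := by
    rintro p ⟨h1, h2⟩
    rcases h1.eq_or_lt with rfl | h1
    · exact hs1
    · exact ⟨⟨by linarith, by linarith⟩, hH p ⟨h1, h2⟩⟩
  set G : ℝ → ℝ := fun p => Real.log (c / (1 - lam * hardyConst N p)) with hG
  have hGd : ∀ p ∈ s, DifferentiableAt ℝ G p := by
    rintro p ⟨⟨h0, h1⟩, h2⟩
    have h2' : 0 < 1 - lam * hardyConst N p := by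
      simp only [Set.mem_ofPred_eq] at h2; linarith
    refine DifferentiableAt.log ?_ (div_pos hc0 h2').ne'
    exact (differentiableAt_const c).div
      ((differentiableAt_const 1).sub ((differentiableAt_hardyConst h0 h1).const_mul lam)) h2'.ne'
  have hds : ContinuousOn (dslope G 1) s :=
    -- Since G(1) = 0, the difference quotient G(p)/(p-1) extends continuously to p = 1, hence is
    -- bounded on the compact interval. It is the logarithm of the base times 1/(p-1).
    (continuousOn_dslope (hso.mem_nhds hs1)).mpr
      ⟨fun p hp => (hGd p hp).continuousAt.continuousWithinAt, hGd 1 hs1⟩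
  obtain ⟨M, hM⟩ := isCompact_Icc.exists_bound_of_continuousOn (hds.mono hsub)
  have hG1 : G 1 = 0 := by
    simp only [hG, hH1]
    rw [sub_sub_cancel, div_self hc0.ne', Real.log_one]
  refine ⟨Real.exp (|M| * pbar) * (volume Ω).toReal, fun p hp u Du hu => ?_⟩
  have hp1 : 0 < p - 1 := by linarith [hp.1]
  have hd : 0 < 1 - lam * hardyConst N p := by linarith [hH p hp]
  refine (hu.energy_le hN hΩ hlam hp.1 (by linarith [hp.2]) hf hfS (hH p hp)).trans ?_
  gcongr
  rw [Real.rpow_def_of_pos (div_pos hc0 hd)]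
  refine Real.exp_le_exp.mpr ?_
  have h1 := hM p ⟨hp.1.le, hp.2⟩
  rw [dslope_of_ne _ (by linarith [hp.1] : p ≠ 1), slope_def_field, hG1, sub_zero,
    Real.norm_eq_abs] at h1
  have hp0 : 0 < p := by linarith [hp.1]
  calc Real.log (c / (1 - lam * hardyConst N p)) * (p / (p - 1)) = G p / (p - 1) * p := by
        simp only [hG]; ring
    _ ≤ |M| * p := by gcongr; exact (le_abs_self _).trans (h1.trans (le_abs_self _))
    _ ≤ |M| * pbar := by gcongr; exact hp.2

end Energy

/-! ### Smooth positive parts and truncation inside W_0^{1,p}. -/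

section SmoothTruncation

/-- A smooth approximation of the positive part, at distance at most `δ` from it. -/
noncomputable def smoothPos (δ s : ℝ) : ℝ := ∫ t in (0 : ℝ)..s, Real.smoothTransition (t / δ)

theorem continuous_smoothTransition_div (δ : ℝ) :
    Continuous fun t : ℝ => Real.smoothTransition (t / δ) :=
  Real.smoothTransition.continuous.comp (continuous_id.div_const δ)

theorem hasDerivAt_smoothPos (δ s : ℝ) :
    HasDerivAt (smoothPos δ) (Real.smoothTransition (s / δ)) s :=
  intervalIntegral.integral_hasDerivAt_right
    ((continuous_smoothTransition_div δ).intervalIntegrable _ _)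
    ((continuous_smoothTransition_div δ).stronglyMeasurableAtFilter _ _)
    (continuous_smoothTransition_div δ).continuousAt

theorem contDiff_smoothPos (δ : ℝ) : ContDiff ℝ ∞ (smoothPos δ) := by
  rw [contDiff_infty_iff_deriv]
  refine ⟨fun s => (hasDerivAt_smoothPos δ s).differentiableAt, ?_⟩
  rw [show deriv (smoothPos δ) = fun s => Real.smoothTransition (s / δ) from
    funext fun s => (hasDerivAt_smoothPos δ s).deriv]
  exact Real.smoothTransition.contDiff.comp (contDiff_id.div_const δ)

theorem monotone_smoothPos (δ : ℝ) : Monotone (smoothPos δ) :=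
  monotone_of_deriv_nonneg (fun s => (hasDerivAt_smoothPos δ s).differentiableAt) fun s => by
    rw [(hasDerivAt_smoothPos δ s).deriv]
    exact Real.smoothTransition.nonneg _

theorem smoothPos_of_nonpos {δ s : ℝ} (hδ : 0 < δ) (hs : s ≤ 0) : smoothPos δ s = 0 := by
  rw [smoothPos, intervalIntegral.integral_symm, neg_eq_zero]
  refine intervalIntegral.integral_zero_ae (ae_of_all _ fun t ht => ?_)
  rw [Set.uIoc_of_le hs] at ht
  exact Real.smoothTransition.zero_of_nonpos (div_nonpos_of_nonpos_of_nonneg ht.2 hδ.le)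

theorem smoothPos_nonneg {δ s : ℝ} (hδ : 0 < δ) : 0 ≤ smoothPos δ s := by
  rcases le_total s 0 with hs | hs
  · exact (smoothPos_of_nonpos hδ hs).ge
  · rw [← smoothPos_of_nonpos hδ (le_refl (0 : ℝ))]
    exact monotone_smoothPos δ hs

theorem sub_le_smoothPos {δ s : ℝ} (hδ : 0 < δ) : s - δ ≤ smoothPos δ s := by
  rcases le_total s δ with hs | hs
  · exact (sub_nonpos.mpr hs).trans (smoothPos_nonneg hδ)
  have h1 : ∫ _ in δ..s, (1 : ℝ) = ∫ t in δ..s, Real.smoothTransition (t / δ) := by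
    refine intervalIntegral.integral_congr fun t ht => ?_
    rw [Set.uIcc_of_le hs] at ht
    exact (Real.smoothTransition.one_of_one_le ((one_le_div hδ).mpr ht.1)).symm
  have h2 : smoothPos δ s = smoothPos δ δ + ∫ t in δ..s, Real.smoothTransition (t / δ) :=
    (intervalIntegral.integral_add_adjacent_intervals
      ((continuous_smoothTransition_div δ).intervalIntegrable _ _)
      ((continuous_smoothTransition_div δ).intervalIntegrable _ _)).symm
  rw [h2, ← h1]
  simpa using smoothPos_nonneg hδ

theorem abs_smoothPos_sub_le (δ a b : ℝ) : |smoothPos δ a - smoothPos δ b| ≤ |a - b| := by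
  have h : LipschitzWith 1 (smoothPos δ) :=
    lipschitzWith_of_nnnorm_deriv_le (fun s => (hasDerivAt_smoothPos δ s).differentiableAt)
      fun s => by
        rw [(hasDerivAt_smoothPos δ s).deriv, ← NNReal.coe_le_coe, coe_nnnorm,
          Real.norm_of_nonneg (Real.smoothTransition.nonneg _)]
        exact Real.smoothTransition.le_one _
  simpa [Real.dist_eq] using h.dist_le_mul a b

theorem smoothPos_le_of_nonneg {δ s : ℝ} (hδ : 0 < δ) (hs : 0 ≤ s) : smoothPos δ s ≤ s := by
  have h := abs_smoothPos_sub_le δ s 0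
  rw [smoothPos_of_nonpos hδ le_rfl, sub_zero, sub_zero, abs_of_nonneg (smoothPos_nonneg hδ),
    abs_of_nonneg hs] at h
  exact h

variable {N : ℕ} {Ω : Set (E N)}

theorem gradient_smoothPos_sub {δ : ℝ} {φ h : E N → ℝ} {x : E N} (hφ : DifferentiableAt ℝ φ x)
    (hh : DifferentiableAt ℝ h x) :
    gradient (fun y => smoothPos δ (φ y - h y)) x =
      Real.smoothTransition ((φ x - h x) / δ) • (gradient φ x - gradient h x) := by
  have h1 := (hasDerivAt_smoothPos δ (φ x - h x)).comp_hasFDerivAt x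
    (hφ.hasFDerivAt.sub hh.hasFDerivAt)
  have h2 : HasFDerivAt (fun y => smoothPos δ (φ y - h y)) _ x := h1
  simp [gradient, h2.fderiv]

/-- A nonnegative h puts the argument in the zero set of `smoothPos` wherever φ vanishes, so the
support stays inside that of φ. Smoothness of the truncation keeps it a test function, which an
ordinary positive part would not be. -/
theorem IsTestFunction.smoothPos_sub {δ : ℝ} (hδ : 0 < δ) {φ h : E N → ℝ}
    (hφ : IsTestFunction Ω φ) (hh : ContDiff ℝ ∞ h) (hpos : ∀ x, 0 ≤ h x) :
    IsTestFunction Ω fun x => smoothPos δ (φ x - h x) := by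
  have hsupp : Function.support (fun x => smoothPos δ (φ x - h x)) ⊆ Function.support φ := by
    intro x hx hx'
    refine hx (smoothPos_of_nonpos hδ ?_)
    rw [hx']
    linarith [hpos x]
  exact ⟨(contDiff_smoothPos δ).comp (hφ.1.sub hh), hφ.2.1.mono hsupp,
    (closure_mono hsupp).trans hφ.2.2⟩

/-- Dominated convergence in `L^p` for bounded multipliers. -/
theorem tendsto_eLpNorm_smul_zero {α F : Type*} [MeasurableSpace α] {μ : Measure α}
    [NormedAddCommGroup F] [NormedSpace ℝ F] {p : ℝ} (hp : 0 < p) {g : α → F}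
    (hg : MemLp g (ENNReal.ofReal p) μ) {a : ℕ → α → ℝ}
    (ha : ∀ n, AEStronglyMeasurable (a n) μ) (ha1 : ∀ n x, |a n x| ≤ 1)
    (hlim : ∀ᵐ x ∂μ, Tendsto (fun n => a n x) atTop (𝓝 0)) :
    Tendsto (fun n => eLpNorm (fun x => a n x • g x) (ENNReal.ofReal p) μ) atTop (𝓝 0) := by
  have hP0 : ENNReal.ofReal p ≠ 0 := by simpa using hp
  simp_rw [eLpNorm_eq_lintegral_rpow_enorm_toReal hP0 ENNReal.ofReal_ne_top,
    ENNReal.toReal_ofReal hp.le]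
  have h : Tendsto (fun n => ∫⁻ x, ‖a n x • g x‖ₑ ^ p ∂μ) atTop (𝓝 (∫⁻ _, 0 ∂μ)) := by
    refine tendsto_lintegral_of_dominated_convergence' (fun x => ‖g x‖ₑ ^ p)
      (fun n => ((ha n).smul hg.1).enorm.pow_const p) (fun n => ae_of_all _ fun x => ?_) ?_ ?_
    · simp only [enorm_smul]
      gcongr
      refine mul_le_of_le_one_left zero_le ?_
      rw [← ofReal_norm]
      simpa using ha1 n x
    · have := hg.2
      rw [eLpNorm_lt_top_iff_lintegral_rpow_enorm_lt_top hP0 ENNReal.ofReal_ne_top,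
        ENNReal.toReal_ofReal hp.le] at this
      exact this.ne
    · filter_upwards [hlim] with x hx
      have h1 : Tendsto (fun n => ‖a n x • g x‖ₑ ^ p) atTop (𝓝 (‖(0 : ℝ) • g x‖ₑ ^ p)) :=
        ((ENNReal.continuous_rpow_const (y := p)).tendsto _).comp (hx.smul_const (g x)).enorm
      simpa [hp] using h1
  have h2 := ((ENNReal.continuous_rpow_const (y := 1 / p)).tendsto _).comp h
  simpa [hp, Function.comp_def] using h2

/-- Smooth truncations of functions in `W_0^{1,p}(Ω)` above a smooth positive barrier. -/
theorem MemW1p0.smoothPos_sub (hΩ : Bornology.IsBounded Ω) {p δ : ℝ} (hp : 1 ≤ p) (hδ : 0 < δ)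
    {u h : E N → ℝ} {Du : E N → E N} (hu : MemW1p0 Ω p u Du) (hh : ContDiff ℝ ∞ h)
    (hpos : ∀ x, 0 ≤ h x) :
    MemW1p0 Ω p (fun x => smoothPos δ (u x - h x))
      (fun x => Real.smoothTransition ((u x - h x) / δ) • (Du x - gradient h x)) := by
  have hfin := isFiniteMeasure_restrict_of_isBounded hΩ
  have hh1 : ContDiff ℝ 1 h := hh.of_le (by exact_mod_cast le_top)
  have hτ := continuous_smoothTransition_div δ
  have hum := hu.memLp.1
  have hhm : AEStronglyMeasurable h (volume.restrict Ω) := hh.continuous.aestronglyMeasurable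
  have hτ1 : ∀ s, |Real.smoothTransition s| ≤ 1 := fun s => by
    rw [abs_of_nonneg (Real.smoothTransition.nonneg _)]
    exact Real.smoothTransition.le_one _
  have hgh : MemLp (gradient h) (ENNReal.ofReal p) (volume.restrict Ω) := by
    obtain ⟨C, hC⟩ := hΩ.isCompact_closure.exists_bound_of_continuousOn
      (continuous_gradient hh1).continuousOn
    refine MemLp.of_bound (continuous_gradient hh1).aestronglyMeasurable C ?_
    have hcl : ∀ᵐ x ∂(volume.restrict Ω), x ∈ closure Ω :=
      ae_mono (Measure.restrict_mono subset_closure le_rfl)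
        (ae_restrict_mem isClosed_closure.measurableSet)
    filter_upwards [hcl] with x hx using hC x hx
  have hD : MemLp (fun x => Du x - gradient h x) (ENNReal.ofReal p) (volume.restrict Ω) :=
    hu.memLp_grad.sub hgh
  have hτm : AEStronglyMeasurable (fun x => Real.smoothTransition ((u x - h x) / δ))
      (volume.restrict Ω) := hτ.comp_aestronglyMeasurable (hum.sub hhm)
  obtain ⟨φ, hφ, h0, h1, hae⟩ := hu.exists_approx_ae (by linarith)
  have hφm : ∀ n, AEStronglyMeasurable (fun x => Real.smoothTransition ((φ n x - h x) / δ))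
      (volume.restrict Ω) := fun n =>
    (hτ.comp ((hφ n).1.continuous.sub hh.continuous)).aestronglyMeasurable
  refine memW1p0_of_tendsto hΩ hp ?_ ?_ (fun n => (hφ n).smoothPos_sub hδ hh hpos) ?_ ?_
  · refine hu.memLp.of_le
      ((contDiff_smoothPos δ).continuous.comp_aestronglyMeasurable (hum.sub hhm))
      (ae_of_all _ fun x => ?_)
    rw [Real.norm_of_nonneg (smoothPos_nonneg hδ), Real.norm_eq_abs]
    rcases le_total (u x - h x) 0 with hx | hx
    · rw [smoothPos_of_nonpos hδ hx]; positivity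
    · exact (smoothPos_le_of_nonneg hδ hx).trans
        ((sub_le_self _ (hpos x)).trans (le_abs_self _))
  · refine hD.of_le (hτm.smul hD.1) (ae_of_all _ fun x => ?_)
    rw [norm_smul]
    exact mul_le_of_le_one_left (norm_nonneg _) (hτ1 _)
  · refine tendsto_of_tendsto_of_tendsto_of_le_of_le tendsto_const_nhds h0 (fun _ => zero_le)
      (fun n => eLpNorm_mono fun x => ?_)
    simpa using abs_smoothPos_sub_le δ (φ n x - h x) (u x - h x)
  · have e : ∀ n x, gradient (fun y => smoothPos δ (φ n y - h y)) x -
        Real.smoothTransition ((u x - h x) / δ) • (Du x - gradient h x) =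
        Real.smoothTransition ((φ n x - h x) / δ) • (gradient (φ n) x - Du x) +
        (Real.smoothTransition ((φ n x - h x) / δ) - Real.smoothTransition ((u x - h x) / δ)) •
          (Du x - gradient h x) := by
      intro n x
      rw [gradient_smoothPos_sub ((hφ n).contDiff_one.differentiable one_ne_zero x)
        (hh1.differentiable one_ne_zero x)]
      module
    simp_rw [e]
    have t2 := tendsto_eLpNorm_smul_zero (by linarith) hD
      (a := fun n x => Real.smoothTransition ((φ n x - h x) / δ) -
        Real.smoothTransition ((u x - h x) / δ)) (fun n => (hφm n).sub hτm)
      (fun n x => abs_sub_le_iff.mpr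
        ⟨by linarith [Real.smoothTransition.le_one ((φ n x - h x) / δ),
          Real.smoothTransition.nonneg ((u x - h x) / δ)],
         by linarith [Real.smoothTransition.le_one ((u x - h x) / δ),
          Real.smoothTransition.nonneg ((φ n x - h x) / δ)]⟩)
      (hae.mono fun x hx => by
        have := ((hτ.tendsto _).comp (hx.sub_const (h x))).sub_const
          (Real.smoothTransition ((u x - h x) / δ))
        simpa using this)
    have t3 := h1.add t2
    rw [add_zero] at t3
    refine tendsto_of_tendsto_of_tendsto_of_le_of_le tendsto_const_nhds t3 (fun _ => zero_le)
      (fun n => ?_)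
    have hm1 : AEStronglyMeasurable (fun x => gradient (φ n) x - Du x) (volume.restrict Ω) :=
      ((hφ n).memLp_gradient 1 _).1.sub hu.memLp_grad.1
    refine (eLpNorm_add_le ((hφm n).smul hm1) (((hφm n).sub hτm).smul hD.1)
      (by simpa using ENNReal.ofReal_le_ofReal hp)).trans ?_
    refine add_le_add (eLpNorm_mono fun x => ?_) le_rfl
    simp only [Pi.smul_apply', norm_smul]
    exact mul_le_of_le_one_left (norm_nonneg _) (hτ1 _)

end SmoothTruncation

/-! ### The singular barrier and the energy above it. -/

section Truncation

variable {N : ℕ} {Ω : Set (E N)}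

theorem rpow_add_le_two_rpow_mul {p a b : ℝ} (hp : 1 ≤ p) (ha : 0 ≤ a) (hb : 0 ≤ b) :
    (a + b) ^ p ≤ 2 ^ (p - 1) * (a ^ p + b ^ p) := by
  lift a to NNReal using ha
  lift b to NNReal using hb
  exact_mod_cast NNReal.rpow_add_le_mul_rpow_add_rpow a b (p := p) hp

theorem abs_norm_rpow_mul_inner_le (p : ℝ) (X Y : E N) :
    |‖X‖ ^ (p - 2) * inner ℝ X Y| ≤ ‖X‖ ^ (p - 1) * ‖Y‖ := by
  rcases eq_or_ne X 0 with rfl | hX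
  · simp only [inner_zero_left, mul_zero, abs_zero]; positivity
  have hX0 : 0 < ‖X‖ := norm_pos_iff.mpr hX
  rw [abs_mul, abs_of_nonneg (by positivity)]
  calc ‖X‖ ^ (p - 2) * |inner ℝ X Y| ≤ ‖X‖ ^ (p - 2) * (‖X‖ * ‖Y‖) := by
        gcongr; exact abs_real_inner_le_norm X Y
    _ = ‖X‖ ^ (p - 1) * ‖Y‖ := by
        rw [← mul_assoc, ← Real.rpow_add_one hX0.ne']; ring_nf

/-- A coercivity inequality for the `p`-Laplacian flux. -/
theorem norm_rpow_mul_inner_sub_ge {p : ℝ} (hp : 1 < p) (X Y : E N) :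
    (2 ^ (1 - p) * ‖X - Y‖ ^ p - 2 * ‖Y‖ ^ p) / p ≤ ‖X‖ ^ (p - 2) * inner ℝ X (X - Y) := by
  -- Young on the cross term leaves (‖X‖^p - ‖Y‖^p)/p, and convexity trades ‖X‖^p for ‖X - Y‖^p. The
  -- resulting factor 2^(1-p)/p tends to 1 as p → 1, so no coercivity is lost in the limit.
  have h1 := (le_abs_self _).trans (abs_norm_rpow_mul_inner_le p X Y)
  have h2 := young_rpow hp (norm_nonneg X) (norm_nonneg Y)
  have h3 : ‖X - Y‖ ^ p ≤ 2 ^ (p - 1) * (‖X‖ ^ p + ‖Y‖ ^ p) :=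
    (Real.rpow_le_rpow (norm_nonneg _) (norm_sub_le X Y) (by linarith)).trans
      (rpow_add_le_two_rpow_mul hp.le (norm_nonneg _) (norm_nonneg _))
  have h4 : (2 : ℝ) ^ (1 - p) * ‖X - Y‖ ^ p ≤ ‖X‖ ^ p + ‖Y‖ ^ p := by
    have h := mul_le_mul_of_nonneg_left h3 (by positivity : (0 : ℝ) ≤ 2 ^ (1 - p))
    rwa [← mul_assoc, ← Real.rpow_add two_pos, show 1 - p + (p - 1) = 0 by ring, Real.rpow_zero,
      one_mul] at h
  rw [inner_sub_right, mul_sub, norm_rpow_sub_two_mul_inner hp, div_le_iff₀ (by linarith)]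
  nlinarith

/-- Replace s by m = max s b, for which a m ≥ 1 and hence (a m)^(p-1) ≥ 1. This passes from L¹ to
L^p with the factor a^(p-1), which tends to 1 as p → 1; a cruder factor would destroy the smallness
condition on f. -/
theorem le_rpow_mul_rpow_add {p a s b : ℝ} (hp : 1 < p) (ha : 0 < a) (hs : 0 ≤ s)
    (hb : a⁻¹ ≤ b) : s ≤ a ^ (p - 1) * (s ^ p + b ^ p) := by
  have hb0 : 0 < b := (inv_pos.mpr ha).trans_le hb
  have hm0 : 0 < max s b := lt_max_of_lt_right hb0
  have h1 : 1 ≤ a * max s b := by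
    calc 1 = a * a⁻¹ := (mul_inv_cancel₀ ha.ne').symm
      _ ≤ a * max s b := by gcongr; exact hb.trans (le_max_right _ _)
  have h2 : 1 ≤ (a * max s b) ^ (p - 1) := Real.one_le_rpow h1 (by linarith)
  have h3 : max s b ^ p ≤ s ^ p + b ^ p := by
    rcases max_cases s b with ⟨h, -⟩ | ⟨h, -⟩ <;> rw [h]
    · exact le_add_of_nonneg_right (by positivity)
    · exact le_add_of_nonneg_left (by positivity)
  calc s ≤ max s b * 1 := by rw [mul_one]; exact le_max_left _ _
    _ ≤ max s b * (a * max s b) ^ (p - 1) := by gcongr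
    _ = a ^ (p - 1) * max s b ^ p := by
        rw [Real.mul_rpow ha.le hm0.le, Real.rpow_sub_one hm0.ne']; field_simp
    _ ≤ _ := by gcongr

/-- The (regularized) power barrier `(‖x‖² + ε)^{-N}`. -/
noncomputable def barrier (ε : ℝ) (x : E N) : ℝ := (‖x‖ ^ 2 + ε) ^ (-(N : ℝ))

theorem barrier_nonneg {ε : ℝ} (hε : 0 ≤ ε) (x : E N) : 0 ≤ barrier ε x :=
  Real.rpow_nonneg (by positivity) _

theorem barrier_pos {ε : ℝ} (hε : 0 ≤ ε) {x : E N} (hx : x ≠ 0) : 0 < barrier ε x :=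
  Real.rpow_pos_of_pos (by have := norm_pos_iff.mpr hx; positivity) _

theorem contDiff_barrier {ε : ℝ} (hε : 0 < ε) {n : WithTop ℕ∞} :
    ContDiff ℝ n (barrier (N := N) ε) :=
  contDiff_normSq_add_rpow hε _

theorem measurable_barrier (ε : ℝ) : Measurable (barrier (N := N) ε) :=
  ((measurable_norm.pow_const 2).add_const ε).pow_const _

theorem barrier_strictAnti {ε ε' : ℝ} (hε : 0 ≤ ε) (h : ε < ε') (hN : 2 ≤ N) {x : E N}
    (hx : x ≠ 0) : barrier ε' x < barrier ε x := by
  have := norm_pos_iff.mpr hx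
  exact Real.rpow_lt_rpow_of_neg (by positivity) (by linarith) (by simp; omega)

/-- The logarithmic derivative of the barrier has size 2N|x|/(|x|² + ε) ≤ 2N/|x|. The bound has no
separate ε-dependent constant, so ∇h is measured by the weight h/|x|. -/
theorem norm_gradient_barrier_le {ε K : ℝ} (hε : 0 < ε) (hK : 0 ≤ K) {x : E N} (hx : x ≠ 0) :
    ‖gradient (fun y => K * barrier ε y) x‖ ≤ 2 * N * K * (‖x‖⁻¹ * barrier ε x) := by
  have hx0 := norm_pos_iff.mpr hx
  have hA : 0 < ‖x‖ ^ 2 + ε := by positivity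
  have h1 : HasFDerivAt (fun y : E N => K * barrier ε y) _ x :=
    (hasFDerivAt_normSq_add_rpow hε (-(N : ℝ)) x).const_mul K
  rw [norm_gradient, h1.fderiv, norm_smul, norm_smul, Real.norm_of_nonneg hK, norm_mul, norm_neg,
    Real.norm_of_nonneg (Nat.cast_nonneg N), Real.norm_of_nonneg (Real.rpow_nonneg hA.le _),
    ← Nat.cast_smul_eq_nsmul ℝ, norm_smul, innerSL_apply_norm, Real.rpow_sub_one hA.ne']
  simp only [barrier, Nat.cast_ofNat, Real.norm_ofNat]
  have h2 : ‖x‖ / (‖x‖ ^ 2 + ε) ≤ ‖x‖⁻¹ := by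
    rw [div_le_iff₀ hA]
    field_simp
    linarith
  calc K * (N * ((‖x‖ ^ 2 + ε) ^ (-(N : ℝ)) / (‖x‖ ^ 2 + ε)) * (2 * ‖x‖))
      = 2 * N * K * (‖x‖ / (‖x‖ ^ 2 + ε) * (‖x‖ ^ 2 + ε) ^ (-(N : ℝ))) := by ring
    _ ≤ _ := by gcongr

/-- The barrier is at least (R² + 1)^(-N), and |x|⁻¹ contributes one more factor since |x| ≤ R ≤ R²
+ 1. One constant thus serves both as threshold for δ and as lower bound for the weight. -/
theorem inv_le_barrier {ε R : ℝ} (hε : 0 ≤ ε) (hε1 : ε ≤ 1) {x : E N} (hx : x ≠ 0)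
    (hxR : ‖x‖ ≤ R) :
    ((R ^ 2 + 1) ^ (N + 1))⁻¹ ≤ barrier ε x ∧
      ((R ^ 2 + 1) ^ (N + 1))⁻¹ ≤ ‖x‖⁻¹ * barrier ε x := by
  have hx0 := norm_pos_iff.mpr hx
  have hA : 0 < ‖x‖ ^ 2 + ε := by positivity
  have h1 : ((R ^ 2 + 1) ^ N)⁻¹ ≤ barrier ε x := by
    rw [barrier, Real.rpow_neg hA.le, Real.rpow_natCast]
    gcongr
  constructor
  · refine le_trans ?_ h1
    gcongr
    · nlinarith [sq_nonneg R]
    · omega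
  · rw [pow_succ, mul_inv, mul_comm]
    gcongr
    nlinarith [sq_nonneg (R - 1)]

/-- The weighted measure of the set where `u` exceeds `K` times the regularized barrier. -/
noncomputable def superlevelMass (Ω : Set (E N)) (p : ℝ) (u : E N → ℝ) (ε K : ℝ) : ℝ :=
  ∫ x in Ω, {x | K * barrier ε x < u x}.indicator (fun x => (‖x‖⁻¹ * barrier ε x) ^ p) x

/-- On the superlevel set the barrier is at most |u|, because K ≥ 1. The majorant is integrable by
Hardy and independent of ε, which permits ε → 0. -/
theorem superlevel_indicator_le {p ε K : ℝ} (hp : 0 ≤ p) (hε : 0 ≤ ε) (hK : 1 ≤ K) (u : E N → ℝ)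
    (x : E N) :
    {x | K * barrier ε x < u x}.indicator (fun x => (‖x‖⁻¹ * barrier ε x) ^ p) x ≤
      (‖x‖⁻¹ * |u x|) ^ p := by
  by_cases hx : K * barrier ε x < u x
  · rw [Set.indicator_of_mem (by exact hx)]
    have hb := barrier_nonneg hε x
    have : barrier ε x ≤ |u x| := by
      refine le_trans ?_ (hx.le.trans (le_abs_self _))
      nlinarith
    gcongr
  · rw [Set.indicator_of_notMem (by exact hx)]
    positivity

theorem aestronglyMeasurable_superlevel {p ε K : ℝ} {u : E N → ℝ} {μ : Measure (E N)}
    (hu : AEStronglyMeasurable u μ) :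
    AEStronglyMeasurable
      ({x | K * barrier ε x < u x}.indicator (fun x => (‖x‖⁻¹ * barrier ε x) ^ p)) μ :=
  (AEMeasurable.indicator₀ ((measurable_norm.inv.mul (measurable_barrier ε)).pow_const p).aemeasurable
    (nullMeasurableSet_lt ((measurable_barrier ε).const_mul K).aemeasurable
      hu.aemeasurable)).aestronglyMeasurable

theorem MemW1p0.integrable_hardy (hΩ : Bornology.IsBounded Ω) {p : ℝ} (hp : 1 < p) (hpN : p < N)
    {u : E N → ℝ} {Du : E N → E N} (hu : MemW1p0 Ω p u Du) :
    Integrable (fun x => (‖x‖⁻¹ * |u x|) ^ p) (volume.restrict Ω) := by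
  have h := (hu.memLp_div_norm hΩ hp hpN).integrable_norm_rpow (by simp; linarith)
    ENNReal.ofReal_ne_top
  rw [ENNReal.toReal_ofReal (by linarith)] at h
  simpa [abs_mul] using h

theorem MemW1p0.integrable_superlevel (hΩ : Bornology.IsBounded Ω) {p : ℝ} (hp : 1 < p)
    (hpN : p < N) {u : E N → ℝ} {Du : E N → E N} (hu : MemW1p0 Ω p u Du) {ε K : ℝ} (hε : 0 ≤ ε)
    (hK : 1 ≤ K) :
    Integrable ({x | K * barrier ε x < u x}.indicator (fun x => (‖x‖⁻¹ * barrier ε x) ^ p))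
      (volume.restrict Ω) := by
  refine (hu.integrable_hardy hΩ hp hpN).mono' (aestronglyMeasurable_superlevel hu.memLp.1)
    (ae_of_all _ fun x => ?_)
  rw [Real.norm_of_nonneg (Set.indicator_nonneg (fun y _ => Real.rpow_nonneg
    (mul_nonneg (by positivity) (barrier_nonneg hε y)) _) x)]
  exact superlevel_indicator_le (by linarith) hε hK u x

/-- The potential term, tested with a truncation of the solution. -/
theorem potential_truncation_le {p δ h s r : ℝ} (hp : 1 < p) (hp2 : p ≤ 2) (hδ : 0 < δ)
    (hδh : δ ≤ h) {K : ℝ} (hK : 0 ≤ K) (hK2 : K ≤ 2) (hs : K * h < s) (hr : 0 ≤ r) :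
    1 / r ^ p * (|s| ^ (p - 2) * s) * smoothPos δ (s - K * h) ≤
      2 ^ (p - 1) * (r⁻¹ * smoothPos δ (s - K * h)) ^ p + 36 * (r⁻¹ * h) ^ p := by
  have hh : 0 < h := hδ.trans_le hδh
  have hs0 : 0 < s := (mul_nonneg hK hh.le).trans_lt hs
  set φ := smoothPos δ (s - K * h) with hφ
  have hφ0 : 0 ≤ φ := smoothPos_nonneg hδ
  -- The 3 is 2 for K ≤ 2 plus 1 for the truncation error δ ≤ h.
  have hsφ : s ≤ φ + 3 * h := by
    have := sub_le_smoothPos (s := s - K * h) hδ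
    nlinarith
  have e1 : |s| ^ (p - 2) * s = s ^ (p - 1) := by
    rw [abs_of_pos hs0, ← Real.rpow_add_one hs0.ne']; ring_nf
  have key : s ^ (p - 1) * φ ≤ 2 ^ (p - 1) * φ ^ p + 36 * h ^ p := by
    -- If 3h ≤ φ then s ≤ 2φ; otherwise both s and φ are at most 6h, and 6^p ≤ 36. The coefficient
    -- of φ^p is thus 2^(p-1), again tending to 1.
    rcases le_total (3 * h) φ with h3 | h3
    · have hφ' : 0 < φ := by linarith
      calc s ^ (p - 1) * φ ≤ (2 * φ) ^ (p - 1) * φ := by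
            gcongr
            linarith
        _ = 2 ^ (p - 1) * φ ^ p := by
            rw [Real.mul_rpow zero_le_two hφ0, Real.rpow_sub_one hφ'.ne']; field_simp
        _ ≤ _ := le_add_of_nonneg_right (by positivity)
    · calc s ^ (p - 1) * φ ≤ (6 * h) ^ (p - 1) * (6 * h) := by
            gcongr
            · linarith
            · linarith
        _ = 6 ^ p * h ^ p := by
            rw [← Real.rpow_add_one (by positivity), sub_add_cancel,
              Real.mul_rpow (by norm_num) hh.le]
        _ ≤ 6 ^ (2 : ℝ) * h ^ p := by
            gcongr
            norm_num
        _ = 36 * h ^ p := by norm_num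
        _ ≤ _ := le_add_of_nonneg_left (by positivity)
  rw [e1, Real.mul_rpow (by positivity) hφ0, Real.mul_rpow (by positivity) hh.le,
    Real.inv_rpow hr, one_div]
  have := mul_le_mul_of_nonneg_left key (by positivity : 0 ≤ (r ^ p)⁻¹)
  linarith

/-- The energy estimate above the barrier, obtained by testing the equation with
a truncation of the solution. -/
theorem IsWeakSolution.truncation_energy (hN : 2 ≤ N) (hΩ : Bornology.IsBounded Ω)
    (hΩm : MeasurableSet Ω) {R : ℝ} (hR : ∀ x ∈ Ω, ‖x‖ ≤ R)
    {lam p : ℝ} (hlam : 0 ≤ lam) (hp : 1 < p) (hp2 : p < 2) {f : E N → ℝ}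
    (hf : MemLp f (N : ℝ≥0∞) (volume.restrict Ω))
    (hfS : eLpNorm f (N : ℝ≥0∞) (volume.restrict Ω) * sobolevConst N ≠ ⊤)
    {u : E N → ℝ} {Du : E N → E N} (hu : IsWeakSolution Ω lam f p u Du)
    {K ε δ a c : ℝ} (hK : 1 ≤ K) (hK2 : K ≤ 2) (hε : 0 < ε) (hε1 : ε ≤ 1) (hδ : 0 < δ)
    (ha : a = (R ^ 2 + 1) ^ (N + 1)) (hδa : δ ≤ a⁻¹)
    (hc : c = (eLpNorm f (N : ℝ≥0∞) (volume.restrict Ω) * sobolevConst N).toReal) :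
    ∃ Dφ : E N → E N, MemW1p0 Ω p (fun x => smoothPos δ (u x - K * barrier ε x)) Dφ ∧
      ∫ x in Ω, ‖Dφ x‖ ≤
        a ^ (p - 1) * ((∫ x in Ω, ‖Dφ x‖ ^ p) + superlevelMass Ω p u ε K) ∧
      (2 ^ (1 - p) / p - lam * (2 ^ (p - 1) * hardyConst N p) - c * a ^ (p - 1)) *
        ∫ x in Ω, ‖Dφ x‖ ^ p ≤
          (lam * 36 + 32 * N ^ 2 + c * a ^ (p - 1)) * superlevelMass Ω p u ε K := by
  have hfin := isFiniteMeasure_restrict_of_isBounded hΩ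
  have hN' : (2 : ℝ) ≤ N := by exact_mod_cast hN
  have hpN : p < N := by linarith
  have hp0 : 0 < p := by linarith
  have ha0 : 0 < a := by rw [ha]; positivity
  have hc0 : 0 ≤ c := by rw [hc]; exact ENNReal.toReal_nonneg
  have hNe : Nonempty (Fin N) := ⟨⟨0, by omega⟩⟩
  set h : E N → ℝ := fun x => K * barrier ε x with hh
  have hhs : ContDiff ℝ ∞ h := contDiff_const.mul (contDiff_barrier hε)
  have hh0 : ∀ x, 0 ≤ h x := fun x => mul_nonneg (by linarith) (barrier_nonneg hε.le x)
  set Dφ : E N → E N := fun x =>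
    Real.smoothTransition ((u x - h x) / δ) • (Du x - gradient h x) with hDφ
  have hφ : MemW1p0 Ω p (fun x => smoothPos δ (u x - h x)) Dφ :=
    hu.mem.smoothPos_sub hΩ hp.le hδ hhs hh0
  set χ : E N → ℝ := {x | K * barrier ε x < u x}.indicator
    (fun x => (‖x‖⁻¹ * barrier ε x) ^ p) with hχ
  have hχ0 : ∀ x, 0 ≤ χ x := fun x => Set.indicator_nonneg (fun y _ => Real.rpow_nonneg
    (mul_nonneg (by positivity) (barrier_nonneg hε.le y)) _) x
  have hχ1 : ∀ x, K * barrier ε x < u x → χ x = (‖x‖⁻¹ * barrier ε x) ^ p := fun x hx =>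
    Set.indicator_of_mem (s := {x | K * barrier ε x < u x}) hx _
  have hχ2 : ∀ x, ¬ K * barrier ε x < u x → χ x = 0 := fun x hx =>
    Set.indicator_of_notMem (s := {x | K * barrier ε x < u x}) hx _
  have hJ : superlevelMass Ω p u ε K = ∫ x in Ω, χ x := rfl
  have hχI : Integrable χ (volume.restrict Ω) :=
    hu.mem.integrable_superlevel hΩ hp hpN hε.le hK
  have hΦI := hφ.integrable_norm_rpow hp.le
  have hDφI := memLp_one_iff_integrable.mp (hφ.memLp_one_grad hΩ hp.le)
  have hae : ∀ᵐ x ∂(volume.restrict Ω), x ∈ Ω ∧ x ≠ 0 := by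
    refine (ae_restrict_mem hΩm).and (ae_restrict_of_ae ?_)
    simp [ae_iff, measure_singleton]
  have hzero : ∀ x, ¬ K * barrier ε x < u x → Dφ x = 0 ∧ smoothPos δ (u x - h x) = 0 := by
    intro x hx
    have hx' : u x - h x ≤ 0 := by simp only [hh]; linarith
    refine ⟨?_, smoothPos_of_nonpos hδ hx'⟩
    simp only [hDφ]
    rw [Real.smoothTransition.zero_of_nonpos (div_nonpos_of_nonpos_of_nonneg hx' hδ.le), zero_smul]
  have hgrad1 : ∫ x in Ω, ‖Dφ x‖ ≤
      a ^ (p - 1) * ((∫ x in Ω, ‖Dφ x‖ ^ p) + superlevelMass Ω p u ε K) := by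
    rw [hJ, ← integral_add hΦI hχI, ← integral_const_mul]
    refine integral_mono_ae hDφI.norm ((hΦI.add hχI).const_mul _) ?_
    filter_upwards [hae] with x ⟨hxΩ, hx0⟩
    by_cases hx : K * barrier ε x < u x
    · rw [hχ1 x hx]
      exact le_rpow_mul_rpow_add hp ha0 (norm_nonneg _)
        (by rw [ha]; exact (inv_le_barrier hε.le hε1 hx0 (hR x hxΩ)).2)
    · simp only [(hzero x hx).1, norm_zero]
      have := hχ0 x
      positivity
  refine ⟨Dφ, hφ, hgrad1, ?_⟩
  have heq := hu.weak_eq _ _ hφ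
  have hLI : Integrable (fun x => ‖Du x‖ ^ (p - 2) * inner ℝ (Du x) (Dφ x))
      (volume.restrict Ω) := by
    refine ((hu.mem.integrable_norm_rpow hp.le).add hΦI).mono' ?_ (ae_of_all _ fun x => ?_)
    · exact ((hu.mem.memLp_grad.1.norm.aemeasurable.pow_const (p - 2)).aestronglyMeasurable).mul
        (hu.mem.memLp_grad.1.inner hφ.memLp_grad.1)
    · refine (abs_norm_rpow_mul_inner_le p _ _).trans ?_
      have h1 := young_rpow hp (norm_nonneg (Du x)) (norm_nonneg (Dφ x))
      have h2 : 0 ≤ ‖Du x‖ ^ p := by positivity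
      have h3 : 0 ≤ ‖Dφ x‖ ^ p := by positivity
      simp only [Pi.add_apply]
      nlinarith
  have hL : 2 ^ (1 - p) / p * (∫ x in Ω, ‖Dφ x‖ ^ p) - 32 * N ^ 2 * superlevelMass Ω p u ε K ≤
      ∫ x in Ω, ‖Du x‖ ^ (p - 2) * inner ℝ (Du x) (Dφ x) := by
    rw [hJ, ← integral_const_mul, ← integral_const_mul,
      ← integral_sub (hΦI.const_mul _) (hχI.const_mul _)]
    refine integral_mono_ae ((hΦI.const_mul _).sub (hχI.const_mul _)) hLI ?_
    filter_upwards [hae] with x ⟨hxΩ, hx0⟩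
    by_cases hx : K * barrier ε x < u x
    · rw [hχ1 x hx]
      set τ := Real.smoothTransition ((u x - h x) / δ) with hτ
      have hτ0 : 0 ≤ τ := Real.smoothTransition.nonneg _
      have hτ1 : τ ≤ 1 := Real.smoothTransition.le_one _
      have hb := barrier_nonneg hε.le x
      -- The gradient bound with K ≤ 2 gives 4N, and p < 2 gives (4N)^p ≤ 16N².
      have hY : ‖gradient h x‖ ^ p ≤ 16 * N ^ 2 * (‖x‖⁻¹ * barrier ε x) ^ p := by
        calc ‖gradient h x‖ ^ p ≤ (4 * N * (‖x‖⁻¹ * barrier ε x)) ^ p := by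
              gcongr
              refine (norm_gradient_barrier_le hε (by linarith) hx0).trans ?_
              have : 0 ≤ ‖x‖⁻¹ * barrier ε x := by positivity
              refine mul_le_mul_of_nonneg_right ?_ this
              nlinarith
          _ = (4 * N) ^ p * (‖x‖⁻¹ * barrier ε x) ^ p :=
              Real.mul_rpow (by positivity) (by positivity)
          _ ≤ (4 * N) ^ (2 : ℝ) * (‖x‖⁻¹ * barrier ε x) ^ p := by
              gcongr
              linarith
          _ = _ := by rw [Real.rpow_two]; ring
      have hco := norm_rpow_mul_inner_sub_ge hp (Du x) (gradient h x)
      -- ‖Dφ‖^p carries τ^p but the tested flux only one factor τ; 0 ≤ τ ≤ 1 reconciles them in the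
      -- right direction.
      have hτp : τ ^ p ≤ τ := by
        calc τ ^ p ≤ τ ^ (1 : ℝ) := Real.rpow_le_rpow_of_exponent_ge' hτ0 hτ1 zero_le_one hp.le
          _ = τ := Real.rpow_one _
      have hDn : ‖Dφ x‖ ^ p = τ ^ p * ‖Du x - gradient h x‖ ^ p := by
        simp only [hDφ]
        rw [norm_smul, Real.norm_of_nonneg hτ0, Real.mul_rpow hτ0 (norm_nonneg _)]
      rw [hDn]
      simp only [hDφ, inner_smul_right]
      rw [← hτ]
      have hZ : 0 ≤ ‖Du x - gradient h x‖ ^ p := by positivity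
      have hYn : 0 ≤ ‖gradient h x‖ ^ p := by positivity
      calc 2 ^ (1 - p) / p * (τ ^ p * ‖Du x - gradient h x‖ ^ p) -
            32 * N ^ 2 * (‖x‖⁻¹ * barrier ε x) ^ p
          ≤ 2 ^ (1 - p) / p * (τ * ‖Du x - gradient h x‖ ^ p) -
            τ * (2 * ‖gradient h x‖ ^ p / p) := by
            have h1 : τ * (2 * ‖gradient h x‖ ^ p / p) ≤ 2 * ‖gradient h x‖ ^ p := by
              calc τ * (2 * ‖gradient h x‖ ^ p / p) ≤ 1 * (2 * ‖gradient h x‖ ^ p / 1) := by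
                    gcongr
                _ = _ := by ring
            have h2 : 2 ^ (1 - p) / p * (τ ^ p * ‖Du x - gradient h x‖ ^ p) ≤
                2 ^ (1 - p) / p * (τ * ‖Du x - gradient h x‖ ^ p) := by gcongr
            linarith
        _ = τ * ((2 ^ (1 - p) * ‖Du x - gradient h x‖ ^ p - 2 * ‖gradient h x‖ ^ p) / p) := by
            ring
        _ ≤ τ * (‖Du x‖ ^ (p - 2) * inner ℝ (Du x) (Du x - gradient h x)) := by gcongr
        _ = _ := by ring
    · simp only [(hzero x hx).1, norm_zero, inner_zero_right, mul_zero,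
        hχ2 x hx, Real.zero_rpow hp0.ne', sub_zero, le_refl]
  have hHI := hφ.integrable_hardy hΩ hp hpN
  have hP : ∫ x in Ω, 1 / ‖x‖ ^ p * (|u x| ^ (p - 2) * u x) * smoothPos δ (u x - h x) ≤
      2 ^ (p - 1) * (hardyConst N p * ∫ x in Ω, ‖Dφ x‖ ^ p) +
        36 * superlevelMass Ω p u ε K := by
    have h1 : 2 ^ (p - 1) * (∫ x in Ω, (‖x‖⁻¹ * |smoothPos δ (u x - h x)|) ^ p) ≤
        2 ^ (p - 1) * (hardyConst N p * ∫ x in Ω, ‖Dφ x‖ ^ p) := by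
      gcongr
      exact hφ.integral_hardy hΩ hp hpN
    refine le_trans ?_ (add_le_add_left h1 _)
    rw [hJ, ← integral_const_mul, ← integral_const_mul,
      ← integral_add (hHI.const_mul _) (hχI.const_mul _)]
    refine integral_mono_of_nonneg ?_ ((hHI.const_mul _).add (hχI.const_mul _)) ?_
    · refine ae_of_all _ fun x => ?_
      by_cases hx : K * barrier ε x < u x
      · have hu0 : 0 ≤ u x := (hh0 x).trans hx.le
        have := smoothPos_nonneg (s := u x - h x) hδ
        simp only [Pi.zero_apply]
        positivity
      · simp [(hzero x hx).2]
    · filter_upwards [hae] with x ⟨hxΩ, hx0⟩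
      by_cases hx : K * barrier ε x < u x
      · simp only [hχ1 x hx, abs_of_nonneg (smoothPos_nonneg hδ)]
        refine potential_truncation_le hp hp2.le hδ (hδa.trans ?_) (by linarith) hK2 hx
          (norm_nonneg x)
        rw [ha]
        exact (inv_le_barrier hε.le hε1 hx0 (hR x hxΩ)).1
      · simp only [(hzero x hx).2, mul_zero, abs_zero, Real.zero_rpow hp0.ne',
          zero_add, hχ2 x hx, le_refl]
  have hF := (le_abs_self _).trans (hφ.abs_integral_mul_le hN hΩ hp.le hf hfS)
  rw [← hc] at hF
  have hF' := mul_le_mul_of_nonneg_left hgrad1 hc0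
  have hP' := mul_le_mul_of_nonneg_left hP hlam
  linarith

end Truncation

/-! ### De Giorgi iteration over multiples of the barrier. -/

section LevelSets

variable {N : ℕ} {Ω : Set (E N)}

/-- A Sobolev estimate above the barrier, uniform over all weak solutions for `p` close to `1`. -/
theorem eventually_eLpNorm_truncation_le (hN : 2 ≤ N) (hΩ : Bornology.IsBounded Ω)
    (hΩm : MeasurableSet Ω) {R : ℝ} (hR : ∀ x ∈ Ω, ‖x‖ ≤ R)
    {lam : ℝ} (hlam : 0 ≤ lam) {f : E N → ℝ}
    (hf : MemLp f (N : ℝ≥0∞) (volume.restrict Ω))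
    (hfS : eLpNorm f (N : ℝ≥0∞) (volume.restrict Ω) * sobolevConst N ≠ ⊤)
    (hstrict : (eLpNorm f (N : ℝ≥0∞) (volume.restrict Ω) * sobolevConst N).toReal +
      lam / ((N : ℝ) - 1) < 1) :
    ∃ C : ℝ, 0 ≤ C ∧ ∀ᶠ p in 𝓝[>] (1 : ℝ), ∀ (u : E N → ℝ) (Du : E N → E N),
      IsWeakSolution Ω lam f p u Du → ∀ K ε δ : ℝ, 1 ≤ K → K ≤ 2 → 0 < ε → ε ≤ 1 → 0 < δ →
        δ ≤ ((R ^ 2 + 1) ^ (N + 1))⁻¹ →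
        eLpNorm (fun x => smoothPos δ (u x - K * barrier ε x)) (sobolevExp N)
          (volume.restrict Ω) ≤ ENNReal.ofReal (C * superlevelMass Ω p u ε K) := by
  set c := (eLpNorm f (N : ℝ≥0∞) (volume.restrict Ω) * sobolevConst N).toReal with hc
  have hc0 : 0 ≤ c := ENNReal.toReal_nonneg
  set a : ℝ := (R ^ 2 + 1) ^ (N + 1) with ha
  have ha1 : 1 ≤ a := one_le_pow₀ (by nlinarith [sq_nonneg R])
  set d : ℝ := (1 - lam / ((N : ℝ) - 1) - c) / 2 with hd
  have hd0 : 0 < d := by rw [hd]; linarith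
  set A : ℝ := lam * 36 + 32 * N ^ 2 + c * a with hA
  have hA0 : 0 ≤ A := by positivity
  -- The coefficient in the truncation energy estimate tends to 1 - λ/(N-1) - c = 2d > 0, so it
  -- exceeds d for p near 1.
  have hlim : Tendsto (fun p : ℝ => 2 ^ (1 - p) / p - lam * (2 ^ (p - 1) * hardyConst N p) -
      c * a ^ (p - 1)) (𝓝[>] 1) (𝓝 (2 * d)) := by
    have t0 : Tendsto (fun p : ℝ => p) (𝓝[>] 1) (𝓝 1) := tendsto_id.mono_left nhdsWithin_le_nhds
    have t1 : Tendsto (fun p : ℝ => (2 : ℝ) ^ (1 - p)) (𝓝[>] 1) (𝓝 (2 ^ (1 - 1 : ℝ))) :=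
      ((Real.continuous_const_rpow two_ne_zero).tendsto _).comp (tendsto_const_nhds.sub t0)
    have t2 : Tendsto (fun p : ℝ => (2 : ℝ) ^ (p - 1)) (𝓝[>] 1) (𝓝 (2 ^ (1 - 1 : ℝ))) :=
      ((Real.continuous_const_rpow two_ne_zero).tendsto _).comp (t0.sub_const 1)
    have t3 : Tendsto (fun p : ℝ => a ^ (p - 1)) (𝓝[>] 1) (𝓝 (a ^ (1 - 1 : ℝ))) :=
      ((Real.continuous_const_rpow (by positivity)).tendsto _).comp (t0.sub_const 1)
    have t := ((t1.div t0 one_ne_zero).sub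
      ((t2.mul (tendsto_hardyConst hN)).const_mul lam)).sub (t3.const_mul c)
    have e : 2 * d = (2 : ℝ) ^ (1 - 1 : ℝ) / 1 -
        lam * ((2 : ℝ) ^ (1 - 1 : ℝ) * (1 / ((N : ℝ) - 1))) - c * a ^ (1 - 1 : ℝ) := by
      rw [sub_self, Real.rpow_zero, Real.rpow_zero, hd]
      ring
    rw [e]
    exact t
  refine ⟨gnsConst N * (a * (A / d + 1)), by positivity, ?_⟩
  filter_upwards [hlim.eventually_const_le (show d < 2 * d by linarith),
    eventually_one_lt_lt one_lt_two] with p hp hp1 u Du hu K ε δ hK hK2 hε hε1 hδ hδa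
  obtain ⟨Dφ, hφ, h1, h2⟩ := hu.truncation_energy hN hΩ hΩm hR hlam hp1.1 hp1.2 hf hfS hK hK2 hε
    hε1 hδ ha hδa hc
  have hΦ0 : 0 ≤ ∫ x in Ω, ‖Dφ x‖ ^ p := integral_nonneg fun x => by positivity
  have hJ0 : 0 ≤ superlevelMass Ω p u ε K := integral_nonneg fun x =>
    Set.indicator_nonneg (fun y _ => Real.rpow_nonneg
      (mul_nonneg (by positivity) (barrier_nonneg hε.le y)) _) x
  have hap : a ^ (p - 1) ≤ a := by
    calc a ^ (p - 1) ≤ a ^ (1 : ℝ) := Real.rpow_le_rpow_of_exponent_le ha1 (by linarith)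
      _ = a := Real.rpow_one a
  have h3 : d * ∫ x in Ω, ‖Dφ x‖ ^ p ≤ A * superlevelMass Ω p u ε K := by
    calc d * ∫ x in Ω, ‖Dφ x‖ ^ p ≤ _ := mul_le_mul_of_nonneg_right hp hΦ0
      _ ≤ _ := h2
      _ ≤ _ := by rw [hA]; gcongr
  have h4 : ∫ x in Ω, ‖Dφ x‖ ^ p ≤ A / d * superlevelMass Ω p u ε K := by
    rw [div_mul_eq_mul_div, le_div_iff₀ hd0]
    linarith
  have h5 : ∫ x in Ω, ‖Dφ x‖ ≤ a * (A / d + 1) * superlevelMass Ω p u ε K := by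
    calc ∫ x in Ω, ‖Dφ x‖ ≤ _ := h1
      _ ≤ a * (A / d * superlevelMass Ω p u ε K + superlevelMass Ω p u ε K) := by gcongr
      _ = _ := by ring
  refine (hφ.eLpNorm_le_gnsConst hN hΩ hp1.1.le).trans ?_
  rw [eLpNorm_one_eq_lintegral_enorm, ← ofReal_integral_norm_eq_lintegral_enorm
      (memLp_one_iff_integrable.mp (hφ.memLp_one_grad hΩ hp1.1.le)),
    ← ENNReal.ofReal_coe_nnreal, ← ENNReal.ofReal_mul NNReal.zero_le_coe, mul_assoc]
  gcongr

/-- The weighted measure of the set where `u` is at least `K` times the barrier. -/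
noncomputable def barrierMass (Ω : Set (E N)) (p : ℝ) (u : E N → ℝ) (K : ℝ) : ℝ :=
  ∫ x in Ω, {x | K * barrier 0 x ≤ u x}.indicator (fun x => (‖x‖⁻¹ * barrier 0 x) ^ p) x

theorem tendsto_barrier_zero {x : E N} (hx : x ≠ 0) :
    Tendsto (fun n : ℕ => barrier (1 / ((n : ℝ) + 1)) x) atTop (𝓝 (barrier 0 x)) := by
  have hx0 := norm_pos_iff.mpr hx
  exact (tendsto_const_nhds.add tendsto_one_div_add_atTop_nhds_zero_nat).rpow_const
    (Or.inl (by positivity))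

theorem ae_restrict_mem_and_ne_zero (hN : 2 ≤ N) (hΩm : MeasurableSet Ω) :
    ∀ᵐ x ∂(volume.restrict Ω), x ∈ Ω ∧ x ≠ 0 := by
  have hNe : Nonempty (Fin N) := ⟨⟨0, by omega⟩⟩
  refine (ae_restrict_mem hΩm).and (ae_restrict_of_ae ?_)
  simp [ae_iff, measure_singleton]

/-- The regularized barriers lie strictly below the limit and converge to it. Hence u ≥ K h forces u
> K h_ε for every ε, while u < K h gives u < K h_ε eventually: strict sets converge to the
non-strict one at every x ≠ 0, including where u = K h. -/
theorem MemW1p0.tendsto_superlevelMass (hN : 2 ≤ N) (hΩ : Bornology.IsBounded Ω)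
    (hΩm : MeasurableSet Ω) {p : ℝ} (hp : 1 < p) (hpN : p < N) {u : E N → ℝ} {Du : E N → E N}
    (hu : MemW1p0 Ω p u Du) {K : ℝ} (hK : 1 ≤ K) :
    Tendsto (fun n : ℕ => superlevelMass Ω p u (1 / ((n : ℝ) + 1)) K) atTop
      (𝓝 (barrierMass Ω p u K)) := by
  refine tendsto_integral_of_dominated_convergence (fun x => (‖x‖⁻¹ * |u x|) ^ p)
    (fun n => aestronglyMeasurable_superlevel hu.memLp.1) (hu.integrable_hardy hΩ hp hpN)
    (fun n => ae_of_all _ fun x => ?_) ?_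
  · have hn : (0 : ℝ) ≤ 1 / ((n : ℝ) + 1) := by positivity
    rw [Real.norm_of_nonneg (Set.indicator_nonneg (fun y _ => Real.rpow_nonneg
      (mul_nonneg (by positivity) (barrier_nonneg hn y)) _) x)]
    exact superlevel_indicator_le (by linarith) hn hK u x
  · filter_upwards [ae_restrict_mem_and_ne_zero hN hΩm] with x ⟨_, hx⟩
    have hlim := tendsto_barrier_zero hx
    have hlimK := hlim.const_mul K
    by_cases hxu : K * barrier 0 x ≤ u x
    · rw [Set.indicator_of_mem (by exact hxu)]
      have hmem : ∀ n : ℕ, K * barrier (1 / ((n : ℝ) + 1)) x < u x := fun n =>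
        (mul_lt_mul_of_pos_left (barrier_strictAnti le_rfl (by positivity) hN hx)
          (by linarith)).trans_le hxu
      exact ((hlim.const_mul _).rpow_const (Or.inr (by linarith))).congr fun n =>
        (Set.indicator_of_mem (s := {x | K * barrier (1 / ((n : ℝ) + 1)) x < u x}) (hmem n) _).symm
    · rw [Set.indicator_of_notMem (by exact hxu)]
      refine tendsto_const_nhds.congr' ?_
      filter_upwards [hlimK.eventually_const_lt (not_le.mp hxu)] with n hn
      exact (Set.indicator_of_notMem (s := {x | K * barrier (1 / ((n : ℝ) + 1)) x < u x})
        (not_lt.mpr hn.le) _).symm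

theorem barrierMass_nonneg {p : ℝ} {u : E N → ℝ} {K : ℝ} : 0 ≤ barrierMass Ω p u K :=
  integral_nonneg fun x => Set.indicator_nonneg (fun y _ => Real.rpow_nonneg
      (mul_nonneg (by positivity) (barrier_nonneg le_rfl y)) _) x

theorem barrierMass_indicator_le {p K : ℝ} (hp : 0 ≤ p) (hK : 1 ≤ K) (u : E N → ℝ) (x : E N) :
    {x | K * barrier 0 x ≤ u x}.indicator (fun x => (‖x‖⁻¹ * barrier 0 x) ^ p) x ≤
      (‖x‖⁻¹ * |u x|) ^ p := by
  by_cases hx : K * barrier 0 x ≤ u x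
  · rw [Set.indicator_of_mem (by exact hx)]
    have hb := barrier_nonneg le_rfl x
    have : barrier 0 x ≤ |u x| := by
      refine le_trans ?_ (hx.trans (le_abs_self _))
      nlinarith
    gcongr
  · rw [Set.indicator_of_notMem (by exact hx)]
    positivity

theorem nullMeasurableSet_barrier_le {K : ℝ} {u : E N → ℝ} {μ : Measure (E N)}
    (hu : AEStronglyMeasurable u μ) : NullMeasurableSet {x | K * barrier 0 x ≤ u x} μ :=
  nullMeasurableSet_le ((measurable_barrier 0).const_mul K).aemeasurable hu.aemeasurable

theorem aestronglyMeasurable_barrierMass {p K : ℝ} {u : E N → ℝ} {μ : Measure (E N)}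
    (hu : AEStronglyMeasurable u μ) :
    AEStronglyMeasurable
      ({x | K * barrier 0 x ≤ u x}.indicator (fun x => (‖x‖⁻¹ * barrier 0 x) ^ p)) μ :=
  (AEMeasurable.indicator₀ ((measurable_norm.inv.mul (measurable_barrier 0)).pow_const p).aemeasurable
    (nullMeasurableSet_barrier_le hu)).aestronglyMeasurable

theorem MemW1p0.integrable_barrierMass (hΩ : Bornology.IsBounded Ω) {p : ℝ} (hp : 1 < p)
    (hpN : p < N) {u : E N → ℝ} {Du : E N → E N} (hu : MemW1p0 Ω p u Du) {K : ℝ} (hK : 1 ≤ K) :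
    Integrable ({x | K * barrier 0 x ≤ u x}.indicator (fun x => (‖x‖⁻¹ * barrier 0 x) ^ p))
      (volume.restrict Ω) := by
  refine (hu.integrable_hardy hΩ hp hpN).mono' (aestronglyMeasurable_barrierMass hu.memLp.1)
    (ae_of_all _ fun x => ?_)
  rw [Real.norm_of_nonneg (Set.indicator_nonneg (fun y _ => Real.rpow_nonneg
    (mul_nonneg (by positivity) (barrier_nonneg le_rfl y)) _) x)]
  exact barrierMass_indicator_le (by linarith) hK u x

/-- Supplies the smallness that starts the iteration: the initial mass is controlled by the energy,
through Hardy. -/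
theorem MemW1p0.barrierMass_one_le (hΩ : Bornology.IsBounded Ω) {p : ℝ} (hp : 1 < p)
    (hpN : p < N) {u : E N → ℝ} {Du : E N → E N} (hu : MemW1p0 Ω p u Du) :
    barrierMass Ω p u 1 ≤ hardyConst N p * ∫ x in Ω, ‖Du x‖ ^ p :=
  (integral_mono (hu.integrable_barrierMass hΩ hp hpN le_rfl) (hu.integrable_hardy hΩ hp hpN)
    fun x => barrierMass_indicator_le (by linarith) le_rfl u x).trans (hu.integral_hardy hΩ hp hpN)

theorem MemW1p0.ae_lt_of_barrierMass_eq_zero (hN : 2 ≤ N) (hΩ : Bornology.IsBounded Ω)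
    (hΩm : MeasurableSet Ω) {p : ℝ} (hp : 1 < p) (hpN : p < N) {u : E N → ℝ} {Du : E N → E N}
    (hu : MemW1p0 Ω p u Du) {K : ℝ} (hK : 1 ≤ K) (h : barrierMass Ω p u K = 0) :
    ∀ᵐ x ∂(volume.restrict Ω), u x < K * barrier 0 x := by
  rw [barrierMass, integral_eq_zero_iff_of_nonneg (fun x => Set.indicator_nonneg (fun y _ =>
    Real.rpow_nonneg (mul_nonneg (by positivity) (barrier_nonneg le_rfl y)) _) x)
    (hu.integrable_barrierMass hΩ hp hpN hK)] at h
  filter_upwards [h, ae_restrict_mem_and_ne_zero hN hΩm] with x hx ⟨_, hx0⟩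
  by_contra hxu
  rw [Set.indicator_of_mem (by exact not_lt.mp hxu)] at hx
  have := barrier_pos le_rfl hx0
  have := norm_pos_iff.mpr hx0
  have h3 : 0 < (‖x‖⁻¹ * barrier 0 x) ^ p := by positivity
  exact h3.ne' hx

/-- Both sides are powers of |x|, so only exponents matter: the condition on p says (2N+1)p ≤ 2N+2,
and 2N+2 ≤ 2N · N/(N-1). The surplus is a nonnegative power of |x|, bounded by a power of R. This is
where the exponent of the barrier must be large. -/
theorem norm_inv_mul_barrier_rpow_le (hN : 2 ≤ N) {p R : ℝ} (hp0 : 0 ≤ p)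
    (hp : p ≤ (2 * N + 2) / (2 * N + 1)) (hR1 : 1 ≤ R) {x : E N} (hx0 : x ≠ 0) (hxR : ‖x‖ ≤ R) :
    (‖x‖⁻¹ * barrier 0 x) ^ p ≤
      R ^ (2 * (N : ℝ) * (N / (N - 1))) * barrier 0 x ^ ((N : ℝ) / (N - 1)) := by
  have hN' : (2 : ℝ) ≤ N := by exact_mod_cast hN
  have hx := norm_pos_iff.mpr hx0
  set q : ℝ := (N : ℝ) / (N - 1) with hq
  have hb : barrier 0 x = ‖x‖ ^ (-(2 * N : ℝ)) := by
    rw [barrier, add_zero, ← Real.rpow_natCast, ← Real.rpow_mul hx.le]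
    push_cast
    ring_nf
  have hexp : (2 * N + 1) * p ≤ 2 * N * q := by
    have h1 : (2 * N + 1) * p ≤ 2 * N + 2 := by
      rw [le_div_iff₀ (by positivity)] at hp
      linarith
    refine h1.trans ?_
    rw [hq, ← mul_div_assoc, le_div_iff₀ (by linarith)]
    nlinarith
  have e1 : (‖x‖⁻¹ * barrier 0 x) ^ p = ‖x‖ ^ (-((2 * N + 1) * p)) := by
    rw [hb, ← Real.rpow_neg_one, ← Real.rpow_add hx, ← Real.rpow_mul hx.le]
    ring_nf
  have e2 : barrier 0 x ^ q = ‖x‖ ^ (-(2 * N * q)) := by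
    rw [hb, ← Real.rpow_mul hx.le]
    ring_nf
  rw [e1, e2]
  have hN0 : 0 ≤ (2 * N + 1) * p := by positivity
  calc ‖x‖ ^ (-((2 * N + 1) * p)) = ‖x‖ ^ (2 * N * q - (2 * N + 1) * p) * ‖x‖ ^ (-(2 * N * q)) := by
        rw [← Real.rpow_add hx]; ring_nf
    _ ≤ R ^ (2 * N * q - (2 * N + 1) * p) * ‖x‖ ^ (-(2 * N * q)) := by
        gcongr
    _ ≤ R ^ (2 * N * q) * ‖x‖ ^ (-(2 * N * q)) := by
        gcongr
        linarith

/-- The level set inequality behind the boundedness estimate. -/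
theorem barrierMass_le_of_eLpNorm_le (hN : 2 ≤ N) (hΩ : Bornology.IsBounded Ω)
    (hΩm : MeasurableSet Ω) {R : ℝ} (hR1 : 1 ≤ R) (hR : ∀ x ∈ Ω, ‖x‖ ≤ R)
    {p : ℝ} (hp : 1 < p) (hpN : p < N) (hp2 : p ≤ (2 * N + 2) / (2 * N + 1))
    {u : E N → ℝ} {Du : E N → E N} (hu : MemW1p0 Ω p u Du) {C : ℝ} (hC : 0 ≤ C)
    (hest : ∀ K ε δ : ℝ, 1 ≤ K → K ≤ 2 → 0 < ε → ε ≤ 1 → 0 < δ →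
        δ ≤ ((R ^ 2 + 1) ^ (N + 1))⁻¹ →
        eLpNorm (fun x => smoothPos δ (u x - K * barrier ε x)) (sobolevExp N)
          (volume.restrict Ω) ≤ ENNReal.ofReal (C * superlevelMass Ω p u ε K))
    {K K' : ℝ} (hK : 1 ≤ K) (hKK' : K < K') (hK' : K' ≤ 2) :
    barrierMass Ω p u K' ≤ R ^ (2 * (N : ℝ) * (N / (N - 1))) *
      (2 * C * barrierMass Ω p u K / (K' - K)) ^ ((N : ℝ) / (N - 1)) := by
  have hN' : (2 : ℝ) ≤ N := by exact_mod_cast hN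
  set a : ℝ := (R ^ 2 + 1) ^ (N + 1) with ha
  have ha1 : 1 ≤ a := one_le_pow₀ (by nlinarith [sq_nonneg R])
  set q : ℝ := (N : ℝ) / (N - 1) with hq
  have hq1 : 1 < q := one_lt_sobolev_ratio hN
  -- Where u ≥ K' h, the excess over K h_ε is at least 2 s h. Half of it pays for the truncation
  -- error, δ = s/a ≤ s h, and the other half remains.
  set s : ℝ := (K' - K) / 2 with hs
  have hs0 : 0 < s := by rw [hs]; linarith
  set δ : ℝ := s * a⁻¹ with hδ
  have hδ0 : 0 < δ := by positivity
  have hδa : δ ≤ a⁻¹ := mul_le_of_le_one_left (by positivity) (by rw [hs]; linarith)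
  set g : E N → ℝ := {x | K' * barrier 0 x ≤ u x}.indicator (barrier 0) with hg
  have hgm : AEStronglyMeasurable g (volume.restrict Ω) :=
    (AEMeasurable.indicator₀ (measurable_barrier 0).aemeasurable
      (nullMeasurableSet_barrier_le hu.memLp.1)).aestronglyMeasurable
  have hg0 : ∀ x, 0 ≤ g x := fun x => Set.indicator_nonneg (fun y _ => barrier_nonneg le_rfl y) x
  have h1 : ∀ n : ℕ, eLpNorm (fun x => s * g x) (sobolevExp N) (volume.restrict Ω) ≤
      ENNReal.ofReal (C * superlevelMass Ω p u (1 / ((n : ℝ) + 1)) K) := by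
    intro n
    have hn : (0 : ℝ) < 1 / ((n : ℝ) + 1) := by positivity
    have hn1 : 1 / ((n : ℝ) + 1) ≤ 1 := by
      rw [div_le_one (by positivity)]
      linarith [n.cast_nonneg (α := ℝ)]
    refine le_trans (eLpNorm_mono_ae ?_) (hest K _ δ hK (by linarith) hn hn1 hδ0 hδa)
    filter_upwards [ae_restrict_mem_and_ne_zero hN hΩm] with x ⟨hxΩ, hx0⟩
    rw [Real.norm_of_nonneg (smoothPos_nonneg hδ0), Real.norm_of_nonneg (mul_nonneg hs0.le (hg0 x))]
    by_cases hx : K' * barrier 0 x ≤ u x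
    · rw [hg, Set.indicator_of_mem (by exact hx)]
      refine le_trans ?_ (sub_le_smoothPos hδ0)
      have hb1 := (barrier_strictAnti le_rfl hn hN hx0).le
      have hb2 := (inv_le_barrier (R := R) le_rfl zero_le_one hx0 (hR x hxΩ)).1
      have hb3 : δ ≤ s * barrier 0 x := by rw [hδ]; gcongr
      have hb4 : K * barrier (1 / ((n : ℝ) + 1)) x ≤ K * barrier 0 x := by gcongr
      have : s * barrier 0 x + s * barrier 0 x = K' * barrier 0 x - K * barrier 0 x := by
        rw [hs]; ring
      linarith
    · rw [hg, Set.indicator_of_notMem (by exact hx), mul_zero]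
      exact smoothPos_nonneg hδ0
  have h2 : eLpNorm (fun x => s * g x) (sobolevExp N) (volume.restrict Ω) ≤
      ENNReal.ofReal (C * barrierMass Ω p u K) :=
    ge_of_tendsto' ((ENNReal.continuous_ofReal.tendsto _).comp
      ((hu.tendsto_superlevelMass hN hΩ hΩm hp hpN hK).const_mul C)) h1
  have hsgm : MemLp (fun x => s * g x) (sobolevExp N) (volume.restrict Ω) :=
    ⟨hgm.const_mul s, h2.trans_lt ENNReal.ofReal_lt_top⟩
  have hgL : MemLp g (sobolevExp N) (volume.restrict Ω) := by
    have := hsgm.const_mul s⁻¹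
    simpa [← mul_assoc, inv_mul_cancel₀ hs0.ne'] using this
  have hgI : Integrable (fun x => g x ^ q) (volume.restrict Ω) := by
    have := hgL.integrable_norm_rpow (sobolevExp_ne_zero hN) ENNReal.ofReal_ne_top
    rw [ENNReal.toReal_ofReal (by linarith)] at this
    simpa only [Real.norm_of_nonneg (hg0 _)] using this
  have h3 : s * (∫ x in Ω, g x ^ q) ^ q⁻¹ ≤ C * barrierMass Ω p u K := by
    have e : (fun x => s * g x) = s • g := rfl
    rw [e, eLpNorm_const_smul, hgL.eLpNorm_eq_integral_rpow_norm (sobolevExp_ne_zero hN)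
      ENNReal.ofReal_ne_top, ENNReal.toReal_ofReal (by linarith), ← ofReal_norm,
      ← ENNReal.ofReal_mul (norm_nonneg _), ENNReal.ofReal_le_ofReal_iff
        (mul_nonneg hC barrierMass_nonneg), Real.norm_of_nonneg hs0.le] at h2
    simpa only [Real.norm_of_nonneg (hg0 _)] using h2
  have hI0 : 0 ≤ ∫ x in Ω, g x ^ q := integral_nonneg fun x => Real.rpow_nonneg (hg0 x) _
  have h4 : ∫ x in Ω, g x ^ q ≤ (2 * C * barrierMass Ω p u K / (K' - K)) ^ q := by
    have h5 : (∫ x in Ω, g x ^ q) ^ q⁻¹ ≤ 2 * C * barrierMass Ω p u K / (K' - K) := by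
      rw [le_div_iff₀ (by linarith)]
      rw [hs] at h3
      linarith
    have h6 := Real.rpow_le_rpow (by positivity) h5 (by linarith : 0 ≤ q)
    rwa [Real.rpow_inv_rpow hI0 (by linarith)] at h6
  refine le_trans ?_ (mul_le_mul_of_nonneg_left h4 (by positivity))
  rw [barrierMass, ← integral_const_mul]
  refine integral_mono_ae (hu.integrable_barrierMass hΩ hp hpN (by linarith))
    (hgI.const_mul _) ?_
  filter_upwards [ae_restrict_mem_and_ne_zero hN hΩm] with x ⟨hxΩ, hx0⟩
  by_cases hx : K' * barrier 0 x ≤ u x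
  · rw [hg, Set.indicator_of_mem (by exact hx), Set.indicator_of_mem (by exact hx)]
    exact norm_inv_mul_barrier_rpow_le hN (by linarith) hp2 hR1 hx0 (hR x hxΩ)
  · rw [Set.indicator_of_notMem (by exact hx)]
    exact mul_nonneg (by positivity) (Real.rpow_nonneg (hg0 x) _)

/-- A De Giorgi type iteration lemma. -/
theorem exists_forall_eq_zero_of_level_inequality {A q : ℝ} (hA : 0 < A) (hq : 1 < q) :
    ∃ η > 0, ∀ m : ℝ → ℝ, (∀ K, 0 ≤ m K) →
      (∀ K K', 1 ≤ K → K < K' → K' ≤ 2 → m K' ≤ A * (m K / (K' - K)) ^ q) →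
      m 1 ≤ η → m 2 = 0 := by
  have hq1 : 0 < q - 1 := by linarith
  -- Chosen so that 2^q r^(q-1) = 1, that is (2r)^q = r; then η is chosen so that A 2^q η^(q-1) = r.
  -- With these the bound η r^j at the levels 2 - 2^(-j) reproduces itself.
  set r : ℝ := 2 ^ (-(q / (q - 1))) with hr
  have hr0 : 0 < r := by positivity
  have hr1 : r < 1 := Real.rpow_lt_one_of_one_lt_of_neg one_lt_two
    (neg_lt_zero.mpr (div_pos (by linarith) hq1))
  have hrq : 2 ^ q * r ^ (q - 1) = 1 := by
    rw [hr, ← Real.rpow_mul zero_le_two, ← Real.rpow_add two_pos]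
    have : q + -(q / (q - 1)) * (q - 1) = 0 := by field_simp; ring
    rw [this, Real.rpow_zero]
  set η : ℝ := (r / (A * 2 ^ q)) ^ (1 / (q - 1)) with hη
  have hη0 : 0 < η := by positivity
  have hηq : η ^ (q - 1) = r / (A * 2 ^ q) := by
    rw [hη, ← Real.rpow_mul (by positivity), one_div, inv_mul_cancel₀ hq1.ne', Real.rpow_one]
  refine ⟨η, hη0, fun m hm0 hm hm1 => ?_⟩
  have key : ∀ j : ℕ, m (2 - (1 / 2) ^ j) ≤ η * r ^ j := by
    intro j
    induction j with
    | zero => simpa [show (2 : ℝ) - 1 = 1 by norm_num] using hm1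
    | succ j ih =>
      have hp1 : ((1 : ℝ) / 2) ^ j ≤ 1 := pow_le_one₀ (by norm_num) (by norm_num)
      have hp0 : 0 < ((1 : ℝ) / 2) ^ (j + 1) := by positivity
      have he : ((1 : ℝ) / 2) ^ j = 2 * (1 / 2) ^ (j + 1) := by rw [pow_succ]; ring
      refine (hm (2 - (1 / 2) ^ j) (2 - (1 / 2) ^ (j + 1)) (by linarith) (by linarith)
        (by linarith)).trans ?_
      have hd : (2 : ℝ) - (1 / 2) ^ (j + 1) - (2 - (1 / 2) ^ j) = (1 / 2) ^ (j + 1) := by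
        rw [he]; ring
      have h2 : m (2 - (1 / 2) ^ j) / (1 / 2) ^ (j + 1) ≤ η * (2 * (2 * r) ^ j) := by
        rw [div_le_iff₀ hp0]
        refine ih.trans_eq ?_
        have : (2 : ℝ) * (2 * r) ^ j * (1 / 2) ^ (j + 1) = r ^ j := by
          rw [pow_succ, mul_pow, one_div, inv_pow]
          field_simp
        rw [mul_assoc, this]
      have hrr : (2 * r) ^ q = r := by
        rw [Real.mul_rpow zero_le_two hr0.le]
        have : r ^ q = r ^ (q - 1) * r := by rw [Real.rpow_sub_one hr0.ne']; field_simp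
        rw [this, ← mul_assoc, hrq, one_mul]
      have hηη : η ^ q = η ^ (q - 1) * η := by rw [Real.rpow_sub_one hη0.ne']; field_simp
      calc A * (m (2 - (1 / 2) ^ j) / (2 - (1 / 2) ^ (j + 1) - (2 - (1 / 2) ^ j))) ^ q
          ≤ A * (η * (2 * (2 * r) ^ j)) ^ q := by
            rw [hd]
            have := hm0 (2 - (1 / 2) ^ j)
            gcongr
        _ = A * (η ^ q * (2 ^ q * ((2 * r) ^ q) ^ j)) := by
            rw [Real.mul_rpow hη0.le (by positivity), Real.mul_rpow zero_le_two (by positivity),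
              Real.rpow_pow_comm (by positivity)]
        _ = η * r ^ (j + 1) := by
            rw [hrr, hηη, hηq, pow_succ]
            field_simp
  -- Jumping from level j straight to 2 avoids any continuity of m. The bound is A (η (2r)^j)^q,
  -- which tends to 0 because q/(q-1) > 1 makes 2r < 1.
  have hle : ∀ j : ℕ, m 2 ≤ A * (η * r ^ j / (1 / 2) ^ j) ^ q := by
    intro j
    have hp1 : ((1 : ℝ) / 2) ^ j ≤ 1 := pow_le_one₀ (by norm_num) (by norm_num)
    have hp0 : 0 < ((1 : ℝ) / 2) ^ j := by positivity
    refine (hm (2 - (1 / 2) ^ j) 2 (by linarith) (by linarith) le_rfl).trans ?_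
    rw [sub_sub_cancel]
    have := hm0 (2 - (1 / 2) ^ j)
    have := key j
    gcongr
  have h2r : 2 * r < 1 := by
    have h1 : (2 * r) = 2 ^ (1 - q / (q - 1)) := by
      rw [hr, sub_eq_add_neg 1, Real.rpow_add two_pos, Real.rpow_one]
    rw [h1]
    refine Real.rpow_lt_one_of_one_lt_of_neg one_lt_two ?_
    rw [sub_neg, lt_div_iff₀ hq1]
    linarith
  have hlim : Tendsto (fun j : ℕ => A * (η * r ^ j / (1 / 2) ^ j) ^ q) atTop (𝓝 0) := by
    have h1 : ∀ j : ℕ, η * r ^ j / (1 / 2) ^ j = η * (2 * r) ^ j := by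
      intro j
      rw [mul_pow, one_div, inv_pow]
      field_simp
    simp_rw [h1]
    have h2 := ((tendsto_pow_atTop_nhds_zero_of_lt_one (by positivity) h2r).const_mul η).rpow_const
      (p := q) (Or.inr (by linarith))
    have h3 := h2.const_mul A
    rwa [mul_zero, Real.zero_rpow (by linarith), mul_zero] at h3
  exact le_antisymm (ge_of_tendsto' hlim hle) (hm0 2)

/-- In the strict case, all weak solutions lie below the barrier for `p` close to `1`. -/
theorem eventually_ae_lt_barrier (hN : 2 ≤ N) (hΩ : Bornology.IsBounded Ω)
    (hΩm : MeasurableSet Ω) {lam : ℝ} (hlam : 0 ≤ lam) {f : E N → ℝ}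
    (hf : MemLp f (N : ℝ≥0∞) (volume.restrict Ω))
    (hfS : eLpNorm f (N : ℝ≥0∞) (volume.restrict Ω) * sobolevConst N ≠ ⊤)
    (hstrict : (eLpNorm f (N : ℝ≥0∞) (volume.restrict Ω) * sobolevConst N).toReal +
      lam / ((N : ℝ) - 1) < 1) :
    ∀ᶠ p in 𝓝[>] (1 : ℝ), ∀ (u : E N → ℝ) (Du : E N → E N), IsWeakSolution Ω lam f p u Du →
      ∀ᵐ x ∂(volume.restrict Ω), u x < 2 * barrier 0 x := by
  have hN' : (2 : ℝ) ≤ N := by exact_mod_cast hN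
  obtain ⟨R, hR1, hR⟩ : ∃ R : ℝ, 1 ≤ R ∧ ∀ x ∈ Ω, ‖x‖ ≤ R := by
    obtain ⟨R, hR⟩ := hΩ.exists_norm_le
    exact ⟨max R 1, le_max_right _ _, fun x hx => (hR x hx).trans (le_max_left _ _)⟩
  obtain ⟨C, hC, hev⟩ := eventually_eLpNorm_truncation_le hN hΩ hΩm hR hlam hf hfS hstrict
  have hq := one_lt_sobolev_ratio hN
  -- 2C + 1 in place of 2C keeps the constant positive even when C = 0.
  obtain ⟨η, hη, hzero⟩ := exists_forall_eq_zero_of_level_inequality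
    (A := R ^ (2 * (N : ℝ) * (N / (N - 1))) * (2 * C + 1) ^ ((N : ℝ) / (N - 1)))
    (by positivity) hq
  have hH : ∀ᶠ p in 𝓝[>] (1 : ℝ), hardyConst N p ≤ 1 / ((N : ℝ) - 1) + 1 :=
    (tendsto_hardyConst hN).eventually_le_const (by linarith)
  have hH0 : 0 < 1 / ((N : ℝ) - 1) + 1 := by
    have : 0 < (N : ℝ) - 1 := by linarith
    positivity
  filter_upwards [hev, hH, eventually_energy_le hN hΩ hlam hf hfS hstrict
      (div_pos hη hH0), eventually_one_lt_lt (show (1 : ℝ) < (2 * N + 2) / (2 * N + 1) by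
        rw [one_lt_div] <;> linarith), eventually_one_lt_lt (show (1 : ℝ) < N by linarith)]
    with p hp hpH hpE hp1 hpN u Du hu
  refine hu.mem.ae_lt_of_barrierMass_eq_zero hN hΩ hΩm hp1.1 hpN.2 one_le_two
    (hzero (barrierMass Ω p u) (fun K => barrierMass_nonneg) (fun K K' hK hKK' hK' => ?_) ?_)
  · refine (barrierMass_le_of_eLpNorm_le hN hΩ hΩm hR1 hR hp1.1 hpN.2 hp1.2.le hu.mem hC
      (hp u Du hu) hK hKK' hK').trans ?_
    rw [mul_assoc (R ^ _)]
    refine mul_le_mul_of_nonneg_left ?_ (Real.rpow_nonneg (zero_le_one.trans hR1) _)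
    rw [← Real.mul_rpow (by linarith) (div_nonneg barrierMass_nonneg (by linarith)),
      ← mul_div_assoc]
    have h0 : 0 ≤ barrierMass Ω p u K := barrierMass_nonneg
    have h1 : 0 < K' - K := by linarith
    gcongr
    linarith
  · refine (hu.mem.barrierMass_one_le hΩ hp1.1 hpN.2).trans ?_
    have h0 : 0 ≤ ∫ x in Ω, ‖Du x‖ ^ p := integral_nonneg fun x => by positivity
    calc hardyConst N p * ∫ x in Ω, ‖Du x‖ ^ p ≤
          (1 / ((N : ℝ) - 1) + 1) * (η / (1 / ((N : ℝ) - 1) + 1)) := by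
          gcongr
          exact hpE u Du hu
      _ = η := mul_div_cancel₀ _ hH0.ne'

end LevelSets

/-! ### The strict case: convergence in L^{1*} and almost everywhere. -/

section StrictCase

variable {N : ℕ} {Ω : Set (E N)}

/-- In the strict case the `L¹` norm of the gradient tends to zero. -/
theorem eventually_integral_norm_grad_le (hN : 2 ≤ N) (hΩ : Bornology.IsBounded Ω)
    {lam : ℝ} (hlam : 0 ≤ lam) {f : E N → ℝ}
    (hf : MemLp f (N : ℝ≥0∞) (volume.restrict Ω))
    (hfS : eLpNorm f (N : ℝ≥0∞) (volume.restrict Ω) * sobolevConst N ≠ ⊤)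
    (hstrict : (eLpNorm f (N : ℝ≥0∞) (volume.restrict Ω) * sobolevConst N).toReal +
      lam / ((N : ℝ) - 1) < 1) {η : ℝ} (hη : 0 < η) :
    ∀ᶠ p in 𝓝[>] (1 : ℝ), ∀ (u : E N → ℝ) (Du : E N → E N), IsWeakSolution Ω lam f p u Du →
      ∫ x in Ω, ‖Du x‖ ≤ η := by
  have hfin := isFiniteMeasure_restrict_of_isBounded hΩ
  set w := (volume Ω).toReal with hw
  have hw0 : 0 ≤ w := ENNReal.toReal_nonneg
  -- Large enough that the measure term w/a is at most η/2; an energy below η/(2a) then pays for the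
  -- other half, since a^(p-1) ≤ a.
  set a : ℝ := 2 * w / η + 1 with ha
  have ha1 : 1 ≤ a := by rw [ha]; have : 0 ≤ 2 * w / η := by positivity
                         linarith
  have hwa : w / a ≤ η / 2 := by
    rw [div_le_iff₀ (by positivity), ha]
    field_simp
    linarith
  filter_upwards [eventually_energy_le hN hΩ hlam hf hfS hstrict
    (show 0 < η / (2 * a) by positivity), eventually_one_lt_lt one_lt_two] with p hp hp1 u Du hu
  have hI := hu.mem.integrable_norm_rpow hp1.1.le
  have hap : a ^ (p - 1) ≤ a := by
    calc a ^ (p - 1) ≤ a ^ (1 : ℝ) := Real.rpow_le_rpow_of_exponent_le ha1 (by linarith [hp1.2])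
      _ = a := Real.rpow_one a
  have h1 : ∫ x in Ω, ‖Du x‖ ≤ ∫ x in Ω, a ^ (p - 1) * (‖Du x‖ ^ p + a⁻¹ ^ p) :=
    integral_mono (memLp_one_iff_integrable.mp (hu.mem.memLp_one_grad hΩ hp1.1.le)).norm
      ((hI.add (integrable_const _)).const_mul _)
      fun x => le_rpow_mul_rpow_add hp1.1 (by positivity) (norm_nonneg _) le_rfl
  rw [integral_const_mul, integral_add hI (integrable_const _), setIntegral_const, smul_eq_mul,
    measureReal_def, ← hw] at h1
  have h2 : a ^ (p - 1) * a⁻¹ ^ p = a⁻¹ := by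
    rw [Real.inv_rpow (by positivity), Real.rpow_sub_one (by positivity)]
    field_simp
  calc ∫ x in Ω, ‖Du x‖ ≤ a ^ (p - 1) * (∫ x in Ω, ‖Du x‖ ^ p) + w * (a ^ (p - 1) * a⁻¹ ^ p) := by
        linarith
    _ ≤ a * (η / (2 * a)) + η / 2 := by
        rw [h2, ← div_eq_mul_inv]
        have h0 : 0 ≤ ∫ x in Ω, ‖Du x‖ ^ p := integral_nonneg fun x => by positivity
        gcongr
        exact hp u Du hu
    _ = η := by field_simp; ring

theorem MemW1p0.eLpNorm_sobolevExp_le (hN : 2 ≤ N) (hΩ : Bornology.IsBounded Ω) {p : ℝ}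
    (hp : 1 ≤ p) {u : E N → ℝ} {Du : E N → E N} (hu : MemW1p0 Ω p u Du) :
    eLpNorm u (sobolevExp N) (volume.restrict Ω) ≤
      ENNReal.ofReal (gnsConst N * ∫ x in Ω, ‖Du x‖) := by
  refine (hu.eLpNorm_le_gnsConst hN hΩ hp).trans_eq ?_
  rw [eLpNorm_one_eq_lintegral_enorm, ← ofReal_integral_norm_eq_lintegral_enorm
      (memLp_one_iff_integrable.mp (hu.memLp_one_grad hΩ hp)),
    ← ENNReal.ofReal_coe_nnreal, ← ENNReal.ofReal_mul NNReal.zero_le_coe]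

/-- In the strict case the solutions tend to zero in `L^{1^*}(Ω)`. -/
theorem tendsto_eLpNorm_solution_zero (hN : 2 ≤ N) (hΩ : Bornology.IsBounded Ω)
    {lam : ℝ} (hlam : 0 ≤ lam) {f : E N → ℝ}
    (hf : MemLp f (N : ℝ≥0∞) (volume.restrict Ω))
    (hfS : eLpNorm f (N : ℝ≥0∞) (volume.restrict Ω) * sobolevConst N ≠ ⊤)
    (hstrict : (eLpNorm f (N : ℝ≥0∞) (volume.restrict Ω) * sobolevConst N).toReal +
      lam / ((N : ℝ) - 1) < 1) {u : ℝ → E N → ℝ} {Du : ℝ → E N → E N}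
    (hu : ∀ᶠ p in 𝓝[>] (1 : ℝ), IsWeakSolution Ω lam f p (u p) (Du p)) :
    Tendsto (fun p => eLpNorm (u p) (sobolevExp N) (volume.restrict Ω)) (𝓝[>] 1) (𝓝 0) := by
  rw [ENNReal.tendsto_nhds_zero]
  intro e he
  obtain ⟨r, hr0, hr⟩ := ENNReal.lt_iff_exists_real_btwn.mp he
  have hr0' : 0 < r := ENNReal.ofReal_pos.mp hr.1
  have hg : (0 : ℝ) < gnsConst N + 1 := by positivity
  filter_upwards [eventually_integral_norm_grad_le hN hΩ hlam hf hfS hstrict (div_pos hr0' hg), hu,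
    self_mem_nhdsWithin] with p hp hup hp1
  refine (hup.mem.eLpNorm_sobolevExp_le hN hΩ (le_of_lt hp1)).trans (le_trans ?_ hr.2.le)
  refine ENNReal.ofReal_le_ofReal ?_
  have h0 : 0 ≤ ∫ x in Ω, ‖Du p x‖ := integral_nonneg fun x => norm_nonneg _
  calc gnsConst N * ∫ x in Ω, ‖Du p x‖ ≤ (gnsConst N + 1) * (r / (gnsConst N + 1)) := by
        gcongr
        · linarith
        · exact hp _ _ hup
    _ = r := mul_div_cancel₀ _ hg.ne'

/-- In the strict case the solutions decay exponentially, uniformly away from the origin. -/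
theorem exists_eventually_ae_abs_le (hN : 2 ≤ N) (hΩ : Bornology.IsBounded Ω)
    (hΩm : MeasurableSet Ω) {lam : ℝ} (hlam : 0 ≤ lam) {f : E N → ℝ}
    (hf : MemLp f (N : ℝ≥0∞) (volume.restrict Ω))
    (hfS : eLpNorm f (N : ℝ≥0∞) (volume.restrict Ω) * sobolevConst N ≠ ⊤)
    (hstrict : (eLpNorm f (N : ℝ≥0∞) (volume.restrict Ω) * sobolevConst N).toReal +
      lam / ((N : ℝ) - 1) < 1) :
    ∃ κ : ℝ, 0 < κ ∧ κ < 1 ∧ ∀ᶠ p in 𝓝[>] (1 : ℝ), ∀ (u : E N → ℝ) (Du : E N → E N),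
      IsWeakSolution Ω lam f p u Du →
        ∀ᵐ x ∂(volume.restrict Ω), |u x| ≤ κ ^ (1 / (p - 1)) * (2 * barrier 0 x) := by
  set c := (eLpNorm f (N : ℝ≥0∞) (volume.restrict Ω) * sobolevConst N).toReal with hc
  have hc0 : 0 ≤ c := ENNReal.toReal_nonneg
  -- κ < 1 is taken so close to 1 that c/κ + λ/(N-1) < 1: the datum f/κ is still strict.
  obtain ⟨κ, hκ1, hκ2⟩ := exists_between (show c / (1 - lam / ((N : ℝ) - 1)) < 1 by
    rw [div_lt_one] <;> linarith)
  have hκ0 : 0 < κ := (div_nonneg hc0 (by linarith)).trans_lt hκ1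
  refine ⟨κ, hκ0, hκ2, ?_⟩
  have hκc : κ⁻¹ * c + lam / ((N : ℝ) - 1) < 1 := by
    rw [div_lt_iff₀ (by linarith)] at hκ1
    rw [← lt_sub_iff_add_lt, inv_mul_lt_iff₀ hκ0]
    linarith
  have hnorm : ∀ s : ℝ, |s| = κ⁻¹ →
      eLpNorm (fun x => s * f x) (N : ℝ≥0∞) (volume.restrict Ω) * sobolevConst N =
        ENNReal.ofReal κ⁻¹ * (eLpNorm f (N : ℝ≥0∞) (volume.restrict Ω) * sobolevConst N) := by
    intro s hs
    rw [show (fun x => s * f x) = s • f from rfl, eLpNorm_const_smul, ← ofReal_norm,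
      Real.norm_eq_abs, hs, mul_assoc]
  have hside : ∀ s : ℝ, |s| = κ⁻¹ → ∀ᶠ p in 𝓝[>] (1 : ℝ), ∀ (u : E N → ℝ) (Du : E N → E N),
      IsWeakSolution Ω lam (fun x => s * f x) p u Du →
        ∀ᵐ x ∂(volume.restrict Ω), u x < 2 * barrier 0 x := by
    intro s hs
    refine eventually_ae_lt_barrier hN hΩ hΩm hlam (hf.const_mul s) ?_ ?_
    · rw [hnorm s hs]
      exact ENNReal.mul_ne_top ENNReal.ofReal_ne_top hfS
    · rwa [hnorm s hs, ENNReal.toReal_mul, ENNReal.toReal_ofReal (by positivity)]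
  have hκa : |κ⁻¹| = κ⁻¹ := abs_of_pos (by positivity)
  filter_upwards [hside κ⁻¹ hκa, hside (-κ⁻¹) (by rw [abs_neg, hκa]), self_mem_nhdsWithin]
    with p hp1 hp2 hp u Du hu
  have hp' : 0 < p - 1 := sub_pos.mpr hp
  -- Dividing the solution by k multiplies the datum by k^(-(p-1)) = κ⁻¹, independent of p. So the
  -- barrier bound for the single datum f/κ applies at every p near 1.
  set k : ℝ := κ ^ (1 / (p - 1)) with hk
  have hk0 : 0 < k := by positivity
  have hkk : k⁻¹ ^ (p - 2) * k⁻¹ = κ⁻¹ := by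
    rw [← Real.rpow_add_one (by positivity), Real.inv_rpow hk0.le, hk, ← Real.rpow_mul hκ0.le,
      show 1 / (p - 1) * (p - 2 + 1) = 1 by rw [show p - 2 + 1 = p - 1 by ring]; field_simp,
      Real.rpow_one]
  have hka : |k⁻¹| = k⁻¹ := abs_of_pos (by positivity)
  have s1 := hu.const_mul k⁻¹
  -- The barrier bound is one-sided; applying it to the negative solution, with datum -f/κ, gives
  -- the lower bound.
  have s2 := hu.const_mul (-k⁻¹)
  simp only [abs_neg, hka, mul_neg, hkk] at s1 s2
  filter_upwards [hp1 _ _ s1, hp2 _ _ s2] with x h1 h2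
  have h3 : |k⁻¹ * u x| ≤ 2 * barrier 0 x := abs_le.mpr ⟨by linarith, h1.le⟩
  rw [abs_mul, hka] at h3
  rwa [← inv_mul_le_iff₀ hk0]

/-- In the strict case the solutions tend to zero almost everywhere along every sequence. -/
theorem ae_tendsto_solution_zero (hN : 2 ≤ N) (hΩ : Bornology.IsBounded Ω)
    (hΩm : MeasurableSet Ω) {lam : ℝ} (hlam : 0 ≤ lam) {f : E N → ℝ}
    (hf : MemLp f (N : ℝ≥0∞) (volume.restrict Ω))
    (hfS : eLpNorm f (N : ℝ≥0∞) (volume.restrict Ω) * sobolevConst N ≠ ⊤)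
    (hstrict : (eLpNorm f (N : ℝ≥0∞) (volume.restrict Ω) * sobolevConst N).toReal +
      lam / ((N : ℝ) - 1) < 1) {u : ℝ → E N → ℝ} {Du : ℝ → E N → E N}
    (hu : ∀ᶠ p in 𝓝[>] (1 : ℝ), IsWeakSolution Ω lam f p (u p) (Du p)) {q : ℕ → ℝ}
    (hq : Tendsto q atTop (𝓝[>] 1)) :
    ∀ᵐ x ∂(volume.restrict Ω), Tendsto (fun n => u (q n) x) atTop (𝓝 0) := by
  obtain ⟨κ, hκ0, hκ1, hev⟩ := exists_eventually_ae_abs_le hN hΩ hΩm hlam hf hfS hstrict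
  have hbound : ∀ᶠ n in atTop, ∀ᵐ x ∂(volume.restrict Ω),
      |u (q n) x| ≤ κ ^ (1 / (q n - 1)) * (2 * barrier 0 x) := by
    filter_upwards [hq.eventually hev, hq.eventually hu] with n h1 h2
    exact h1 _ _ h2
  obtain ⟨n₀, hn₀⟩ := eventually_atTop.mp hbound
  -- The exceptional null set depends on n; a sequence allows one common null set.
  have hall : ∀ᵐ x ∂(volume.restrict Ω), ∀ n, n₀ ≤ n →
      |u (q n) x| ≤ κ ^ (1 / (q n - 1)) * (2 * barrier 0 x) := by
    rw [ae_all_iff]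
    intro n
    by_cases hn : n₀ ≤ n
    · filter_upwards [hn₀ n hn] with x hx _ using hx
    · exact ae_of_all _ fun x h => absurd h hn
  have hpow : Tendsto (fun n => κ ^ (1 / (q n - 1))) atTop (𝓝 0) := by
    refine (tendsto_rpow_atTop_of_base_lt_one κ (by linarith) hκ1).comp ?_
    have h1 : Tendsto (fun n => q n - 1) atTop (𝓝[>] 0) := by
      refine tendsto_nhdsWithin_iff.mpr ⟨?_, ?_⟩
      · have := (tendsto_nhdsWithin_iff.mp hq).1.sub_const 1
        rwa [sub_self] at this
      · filter_upwards [(tendsto_nhdsWithin_iff.mp hq).2] with n hn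
        simpa using hn
    simpa only [one_div, Function.comp_def] using tendsto_inv_nhdsGT_zero.comp h1
  filter_upwards [hall] with x hx
  refine squeeze_zero_norm' (eventually_atTop.mpr ⟨n₀, hx⟩) ?_
  simpa using hpow.mul_const (2 * barrier 0 x)

end StrictCase

/-! ### Poincaré-type estimates by translations and ball averages. -/

section Compactness

variable {N : ℕ} {Ω : Set (E N)}

/-- Translations are Lipschitz in `L¹`, with constant the `L¹` norm of the gradient. -/
theorem lintegral_enorm_translate_sub_le {φ : E N → ℝ} (hφ : ContDiff ℝ 1 φ) (z : E N) :
    ∫⁻ x, ‖φ (x + z) - φ x‖ₑ ≤ ‖z‖ₑ * ∫⁻ x, ‖gradient φ x‖ₑ := by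
  have hg := continuous_gradient hφ
  have key : ∀ x, ‖φ (x + z) - φ x‖ₑ ≤
      ∫⁻ t in Set.Ioc (0 : ℝ) 1, ‖z‖ₑ * ‖gradient φ (x + t • z)‖ₑ := by
    intro x
    have hd : ∀ t : ℝ, HasDerivAt (fun t : ℝ => φ (x + t • z)) (fderiv ℝ φ (x + t • z) z) t := by
      intro t
      have h1 : HasDerivAt (fun t : ℝ => x + t • z) z t := by
        simpa using ((hasDerivAt_id t).smul_const z).const_add x
      exact ((hφ.differentiable one_ne_zero _).hasFDerivAt).comp_hasDerivAt t h1
    have hc : Continuous fun t : ℝ => fderiv ℝ φ (x + t • z) z :=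
      ((hφ.continuous_fderiv one_ne_zero).comp (by fun_prop)).clm_apply continuous_const
    have h2 := intervalIntegral.integral_eq_sub_of_hasDerivAt (fun t _ => hd t)
      (hc.intervalIntegrable 0 1)
    simp only [one_smul, zero_smul, add_zero] at h2
    rw [← h2, intervalIntegral.integral_of_le zero_le_one]
    refine (enorm_integral_le_lintegral_enorm _).trans (lintegral_mono fun t => ?_)
    rw [mul_comm]
    refine ((fderiv ℝ φ (x + t • z)).le_opENorm z).trans_eq ?_
    rw [← ofReal_norm, ← ofReal_norm (gradient φ _), norm_gradient]
  calc ∫⁻ x, ‖φ (x + z) - φ x‖ₑ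
      ≤ ∫⁻ x, ∫⁻ t in Set.Ioc (0 : ℝ) 1, ‖z‖ₑ * ‖gradient φ (x + t • z)‖ₑ := lintegral_mono key
    _ = ∫⁻ t in Set.Ioc (0 : ℝ) 1, ∫⁻ x, ‖z‖ₑ * ‖gradient φ (x + t • z)‖ₑ := by
        refine lintegral_lintegral_swap (Continuous.aemeasurable ?_)
        have h : Continuous fun q : E N × ℝ => gradient φ (q.1 + q.2 • z) := hg.comp (by fun_prop)
        exact ENNReal.continuous_const_mul enorm_ne_top |>.comp h.enorm
    _ = ∫⁻ t in Set.Ioc (0 : ℝ) 1, ‖z‖ₑ * ∫⁻ x, ‖gradient φ x‖ₑ := by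
        refine lintegral_congr fun t => ?_
        rw [lintegral_const_mul' _ _ enorm_ne_top,
          lintegral_add_right_eq_self (fun x => ‖gradient φ x‖ₑ) (t • z)]
    _ = ‖z‖ₑ * ∫⁻ x, ‖gradient φ x‖ₑ := by simp

/-- The mean oscillation of a `C¹` function on balls of radius `r`, integrated. -/
theorem lintegral_lintegral_ball_translate_sub_le {φ : E N → ℝ} (hφ : ContDiff ℝ 1 φ) (R : ℝ) :
    ∫⁻ x, ∫⁻ z in Metric.ball 0 R, ‖φ (x + z) - φ x‖ₑ ≤
      volume (Metric.ball (0 : E N) R) * (ENNReal.ofReal R * ∫⁻ x, ‖gradient φ x‖ₑ) := by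
  have hc : Continuous fun q : E N × E N => ‖φ (q.1 + q.2) - φ q.1‖ₑ :=
    ((hφ.continuous.comp (by fun_prop)).sub (hφ.continuous.comp (by fun_prop))).enorm
  rw [lintegral_lintegral_swap hc.aemeasurable]
  refine (setLIntegral_mono' (g := fun _ => ENNReal.ofReal R * ∫⁻ x, ‖gradient φ x‖ₑ)
    measurableSet_ball fun z hz => ?_).trans_eq (by rw [setLIntegral_const, mul_comm])
  refine (lintegral_enorm_translate_sub_le hφ z).trans ?_
  gcongr
  rw [← ofReal_norm]
  exact ENNReal.ofReal_le_ofReal (mem_ball_zero_iff.mp hz).le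

/-- Any two points of a ball of radius r differ by less than 2r, so the ball about y lies in the
ball of radius 2r about x. The integral thus depends on x alone and no longer on which ball of the
cover contains it. -/
theorem enorm_sub_setAverage_ball_le {φ : E N → ℝ} (hφ : Continuous φ) {r : ℝ} (hr : 0 < r)
    {x y : E N} (hx : x ∈ Metric.ball y r) :
    ‖φ x - ⨍ w in Metric.ball y r, φ w‖ₑ ≤
      (volume (Metric.ball (0 : E N) r))⁻¹ *
        ∫⁻ z in Metric.ball 0 (2 * r), ‖φ (x + z) - φ x‖ₑ := by
  have hv0 : volume (Metric.ball y r) ≠ 0 := (Metric.measure_ball_pos _ _ hr).ne'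
  have hvt : volume (Metric.ball y r) ≠ ⊤ := measure_ball_lt_top.ne
  have hi : IntegrableOn φ (Metric.ball y r) :=
    (hφ.continuousOn.integrableOn_compact (isCompact_closedBall y r)).mono_set Metric.ball_subset_closedBall
  have h1 : φ x - ⨍ w in Metric.ball y r, φ w = ⨍ w in Metric.ball y r, (φ x - φ w) := by
    rw [setAverage_eq, setAverage_eq, integral_sub (integrableOn_const (C := φ x) hvt) hi, setIntegral_const,
      smul_sub, smul_smul, inv_mul_cancel₀, one_smul]
    simp [Measure.real, ENNReal.toReal_eq_zero_iff, hv0, hvt]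
  have h2 : ∫⁻ w in Metric.ball y r, ‖φ x - φ w‖ₑ ≤
      ∫⁻ z in Metric.ball 0 (2 * r), ‖φ (x + z) - φ x‖ₑ := by
    rw [← lintegral_indicator measurableSet_ball, ← lintegral_indicator measurableSet_ball,
      ← lintegral_add_left_eq_self _ x]
    refine lintegral_mono fun z => ?_
    by_cases hz : x + z ∈ Metric.ball y r
    · have : z ∈ Metric.ball (0 : E N) (2 * r) := by
        rw [mem_ball_zero_iff]
        have := dist_triangle_right (x + z) x y
        rw [dist_self_add_left] at this
        rw [Metric.mem_ball] at hz hx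
        linarith
      simp only [Set.indicator_of_mem hz, Set.indicator_of_mem this]
      rw [enorm_sub_rev]
    · simp [Set.indicator_of_notMem hz]
  rw [h1, setAverage_eq, enorm_smul]
  refine mul_le_mul' (le_of_eq ?_) ((enorm_integral_le_lintegral_enorm _).trans h2)
  rw [Measure.real, ← ENNReal.toReal_inv, Real.enorm_of_nonneg ENNReal.toReal_nonneg,
    ENNReal.ofReal_toReal (ENNReal.inv_ne_top.mpr hv0),
    Measure.addHaar_ball_center volume y r]

/-- The `L¹` norm is controlled by the gradient and by finitely many averages. -/
theorem lintegral_enorm_le_gradient_add_averages (hΩm : MeasurableSet Ω) {φ : E N → ℝ}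
    (hφ : ContDiff ℝ 1 φ) {r : ℝ} (hr : 0 < r) {t : Finset (E N)} (ht : Ω ⊆ ⋃ y ∈ t, Metric.ball y r) :
    ∫⁻ x in Ω, ‖φ x‖ₑ ≤ 2 ^ N * (ENNReal.ofReal (2 * r) * ∫⁻ x, ‖gradient φ x‖ₑ) +
      (∑ y ∈ t, ‖⨍ w in Metric.ball y r, φ w‖ₑ) * volume Ω := by
  have hv0 : volume (Metric.ball (0 : E N) r) ≠ 0 := (Metric.measure_ball_pos _ _ hr).ne'
  have hvt : volume (Metric.ball (0 : E N) r) ≠ ⊤ := measure_ball_lt_top.ne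
  -- The price of the doubled radius is this ratio 2^N, uniform in r.
  have hball : volume (Metric.ball (0 : E N) (2 * r)) =
      2 ^ N * volume (Metric.ball (0 : E N) r) := by
    have h := Measure.addHaar_ball_mul_of_pos volume (0 : E N) (two_pos : (0 : ℝ) < 2) r
    rw [finrank_euclideanSpace_fin, ENNReal.ofReal_pow zero_le_two] at h
    simpa using h
  set G : E N → ℝ≥0∞ := fun x => (volume (Metric.ball (0 : E N) r))⁻¹ *
        ∫⁻ z in Metric.ball 0 (2 * r), ‖φ (x + z) - φ x‖ₑ with hG
  set A := ∑ y ∈ t, ‖⨍ w in Metric.ball y r, φ w‖ₑ with hA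
  have hpt : ∀ x ∈ Ω, ‖φ x‖ₑ ≤ G x + A := by
    intro x hx
    obtain ⟨y, hy, hxy⟩ : ∃ y ∈ t, x ∈ Metric.ball y r := by simpa using ht hx
    calc ‖φ x‖ₑ = ‖(φ x - ⨍ w in Metric.ball y r, φ w) + ⨍ w in Metric.ball y r, φ w‖ₑ := by
          rw [sub_add_cancel]
      _ ≤ _ := enorm_add_le _ _
      _ ≤ G x + A := add_le_add (enorm_sub_setAverage_ball_le hφ.continuous hr hxy)
          (Finset.single_le_sum (f := fun y => ‖⨍ w in Metric.ball y r, φ w‖ₑ)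
            (fun _ _ => zero_le) hy)
  calc ∫⁻ x in Ω, ‖φ x‖ₑ ≤ ∫⁻ x in Ω, (G x + A) := setLIntegral_mono' hΩm hpt
    _ = (∫⁻ x in Ω, G x) + A * volume Ω := by
        rw [lintegral_add_right _ measurable_const, setLIntegral_const]
    _ ≤ _ := by
        gcongr
        refine (setLIntegral_le_lintegral _ _).trans ?_
        rw [hG, lintegral_const_mul' _ _ (ENNReal.inv_ne_top.mpr hv0)]
        refine (mul_le_mul_right (lintegral_lintegral_ball_translate_sub_le hφ (2 * r)) _).trans_eq ?_
        rw [hball, mul_comm (2 ^ N), mul_assoc (volume _), ← mul_assoc, ENNReal.inv_mul_cancel hv0 hvt,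
          one_mul]

end Compactness

/-! ### Rellich compactness in L¹. -/

section Rellich

variable {N : ℕ} {Ω : Set (E N)}

/-- Finitely many balls of any given radius cover a bounded set. -/
theorem exists_finset_subset_iUnion_ball (hΩ : Bornology.IsBounded Ω) {r : ℝ} (hr : 0 < r) :
    ∃ t : Finset (E N), Ω ⊆ ⋃ y ∈ t, Metric.ball y r := by
  obtain ⟨t, ht, h⟩ := Metric.totallyBounded_iff.mp
    (hΩ.isCompact_closure.totallyBounded.subset subset_closure) r hr
  exact ⟨ht.toFinset, by simpa using h⟩

theorem abs_setAverage_ball_le {φ : E N → ℝ} {M : ℝ} (hM : ∫ x, ‖φ x‖ ≤ M)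
    (hi : Integrable φ) (y : E N) (r : ℝ) :
    |⨍ w in Metric.ball y r, φ w| ≤ (volume.real (Metric.ball y r))⁻¹ * M := by
  rw [setAverage_eq, smul_eq_mul, abs_mul, abs_of_nonneg (by positivity)]
  gcongr
  exact (norm_integral_le_integral_norm _).trans
    ((setIntegral_le_integral hi.norm (ae_of_all _ fun x => norm_nonneg _)).trans hM)

/-- Countably many bounded real sequences converge along a common subsequence. -/
theorem exists_strictMono_forall_tendsto {ι : Type*} [Countable ι] {a : ℕ → ι → ℝ} {B : ι → ℝ}
    (h : ∀ n i, |a n i| ≤ B i) :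
    ∃ σ : ℕ → ℕ, StrictMono σ ∧ ∃ b : ι → ℝ, ∀ i, Tendsto (fun n => a (σ n) i) atTop (𝓝 (b i)) := by
  obtain ⟨b, -, σ, hσ, hb⟩ := (isCompact_univ_pi fun i => isCompact_Icc (a := -B i)
    (b := B i)).tendsto_subseq (x := a) fun n i _ => abs_le.mp (h n i)
  exact ⟨σ, hσ, b, fun i => (tendsto_pi_nhds.mp hb) i⟩

/-- Rellich's theorem for test functions bounded in `W^{1,1}`. -/
theorem exists_strictMono_tendsto_of_gradient_bounded (hΩ : Bornology.IsBounded Ω)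
    (hΩm : MeasurableSet Ω) {φ : ℕ → E N → ℝ} (hφ : ∀ n, IsTestFunction Ω (φ n)) {M₀ : ℝ}
    (h0 : ∀ n, ∫ x, ‖φ n x‖ ≤ M₀) {M₁ : ℝ≥0∞} (hM₁ : M₁ ≠ ⊤)
    (h1 : ∀ n, ∫⁻ x, ‖gradient (φ n) x‖ₑ ≤ M₁) :
    ∃ σ : ℕ → ℕ, StrictMono σ ∧ ∃ v : E N → ℝ, MemLp v 1 (volume.restrict Ω) ∧
      Tendsto (fun n => eLpNorm (fun x => φ (σ n) x - v x) 1 (volume.restrict Ω)) atTop (𝓝 0) := by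
  have hfin := isFiniteMeasure_restrict_of_isBounded hΩ
  have hi : ∀ n, Integrable (φ n) := fun n => memLp_one_iff_integrable.mp ((hφ n).memLp 1 _)
  choose t ht using fun k : ℕ => exists_finset_subset_iUnion_ball hΩ
    (r := 1 / ((k : ℝ) + 1)) (by positivity)
  -- All averages at all scales 1/(k+1) form a countable family, so one subsequence makes every one
  -- of them converge.
  obtain ⟨σ, hσ, b, hb⟩ := exists_strictMono_forall_tendsto (ι := Σ k, t k)
    (a := fun n i => ⨍ w in Metric.ball (i.2 : E N) (1 / ((i.1 : ℝ) + 1)), φ n w)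
    fun n i => abs_setAverage_ball_le (h0 n) (hi n) _ _
  refine ⟨σ, hσ, ?_⟩
  have hL : ∀ n, MemLp (φ n) 1 (volume.restrict Ω) := fun n => (hφ n).memLp 1 _
  have hdiff : ∀ (m n k : ℕ), eLpNorm (φ m - φ n) 1 (volume.restrict Ω) ≤
      2 ^ N * (ENNReal.ofReal (2 * (1 / ((k : ℝ) + 1))) * (2 * M₁)) +
      (∑ y ∈ t k, ‖(⨍ w in Metric.ball y (1 / ((k : ℝ) + 1)), φ m w) -
        ⨍ w in Metric.ball y (1 / ((k : ℝ) + 1)), φ n w‖ₑ) * volume Ω := by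
    intro m n k
    have hg : ∀ x, gradient (fun x => φ m x - φ n x) x = gradient (φ m) x - gradient (φ n) x := by
      intro x
      simp only [gradient]
      rw [fderiv_fun_sub ((hφ m).contDiff_one.differentiable one_ne_zero x)
        ((hφ n).contDiff_one.differentiable one_ne_zero x), map_sub]
    rw [eLpNorm_one_eq_lintegral_enorm]
    refine (lintegral_enorm_le_gradient_add_averages hΩm
      ((hφ m).contDiff_one.sub (hφ n).contDiff_one) (by positivity) (ht k)).trans ?_
    gcongr with y hy
    · calc ∫⁻ x, ‖gradient (fun x => φ m x - φ n x) x‖ₑ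
          ≤ ∫⁻ x, (‖gradient (φ m) x‖ₑ + ‖gradient (φ n) x‖ₑ) :=
            lintegral_mono fun x => by rw [hg]; exact enorm_sub_le
        _ ≤ 2 * M₁ := by
            rw [lintegral_add_left (continuous_gradient (hφ m).contDiff_one).enorm.measurable,
              two_mul]
            exact add_le_add (h1 m) (h1 n)
    · refine le_of_eq ?_
      rw [setAverage_eq, setAverage_eq, setAverage_eq, ← smul_sub, ← integral_sub
        (hi m).integrableOn (hi n).integrableOn]
  have hcauchy : CauchySeq fun n => (hL (σ n)).toLp (φ (σ n)) := by
    rw [EMetric.cauchySeq_iff]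
    intro ε hε
    have hk : Tendsto (fun k : ℕ => 2 ^ N * (ENNReal.ofReal (2 * (1 / ((k : ℝ) + 1))) * (2 * M₁)))
        atTop (𝓝 0) := by
      have e1 : Tendsto (fun k : ℕ => ENNReal.ofReal (2 * (1 / ((k : ℝ) + 1)))) atTop (𝓝 0) := by
        have := tendsto_one_div_add_atTop_nhds_zero_nat (𝕜 := ℝ)
        simpa using ENNReal.tendsto_ofReal (this.const_mul 2)
      have e2 := ENNReal.Tendsto.mul_const e1 (b := 2 * M₁)
        (Or.inr (ENNReal.mul_ne_top ENNReal.ofNat_ne_top hM₁))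
      have e3 := ENNReal.Tendsto.const_mul e2 (a := 2 ^ N) (Or.inr (by simp))
      simpa using e3
    -- The scale is fixed first, from the gradient bound alone; at that scale only finitely many
    -- averages remain to be made small.
    obtain ⟨k, hk⟩ := (hk.eventually_lt_const (ENNReal.half_pos hε.ne')).exists
    have hs : Tendsto (fun q : ℕ × ℕ =>
        (∑ y ∈ t k, ‖(⨍ w in Metric.ball y (1 / ((k : ℝ) + 1)), φ (σ q.1) w) -
        ⨍ w in Metric.ball y (1 / ((k : ℝ) + 1)), φ (σ q.2) w‖ₑ) * volume Ω) atTop (𝓝 0) := by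
      have e1 : Tendsto (fun q : ℕ × ℕ =>
          ∑ y ∈ t k, ‖(⨍ w in Metric.ball y (1 / ((k : ℝ) + 1)), φ (σ q.1) w) -
          ⨍ w in Metric.ball y (1 / ((k : ℝ) + 1)), φ (σ q.2) w‖ₑ) atTop (𝓝 0) := by
        rw [← Finset.sum_const_zero (s := t k)]
        refine tendsto_finsetSum _ fun y hy => ?_
        have hy' := hb ⟨k, ⟨y, hy⟩⟩
        rw [← prod_atTop_atTop_eq]
        have := ((hy'.comp tendsto_fst).sub (hy'.comp tendsto_snd)).enorm
        simpa using this
      simpa using ENNReal.Tendsto.mul_const e1 (b := volume Ω) (Or.inr hΩ.measure_lt_top.ne)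
    obtain ⟨⟨n₁, n₂⟩, hn⟩ := eventually_atTop.mp
      (hs.eventually_lt_const (ENNReal.half_pos hε.ne'))
    refine ⟨max n₁ n₂, fun m hm n hn' => ?_⟩
    rw [Lp.edist_toLp_toLp]
    refine (hdiff _ _ k).trans_lt ?_
    rw [← ENNReal.add_halves ε]
    exact ENNReal.add_lt_add hk
      (hn (m, n) ⟨(le_max_left _ _).trans hm, (le_max_right _ _).trans hn'⟩)
  obtain ⟨v, hv⟩ := cauchySeq_tendsto_of_complete hcauchy
  refine ⟨v, Lp.memLp v, ?_⟩
  have := (Lp.tendsto_Lp_iff_tendsto_eLpNorm'' (fun n => φ (σ n)) (fun n => hL (σ n)) v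
    (Lp.memLp v)).mp (by simpa using hv)
  exact this

end Rellich

/-! ### Interpolation between L¹ and L^r. -/

section Interpolation

variable {α : Type*} [MeasurableSpace α] {μ : Measure α}

/-- Convergence in `L¹` together with a bound in `L^r` gives convergence in `L^s`, `1 ≤ s < r`. -/
theorem tendsto_eLpNorm_zero_of_interpolation {w : ℕ → α → ℝ} {s r : ℝ} (hs : 1 ≤ s) (hsr : s < r)
    (hw : ∀ n, AEStronglyMeasurable (w n) μ)
    (h1 : Tendsto (fun n => eLpNorm (w n) 1 μ) atTop (𝓝 0)) {K : ℝ≥0∞} (hK : K ≠ ⊤)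
    (hr : ∀ n, eLpNorm (w n) (ENNReal.ofReal r) μ ≤ K) :
    Tendsto (fun n => eLpNorm (w n) (ENNReal.ofReal s) μ) atTop (𝓝 0) := by
  have hs0 : 0 < s := by linarith
  have hr0 : 0 < r := by linarith
  -- The solution of θ + r(1 - θ) = s; it is positive because s < r, so the L¹ factor enters with a
  -- positive power.
  set θ : ℝ := (r - s) / (r - 1) with hθ
  have hθ0 : 0 < θ := div_pos (by linarith) (by linarith)
  have hθ1 : θ ≤ 1 := (div_le_one (by linarith)).mpr (by linarith)
  have hθs : θ + r * (1 - θ) = s := by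
    have : r - 1 ≠ 0 := by linarith
    rw [hθ]; field_simp; ring
  have hb : ∀ n, eLpNorm (w n) (ENNReal.ofReal s) μ ≤
      (eLpNorm (w n) 1 μ ^ θ * (K ^ r) ^ (1 - θ)) ^ (1 / s) := by
    intro n
    rw [eLpNorm_eq_lintegral_rpow_enorm_toReal (by simpa using hs0) ENNReal.ofReal_ne_top,
      ENNReal.toReal_ofReal hs0.le]
    gcongr
    have hQ : ∫⁻ x, ‖w n x‖ₑ ^ r ∂μ ≤ K ^ r := by
      have h := hr n
      rw [eLpNorm_eq_lintegral_rpow_enorm_toReal (by simpa using hr0) ENNReal.ofReal_ne_top,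
        ENNReal.toReal_ofReal hr0.le] at h
      rwa [one_div, ENNReal.rpow_inv_le_iff hr0] at h
    calc ∫⁻ x, ‖w n x‖ₑ ^ s ∂μ = ∫⁻ x, ‖w n x‖ₑ ^ θ * (‖w n x‖ₑ ^ r) ^ (1 - θ) ∂μ := by
          refine lintegral_congr fun x => ?_
          rw [← ENNReal.rpow_mul, ← ENNReal.rpow_add_of_nonneg _ _ hθ0.le
            (mul_nonneg hr0.le (by linarith)), hθs]
      _ ≤ (∫⁻ x, ‖w n x‖ₑ ∂μ) ^ θ * (∫⁻ x, ‖w n x‖ₑ ^ r ∂μ) ^ (1 - θ) :=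
          ENNReal.lintegral_mul_norm_pow_le (hw n).enorm ((hw n).enorm.pow_const r) hθ0.le
            (by linarith) (by ring)
      _ ≤ _ := by
          rw [eLpNorm_one_eq_lintegral_enorm]
          gcongr
  refine tendsto_of_tendsto_of_tendsto_of_le_of_le tendsto_const_nhds ?_ (fun _ => zero_le) hb
  have hKt : (K ^ r) ^ (1 - θ) ≠ ⊤ := ENNReal.rpow_ne_top_of_nonneg (by linarith)
    (ENNReal.rpow_ne_top_of_nonneg hr0.le hK)
  have e1 := (ENNReal.continuous_rpow_const (y := θ)).tendsto 0 |>.comp h1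
  rw [ENNReal.zero_rpow_of_pos hθ0] at e1
  have e2 := ENNReal.Tendsto.mul_const e1 (Or.inr hKt)
  have e3 := (ENNReal.continuous_rpow_const (y := 1 / s)).tendsto _ |>.comp e2
  rwa [zero_mul, ENNReal.zero_rpow_of_pos (by positivity)] at e3

/-- An `L^r` bound passes to the limit in `L¹`. -/
theorem eLpNorm_le_of_tendsto_eLpNorm_one {w : ℕ → α → ℝ} {v : α → ℝ} {r K : ℝ≥0∞}
    (hw : ∀ n, AEStronglyMeasurable (w n) μ) (hv : AEStronglyMeasurable v μ)
    (h1 : Tendsto (fun n => eLpNorm (fun x => w n x - v x) 1 μ) atTop (𝓝 0))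
    (hr : ∀ n, eLpNorm (w n) r μ ≤ K) : eLpNorm v r μ ≤ K := by
  obtain ⟨τ, -, hτ⟩ := (tendstoInMeasure_of_tendsto_eLpNorm one_ne_zero hw hv h1).exists_seq_tendsto_ae
  refine (Lp.eLpNorm_lim_le_liminf_eLpNorm (fun n => hw (τ n)) v hτ).trans ?_
  exact (liminf_le_liminf (Eventually.of_forall fun n => hr (τ n))).trans_eq (liminf_const K)

end Interpolation

/-! ### Lower semicontinuity of the total variation. -/

section BoundedVariation

variable {N : ℕ} {Ω : Set (E N)}

theorem continuous_divergence {ψ : E N → E N} (hψ : ContDiff ℝ 1 ψ) : Continuous (divergence ψ) := by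
  refine continuous_finsetSum _ fun i _ => ?_
  have h : Continuous fun x => fderiv ℝ ψ x (EuclideanSpace.single i 1) :=
    (hψ.continuous_fderiv one_ne_zero).clm_apply continuous_const
  exact (EuclideanSpace.proj (𝕜 := ℝ) i).continuous.comp h

theorem hasCompactSupport_divergence {ψ : E N → E N} (hψ : HasCompactSupport ψ) :
    HasCompactSupport (divergence ψ) :=
  (hψ.fderiv ℝ).comp_left (g := fun L : E N →L[ℝ] E N =>
    ∑ i : Fin N, L (EuclideanSpace.single i 1) i) (by simp)

/-- Integration by parts against a vector field. -/
theorem IsTestFunction.setIntegral_mul_divergence {φ : E N → ℝ} (hφ : IsTestFunction Ω φ)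
    {ψ : E N → E N} (hψ : ContDiff ℝ 1 ψ) :
    ∫ x in Ω, φ x * divergence ψ x = - ∫ x in Ω, inner ℝ (gradient φ x) (ψ x) := by
  have hψi : ∀ i, ContDiff ℝ 1 fun x => ψ x i := fun i =>
    (EuclideanSpace.proj (𝕜 := ℝ) i).contDiff.comp hψ
  have hd : ∀ i x, fderiv ℝ ψ x (EuclideanSpace.single i 1) i =
      fderiv ℝ (fun x => ψ x i) x (EuclideanSpace.single i 1) := by
    intro i x
    have h := ((EuclideanSpace.proj (𝕜 := ℝ) i).hasFDerivAt.comp x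
      (hψ.differentiable one_ne_zero x).hasFDerivAt).fderiv
    have h' : fderiv ℝ (fun x => ψ x i) x = _ := h
    rw [h']
    rfl
  have hc1 : ∀ i : Fin N, Continuous fun x =>
      fderiv ℝ (fun x => ψ x i) x (EuclideanSpace.single i 1) := fun i =>
    ((hψi i).continuous_fderiv one_ne_zero).clm_apply continuous_const
  have hg := continuous_gradient hφ.contDiff_one
  have hi1 : ∀ i : Fin N, Integrable (fun x => φ x *
      fderiv ℝ (fun x => ψ x i) x (EuclideanSpace.single i 1)) (volume.restrict Ω) := fun i =>
    ((hφ.1.continuous.mul (hc1 i)).integrable_of_hasCompactSupport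
      hφ.2.1.mul_right).integrableOn
  have hi2 : ∀ i : Fin N, Integrable (fun x =>
      inner ℝ (gradient φ x) (EuclideanSpace.single i (1 : ℝ)) * ψ x i) (volume.restrict Ω) := by
    intro i
    refine (((hg.inner continuous_const).mul (hψi i).continuous).integrable_of_hasCompactSupport
      (HasCompactSupport.mul_right ?_)).integrableOn
    exact (hasCompactSupport_gradient hφ.2.1).comp_left
      (g := fun y : E N => inner ℝ y (EuclideanSpace.single i (1 : ℝ))) (inner_zero_left _)
  simp only [divergence, hd, Finset.mul_sum]
  rw [integral_finsetSum _ fun i _ => hi1 i]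
  simp_rw [fun i => hφ.setIntegral_mul_fderiv (hψi i) (EuclideanSpace.single i 1)]
  rw [Finset.sum_neg_distrib, ← integral_finsetSum _ fun i _ => hi2 i]
  congr 2 with x
  generalize gradient φ x = g
  simp [PiLp.inner_apply, mul_comm]

/-- An `L¹` limit of test functions with bounded gradients has bounded variation. -/
theorem memBV_of_tendsto {φ : ℕ → E N → ℝ} (hφ : ∀ n, IsTestFunction Ω (φ n)) {M : ℝ≥0∞}
    (hM : M ≠ ⊤) (h1 : ∀ n, ∫⁻ x, ‖gradient (φ n) x‖ₑ ≤ M) {v : E N → ℝ}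
    (hv : MemLp v 1 (volume.restrict Ω))
    (h : Tendsto (fun n => eLpNorm (fun x => φ n x - v x) 1 (volume.restrict Ω)) atTop (𝓝 0)) :
    MemBV Ω v := by
  -- For each fixed field the divergence is bounded, so L¹ convergence passes to the limit in the
  -- pairing, and integration by parts bounds each pairing by M.
  refine ⟨hv, lt_of_le_of_lt (iSup₂_le fun ψ hψ => ?_) hM.lt_top⟩
  obtain ⟨hψ1, hψc, -, hψb⟩ := hψ
  obtain ⟨C, hC⟩ := (hasCompactSupport_divergence hψc).exists_bound_of_continuous
    (continuous_divergence hψ1)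
  have ht := tendsto_integral_mul_of_tendsto_eLpNorm
    (fun n => memLp_one_iff_integrable.mp ((hφ n).memLp 1 _)) (memLp_one_iff_integrable.mp hv) h
    (continuous_divergence hψ1).aestronglyMeasurable hC
  refine ENNReal.ofReal_le_of_le_toReal (le_of_tendsto' ht fun n => ?_)
  rw [(hφ n).setIntegral_mul_divergence hψ1]
  refine (neg_le_abs _).trans ?_
  rw [← Real.norm_eq_abs]
  refine (norm_integral_le_lintegral_norm _).trans 
    (ENNReal.toReal_mono hM (le_trans ?_ (h1 n)))
  refine (lintegral_mono fun x => ?_).trans (setLIntegral_le_lintegral Ω _)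
  rw [ofReal_norm, ← ofReal_norm (gradient _ _), ← ofReal_norm (inner ℝ _ _)]
  refine ENNReal.ofReal_le_ofReal ((norm_inner_le_norm _ _).trans ?_)
  exact mul_le_of_le_one_right (norm_nonneg _) (hψb x)

end BoundedVariation

/-! ### Compactness for sequences in W_0^{1,p_n} with varying exponents. -/

section Solutions

variable {N : ℕ} {Ω : Set (E N)}

/-- Approximation of an element of `W_0^{1,p}(Ω)` by a test function, in `W^{1,1}`. -/
theorem MemW1p0.exists_isTestFunction_eLpNorm_sub_le (hΩ : Bornology.IsBounded Ω) {p : ℝ}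
    (hp : 1 ≤ p) {u : E N → ℝ} {Du : E N → E N} (hu : MemW1p0 Ω p u Du) {ε : ℝ≥0∞} (hε : 0 < ε) :
    ∃ φ : E N → ℝ, IsTestFunction Ω φ ∧
      eLpNorm (fun x => φ x - u x) 1 (volume.restrict Ω) ≤ ε ∧
      eLpNorm (fun x => gradient φ x - Du x) 1 (volume.restrict Ω) ≤ ε := by
  have := isFiniteMeasure_restrict_of_isBounded hΩ
  have hp' : (1 : ℝ≥0∞) ≤ ENNReal.ofReal p := by simpa using ENNReal.ofReal_le_ofReal hp
  obtain ⟨φ, hφ, h0, h1⟩ := hu.approx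
  have e0 := tendsto_eLpNorm_zero_of_exponent_le hp'
    (fun n => ((hφ n).memLp 1 _).1.sub hu.memLp.1) h0 one_ne_zero
  have e1 := tendsto_eLpNorm_zero_of_exponent_le hp'
    (fun n => ((hφ n).memLp_gradient 1 _).1.sub hu.memLp_grad.1) h1 one_ne_zero
  obtain ⟨n, hn0, hn1⟩ := ((ENNReal.tendsto_nhds_zero.mp e0 ε hε).and
    (ENNReal.tendsto_nhds_zero.mp e1 ε hε)).exists
  exact ⟨φ n, hφ n, hn0, hn1⟩

/-- A sequence with gradients bounded in `L¹` has a subsequence converging in `L^s(Ω)`,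
`1 ≤ s < 1^*`, to a function of bounded variation. -/
theorem exists_strictMono_tendsto_memBV (hN : 2 ≤ N) (hΩ : Bornology.IsBounded Ω)
    (hΩm : MeasurableSet Ω) {p : ℕ → ℝ} (hp : ∀ n, 1 ≤ p n) {u : ℕ → E N → ℝ}
    {Du : ℕ → E N → E N} (hu : ∀ n, MemW1p0 Ω (p n) (u n) (Du n)) {C : ℝ≥0∞} (hC : C ≠ ⊤)
    (hDu : ∀ n, eLpNorm (Du n) 1 (volume.restrict Ω) ≤ C) :
    ∃ σ : ℕ → ℕ, StrictMono σ ∧ ∃ v : E N → ℝ, MemBV Ω v ∧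
      ∀ s ∈ Set.Ico 1 ((N : ℝ) / ((N : ℝ) - 1)),
        Tendsto (fun n => eLpNorm (fun x => u (σ n) x - v x) (ENNReal.ofReal s)
          (volume.restrict Ω)) atTop (𝓝 0) := by
  have hfin := isFiniteMeasure_restrict_of_isBounded hΩ
  have hQ1 : (1 : ℝ≥0∞) ≤ sobolevExp N := by
    simpa using ENNReal.ofReal_le_ofReal (one_lt_sobolev_ratio hN).le
  -- Test functions within 1/(n+1) in W^{1,1} replace the u n: they remove the varying exponent and
  -- have the same L¹ limits.
  choose φ hφ hφ0 hφ1 using fun n => (hu n).exists_isTestFunction_eLpNorm_sub_le hΩ (hp n)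
    (ε := ((n : ℝ≥0∞) + 1)⁻¹) (by simp)
  have hε1 : ∀ n : ℕ, ((n : ℝ≥0∞) + 1)⁻¹ ≤ 1 := fun n => by simp
  have hε : Tendsto (fun n : ℕ => ((n : ℝ≥0∞) + 1)⁻¹) atTop (𝓝 0) := by
    have := (tendsto_add_atTop_iff_nat 1).mpr ENNReal.tendsto_inv_nat_nhds_zero
    simpa using this
  have hM : C + 1 ≠ ⊤ := by simpa using hC
  have hgrad : ∀ n, eLpNorm (gradient (φ n)) 1 (volume.restrict Ω) ≤ C + 1 := by
    intro n
    calc eLpNorm (gradient (φ n)) 1 (volume.restrict Ω)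
        = eLpNorm (Du n + fun x => gradient (φ n) x - Du n x) 1 (volume.restrict Ω) := by
          congr 1; ext1 x; simp
      _ ≤ eLpNorm (Du n) 1 (volume.restrict Ω) +
          eLpNorm (fun x => gradient (φ n) x - Du n x) 1 (volume.restrict Ω) :=
          eLpNorm_add_le (hu n).memLp_grad.1
            (((hφ n).memLp_gradient 1 _).1.sub (hu n).memLp_grad.1) le_rfl
      _ ≤ C + 1 := add_le_add (hDu n) ((hφ1 n).trans (hε1 n))
  have hgrad' : ∀ n, ∫⁻ x, ‖gradient (φ n) x‖ₑ ≤ C + 1 := fun n => by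
    rw [← eLpNorm_one_eq_lintegral_enorm, ← (hφ n).eLpNorm_gradient_restrict]
    exact hgrad n
  set K := (gnsConst N : ℝ≥0∞) * (C + 1) with hK
  have hKt : K ≠ ⊤ := ENNReal.mul_ne_top ENNReal.coe_ne_top hM
  have hφK : ∀ n, eLpNorm (φ n) (sobolevExp N) (volume.restrict Ω) ≤ K := fun n =>
    ((hφ n).eLpNorm_le_gnsConst hN).trans (mul_le_mul_right (hgrad n) _)
  have huK : ∀ n, eLpNorm (u n) (sobolevExp N) (volume.restrict Ω) ≤ K := fun n =>
    ((hu n).eLpNorm_le_gnsConst hN hΩ (hp n)).trans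
      (mul_le_mul_right ((hDu n).trans le_self_add) _)
  set L := K * (volume.restrict Ω) Set.univ ^ (1 / (1 : ℝ≥0∞).toReal - 1 / (sobolevExp N).toReal)
    with hL
  have hLt : L ≠ ⊤ := by
    refine ENNReal.mul_ne_top hKt (ENNReal.rpow_ne_top_of_nonneg ?_ (measure_ne_top _ _))
    rw [ENNReal.toReal_one, sub_nonneg, ENNReal.toReal_ofReal
      (zero_le_one.trans (one_lt_sobolev_ratio hN).le)]
    exact one_div_le_one_div_of_le one_pos (one_lt_sobolev_ratio hN).le
  have hφL : ∀ n, ∫ x, ‖φ n x‖ ≤ L.toReal := by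
    intro n
    have h : eLpNorm (φ n) 1 volume ≤ L := by
      rw [← eLpNorm_restrict_eq_of_support_subset (s := Ω)
        fun x hx => by_contra fun hx' => hx ((hφ n).eq_zero hx')]
      exact (eLpNorm_le_eLpNorm_mul_rpow_measure_univ hQ1 ((hφ n).memLp 1 _).1).trans
        (mul_le_mul_left (hφK n) _)
    rw [integral_norm_eq_lintegral_enorm ((hφ n).memLp 1 _).1, ← eLpNorm_one_eq_lintegral_enorm]
    exact ENNReal.toReal_mono hLt h
  obtain ⟨σ, hσ, v, hv, hlim⟩ := exists_strictMono_tendsto_of_gradient_bounded hΩ hΩm hφ hφL hM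
    hgrad'
  refine ⟨σ, hσ, v, memBV_of_tendsto (fun n => hφ (σ n)) hM (fun n => hgrad' _) hv hlim, ?_⟩
  have hum : ∀ n, AEStronglyMeasurable (u n) (volume.restrict Ω) := fun n => (hu n).memLp.1
  have hvK : eLpNorm v (sobolevExp N) (volume.restrict Ω) ≤ K :=
    eLpNorm_le_of_tendsto_eLpNorm_one (fun n => ((hφ (σ n)).memLp 1 _).1) hv.1 hlim
      fun n => hφK _
  have hlim' : Tendsto (fun n => eLpNorm (fun x => u (σ n) x - v x) 1 (volume.restrict Ω))
      atTop (𝓝 0) := by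
    have hsum := hlim.add (hε.comp hσ.tendsto_atTop)
    rw [add_zero] at hsum
    refine tendsto_of_tendsto_of_tendsto_of_le_of_le tendsto_const_nhds hsum (fun _ => zero_le)
      fun n => ?_
    calc eLpNorm (fun x => u (σ n) x - v x) 1 (volume.restrict Ω)
        = eLpNorm ((fun x => φ (σ n) x - v x) - fun x => φ (σ n) x - u (σ n) x) 1
          (volume.restrict Ω) := by congr 1; ext1 x; simp
      _ ≤ _ := eLpNorm_sub_le (((hφ (σ n)).memLp 1 _).1.sub hv.1)
          (((hφ (σ n)).memLp 1 _).1.sub (hum _)) le_rfl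
      _ ≤ _ := add_le_add le_rfl (hφ0 _)
  -- The differences tend to 0 in L¹ and are bounded by 2K in L^{1*}; the limit inherits the bound K
  -- by Fatou.
  intro s hs
  refine tendsto_eLpNorm_zero_of_interpolation hs.1 hs.2 (fun n => (hum _).sub hv.1) hlim'
    (K := K + K) (by simpa using hKt) fun n => ?_
  exact (eLpNorm_sub_le (hum _) hv.1 hQ1).trans (add_le_add (huK _) hvK)

end Solutions

end HardyOneLaplace

/-! ### The two cases assembled. -/

theorem theorem3p2 (N : ℕ) (hN : 2 ≤ N)
    (Ω : Set (HardyOneLaplace.E N)) (hΩ_open : IsOpen Ω) (hΩ_bdd : Bornology.IsBounded Ω)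
    (hΩ_zero : (0 : HardyOneLaplace.E N) ∈ Ω)
    (lam : ℝ) (hlam_pos : 0 < lam) (hlam_lt : lam < (N : ℝ) - 1)
    (f : HardyOneLaplace.E N → ℝ) (hf : MemLp f (N : ℝ≥0∞) (volume.restrict Ω))
    (pbar : ℝ) (hpbar_one : 1 < pbar) (hpbar_N : pbar < (N : ℝ))
    (hpbar_lam : ∀ p ∈ Set.Ioc 1 pbar, lam < (((N : ℝ) - p) / p) ^ p)
    (u : ℝ → HardyOneLaplace.E N → ℝ) (Du : ℝ → HardyOneLaplace.E N → HardyOneLaplace.E N)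
    (hu : ∀ p ∈ Set.Ioc 1 pbar, HardyOneLaplace.IsWeakSolution Ω lam f p (u p) (Du p)) :
    (eLpNorm f (N : ℝ≥0∞) (volume.restrict Ω) * HardyOneLaplace.sobolevConst N
        + ENNReal.ofReal (lam / ((N : ℝ) - 1)) < 1 →
      Tendsto (fun p => eLpNorm (u p) (ENNReal.ofReal ((N : ℝ) / ((N : ℝ) - 1)))
        (volume.restrict Ω)) (𝓝[>] 1) (𝓝 0) ∧
      ∀ q : ℕ → ℝ, Tendsto q atTop (𝓝[>] 1) →
        ∀ᵐ x ∂(volume.restrict Ω), Tendsto (fun n => u (q n) x) atTop (𝓝 0)) ∧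
    (eLpNorm f (N : ℝ≥0∞) (volume.restrict Ω) * HardyOneLaplace.sobolevConst N
        + ENNReal.ofReal (lam / ((N : ℝ) - 1)) = 1 →
      (∃ C : ℝ, ∀ p ∈ Set.Ioc 1 pbar, ∫ x in Ω, ‖Du p x‖ ^ p ≤ C) ∧
      ∀ q : ℕ → ℝ, Tendsto q atTop (𝓝[>] 1) →
        ∃ σ : ℕ → ℕ, StrictMono σ ∧ ∃ v : HardyOneLaplace.E N → ℝ, HardyOneLaplace.MemBV Ω v ∧
          ∀ s ∈ Set.Ico 1 ((N : ℝ) / ((N : ℝ) - 1)),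
            Tendsto (fun n => eLpNorm (fun x => u (q (σ n)) x - v x) (ENNReal.ofReal s)
              (volume.restrict Ω)) atTop (𝓝 0)) := by
  have hN' : (1 : ℝ) < N := by exact_mod_cast hN
  have hlam0 : 0 ≤ lam / ((N : ℝ) - 1) := div_nonneg hlam_pos.le (by linarith)
  have hfS : ∀ {c : ℝ≥0∞}, c ≤ 1 → eLpNorm f (N : ℝ≥0∞) (volume.restrict Ω) *
      HardyOneLaplace.sobolevConst N + ENNReal.ofReal (lam / ((N : ℝ) - 1)) = c →
      eLpNorm f (N : ℝ≥0∞) (volume.restrict Ω) * HardyOneLaplace.sobolevConst N ≠ ⊤ := by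
    intro c hc h
    exact ((le_self_add.trans_eq h).trans_lt (hc.trans_lt ENNReal.one_lt_top)).ne
  have hreal : ∀ {c : ℝ≥0∞}, c ≤ 1 → eLpNorm f (N : ℝ≥0∞) (volume.restrict Ω) *
      HardyOneLaplace.sobolevConst N + ENNReal.ofReal (lam / ((N : ℝ) - 1)) = c →
      (eLpNorm f (N : ℝ≥0∞) (volume.restrict Ω) * HardyOneLaplace.sobolevConst N).toReal +
        lam / ((N : ℝ) - 1) = c.toReal := by
    intro c hc h
    rw [← h, ENNReal.toReal_add (hfS hc h) ENNReal.ofReal_ne_top, ENNReal.toReal_ofReal hlam0]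
  have hIoc : ∀ᶠ p in 𝓝[>] (1 : ℝ), p ∈ Set.Ioc 1 pbar := Ioc_mem_nhdsGT hpbar_one
  refine ⟨fun h => ?_, fun h => ?_⟩
  · have hstrict := hreal h.le rfl
    have hlt := (ENNReal.toReal_lt_toReal (h.trans ENNReal.one_lt_top).ne ENNReal.one_ne_top).mpr h
    rw [ENNReal.toReal_one, ← hstrict] at hlt
    have hu' := hIoc.mono hu
    exact ⟨HardyOneLaplace.tendsto_eLpNorm_solution_zero hN hΩ_bdd hlam_pos.le hf (hfS h.le rfl)
        hlt hu', fun q hq => HardyOneLaplace.ae_tendsto_solution_zero hN hΩ_bdd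
        hΩ_open.measurableSet hlam_pos.le hf (hfS h.le rfl) hlt hu' hq⟩
  · have hextreme := hreal le_rfl h
    rw [ENNReal.toReal_one] at hextreme
    obtain ⟨C, hC⟩ := HardyOneLaplace.exists_energy_bound hN hΩ_bdd hlam_pos.le hlam_lt hf
      (hfS le_rfl h) hextreme hpbar_one hpbar_N fun p hp =>
        HardyOneLaplace.mul_hardyConst_lt_one (by linarith [hp.1]) (hp.2.trans_lt hpbar_N)
          (hpbar_lam p hp)
    refine ⟨⟨C, fun p hp => hC p hp _ _ (hu p hp)⟩, fun q hq => ?_⟩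
    -- Only a tail of the sequence need lie in (1, p̄], so compactness is applied to the shifted
    -- sequence and the shift is put back into the extraction.
    obtain ⟨n₀, hn₀⟩ := eventually_atTop.mp (hq.eventually hIoc)
    have hq' : ∀ n, q (n + n₀) ∈ Set.Ioc 1 pbar := fun n => hn₀ _ (Nat.le_add_left _ _)
    have hfin := HardyOneLaplace.isFiniteMeasure_restrict_of_isBounded hΩ_bdd
    obtain ⟨σ, hσ, v, hv, hlim⟩ := HardyOneLaplace.exists_strictMono_tendsto_memBV hN hΩ_bdd
      hΩ_open.measurableSet (fun n => (hq' n).1.le) (fun n => (hu _ (hq' n)).mem)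
      (C := ENNReal.ofReal (C + (volume.restrict Ω).real Set.univ)) ENNReal.ofReal_ne_top
      fun n => by
        have hp := (hq' n).1
        have hmem := (hu _ (hq' n)).mem
        have hi := memLp_one_iff_integrable.mp (hmem.memLp_one_grad hΩ_bdd hp.le)
        rw [eLpNorm_one_eq_lintegral_enorm, ← ofReal_integral_norm_eq_lintegral_enorm hi]
        refine ENNReal.ofReal_le_ofReal ?_
        calc ∫ x in Ω, ‖Du (q (n + n₀)) x‖
            ≤ ∫ x in Ω, (‖Du (q (n + n₀)) x‖ ^ q (n + n₀) + 1) :=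
              integral_mono hi.norm ((hmem.integrable_norm_rpow hp.le).add (integrable_const 1))
                fun x => by
                  -- With a = b = 1 this is t ≤ t^p + 1, which bounds the L¹ norms of the gradients
                  -- uniformly in p.
                  have := HardyOneLaplace.le_rpow_mul_rpow_add hp one_pos
                    (norm_nonneg (Du (q (n + n₀)) x)) (b := 1) (by simp)
                  simpa using this
          _ = (∫ x in Ω, ‖Du (q (n + n₀)) x‖ ^ q (n + n₀)) + (volume.restrict Ω).real Set.univ := by
              rw [integral_add (hmem.integrable_norm_rpow hp.le) (integrable_const 1)]
              simp
          _ ≤ _ := add_le_add (hC _ (hq' n) _ _ (hu _ (hq' n))) le_rfl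
    exact ⟨fun n => σ n + n₀, hσ.add_const n₀, v, hv, hlim⟩
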